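/- Let $c_L, c_{L,I}\in\mathbb{C}$ with $c_{L,I}\neq 0$, and put $c_W=-24c_{L,I}^2$. The twisted Heisenberg–Virasoro algebra $\mathcal{H}$ is the complex Lie algebra with basis $L(n), I(n)$ $(n\in\mathbb{Z})$, $C_L, C_{LI}, C_I$, the last three central, and $$[L(n),L(m)]=(n-m)L(n+m)+\delta_{n,-m}\tfrac{n^3-n}{12}C_L,\quad [L(n),I(m)]=-mI(n+m)-\delta_{n,-m}(n^2+n)C_{LI},\quad [I(n),I(m)]=n\delta_{n,-m}C_I .$$ The Lie algebra $W(2,2)$ has basis $L(n), W(n)$ $(n\in\mathbb{Z})$, $C, C_W$, the last two central, and $$[L(n),L(m)]=(n-m)L(n+m)+\delta_{n,-m}\tfrac{n^3-n}{12}C,\quad [L(n),W(m)]=(n-m)W(n+m)+\delta_{n,-m}\tfrac{n^3-n}{12}C_W,\quad [W(n),W(m)]=0 .$$ Let $V^{\mathrm{HVir}}(c_L,0,c_{L,I},h,h_I)$ be the Verma module of $\mathcal{H}$ on which $C_L,C_I,C_{LI}$ act by $c_L,0,c_{L,I}$ and whose highest weight vector $v_{h,h_I}$ satisfies $L(0)v_{h,h_I}=hv_{h,h_I}$,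 $I(0)v_{h,h_I}=h_Iv_{h,h_I}$; let $V^{W(2,2)}(c_L,c_W,h,h_W)$ be the Verma module of $W(2,2)$ on which $C,C_W$ act by $c_L,c_W$ and whose highest weight vector $v_{h,h_W}$ satisfies $L(0)v_{h,h_W}=hv_{h,h_W}$, $W(0)v_{h,h_W}=h_Wv_{h,h_W}$. Let $L^{\mathrm{HVir}}(c_L,c_{L,I})$ be the irreducible quotient of $V^{\mathrm{HVir}}(c_L,0,c_{L,I},0,0)$, with $\mathbf{1}$ the image of the highest weight vector, and let $L^{W(2,2)}(c_L,c_W)$ be the universal vacuum module, the quotient of $U(W(2,2))$ by the left ideal generated by $L(n),W(n)$ $(n\ge -1)$, $C-c_L$, $C_W-c_W$, with $\mathbf{1}$ the image of $1$. **Theorem.** (0) $L^{W(2,2)}(c_L,c_W)$ carries a unique vertex algebra structure with vacuum $\mathbf{1}$ such that, for $\omega=L(-2)\mathbf{1}$ and $w=W(-2)\mathbf{1}$, $Y(\omega,z)=\sum_n L(n)z^{-n-2}$ and $Y(w,z)=\sum_n W(n)z^{-n-2}$. Likewise $L^{\mathrm{HVir}}(c_L,c_{L,I})$ carries a unique vertex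 algebra structure with vacuum $\mathbf{1}$ such that $Y(L(-2)\mathbf{1},z)=\sum_n L(n)z^{-n-2}$ and $Y(I(-1)\mathbf{1},z)=\sum_n I(n)z^{-n-1}$. (1) There is a non-trivial (that is, nonzero) homomorphism of vertex algebras $$\Psi: L^{W(2,2)}(c_L,c_W)\to L^{\mathrm{HVir}}(c_L,c_{L,I}),\qquad \omega\mapsto L(-2)\mathbf{1},\qquad w\mapsto (I(-1)^2+2c_{L,I}I(-2))\mathbf{1}.$$ (2) Let $h,h_I\in\mathbb{C}$ and $h_W=h_I(h_I-2c_{L,I})$. The action of $\mathcal{H}$ on $V^{\mathrm{HVir}}(c_L,0,c_{L,I},h,h_I)$ extends to a unique structure of $L^{\mathrm{HVir}}(c_L,c_{L,I})$-module (that is, $L(-2)\mathbf{1}$ and $I(-1)\mathbf{1}$ act by $\sum_n L(n)z^{-n-2}$ and $\sum_n I(n)z^{-n-1}$). Restrict it along $\Psi$ to an $L^{W(2,2)}(c_L,c_W)$-module, and let $L(n),W(n)\in W(2,2)$ act by the coefficients of $z^{-n-2}$ in the fields of $\omega$ and $w$. There is a homomorphism of $W(2,2)$-modules $$V^{W(2,2)}(c_L,c_W,h,h_W)\to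 V^{\mathrm{HVir}}(c_L,0,c_{L,I},h,h_I),\qquad v_{h,h_W}\mapsto v_{h,h_I},$$ and if $\frac{h_I}{c_{L,I}}-1\notin\{-1,-2,-3,\dots\}$, it is an isomorphism. -/

import Mathlib

noncomputable section

/-! ### Lie algebras given by structure constants on a basis -/

/-- The bilinear extension of structure constants `br i j` given on a basis. -/
def bracketExt {ι : Type} (br : ι → ι → (ι →₀ ℂ)) :
    (ι →₀ ℂ) →ₗ[ℂ] (ι →₀ ℂ) →ₗ[ℂ] (ι →₀ ℂ) :=
  Finsupp.linearCombination ℂ fun i => Finsupp.linearCombination ℂ (br i)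

lemma bracketExt_single {ι : Type} (br : ι → ι → (ι →₀ ℂ)) (i j : ι) (a b : ℂ) :
    bracketExt br (Finsupp.single i a) (Finsupp.single j b) = (a * b) • br i j := by
  simp [bracketExt, Finsupp.linearCombination_single, smul_smul]

lemma bracketExt_skew {ι : Type} (br : ι → ι → (ι →₀ ℂ)) (h : ∀ i j, br i j = -br j i)
    (x y : ι →₀ ℂ) : bracketExt br x y = -bracketExt br y x := by
  induction x using Finsupp.induction_linear with
  | zero => simp
  | add f g hf hg => simp only [map_add, LinearMap.add_apply, hf, hg, neg_add]
  | single i a =>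
    induction y using Finsupp.induction_linear with
    | zero => simp
    | add f g hf hg => simp only [map_add, LinearMap.add_apply, hf, hg, neg_add]
    | single j b => rw [bracketExt_single, bracketExt_single, h i j, smul_neg, mul_comm]

lemma bracketExt_self {ι : Type} (br : ι → ι → (ι →₀ ℂ)) (h : ∀ i j, br i j = -br j i)
    (x : ι →₀ ℂ) : bracketExt br x x = 0 :=
  self_eq_neg.mp (bracketExt_skew br h x x)

lemma bracketExt_leibniz {ι : Type} (br : ι → ι → (ι →₀ ℂ))
    (h : ∀ i j k, bracketExt br (Finsupp.single i 1) (br j k) =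
      bracketExt br (br i j) (Finsupp.single k 1) + bracketExt br (Finsupp.single j 1) (br i k))
    (x y z : ι →₀ ℂ) :
    bracketExt br x (bracketExt br y z) =
      bracketExt br (bracketExt br x y) z + bracketExt br y (bracketExt br x z) := by
  induction x using Finsupp.induction_linear with
  | zero => simp
  | add f g hf hg => simp only [map_add, LinearMap.add_apply, hf, hg]; abel
  | single i a =>
    induction y using Finsupp.induction_linear with
    | zero => simp
    | add f g hf hg => simp only [map_add, LinearMap.add_apply, hf, hg]; abel
    | single j b =>
      induction z using Finsupp.induction_linear with
      | zero => simp
      | add f g hf hg => simp only [map_add, hf, hg]; abel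
      | single k c =>
        have e : ∀ (l : ι) (r : ℂ), Finsupp.single l r = r • Finsupp.single l (1 : ℂ) := by
          intro l r
          rw [Finsupp.smul_single, smul_eq_mul, mul_one]
        rw [e i a, e j b, e k c]
        simp only [map_smul, LinearMap.smul_apply]
        simp only [bracketExt_single, mul_one, one_smul, map_smul, LinearMap.smul_apply]
        rw [h i j k]
        module

/-! ### The twisted Heisenberg-Virasoro algebra -/

/-- Labels of the standard basis of the twisted Heisenberg-Virasoro algebra. -/
inductive HVirIdx : Type
  | L (n : ℤ)
  | I (n : ℤ)
  | CL
  | CLI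
  | CI

/-- Structure constants: `[L n, L m] = (n - m) L (n + m) + δ (n³ - n) / 12 C_L`,
`[L n, I m] = -m I (n + m) - δ (n² + n) C_LI`, `[I n, I m] = n δ C_I` with `δ = δ_{n,-m}`,
and `C_L`, `C_LI`, `C_I` central. -/
def HVirIdx.br : HVirIdx → HVirIdx → (HVirIdx →₀ ℂ)
  | .L n, .L m => .single (.L (n + m)) ((n : ℂ) - m)
      + .single .CL (if n + m = 0 then ((n : ℂ) ^ 3 - n) / 12 else 0)
  | .L n, .I m => .single (.I (n + m)) (-(m : ℂ))
      - .single .CLI (if n + m = 0 then (n : ℂ) ^ 2 + n else 0)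
  | .I n, .L m => .single (.I (n + m)) (n : ℂ)
      + .single .CLI (if n + m = 0 then (m : ℂ) ^ 2 + m else 0)
  | .I n, .I m => .single .CI (if n + m = 0 then (n : ℂ) else 0)
  | _, _ => 0

lemma HVirIdx.br_skew (i j : HVirIdx) : br i j = -br j i := by
  classical
  cases i with
  | L n =>
    cases j with
    | L m =>
      simp only [br, add_comm m n]
      ext t
      by_cases h : n + m = 0
      · obtain rfl : m = -n := by omega
        cases t <;> simp [Finsupp.single_apply] <;> (try split_ifs) <;> ring
      · cases t <;> simp [Finsupp.single_apply, h] <;> (try split_ifs) <;> ring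
    | I m => simp [br, add_comm m n, sub_eq_add_neg, add_comm]
    | _ => simp [br]
  | I n =>
    cases j with
    | L m => simp [br, add_comm m n, sub_eq_add_neg, add_comm]
    | I m =>
      simp only [br, add_comm m n]
      by_cases h : n + m = 0
      · obtain rfl : m = -n := by omega
        simp
      · simp [h]
    | _ => simp [br]
  | _ => cases j <;> simp [br]

lemma HVirIdx.br_jacobi (i j k : HVirIdx) :
    bracketExt br (Finsupp.single i 1) (br j k) =
      bracketExt br (br i j) (Finsupp.single k 1) +
        bracketExt br (Finsupp.single j 1) (br i k) := by
  classical
  cases i <;> cases j <;> cases k <;>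
    simp only [br, bracketExt_single, map_add, map_sub, map_zero, LinearMap.add_apply,
      LinearMap.sub_apply, LinearMap.zero_apply, smul_zero, add_zero, sub_zero]
  all_goals
    rename_i a b c
    try rw [add_left_comm b a c]
    try rw [add_assoc a b c]
    ext t
    by_cases h : a + (b + c) = 0
    · obtain rfl : c = -a - b := by omega
      cases t <;> simp [Finsupp.single_apply, h] <;> (try split_ifs) <;> ring
    · cases t <;> simp [Finsupp.single_apply, h] <;> (try split_ifs) <;> ring

/-- The twisted Heisenberg-Virasoro algebra: the complex Lie algebra with basis
`L n`, `I n` (`n : ℤ`), `C_L`, `C_LI`, `C_I` and the brackets `HVirIdx.br`. -/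
def HVir : Type := HVirIdx →₀ ℂ

namespace HVir

instance : AddCommGroup HVir := inferInstanceAs (AddCommGroup (HVirIdx →₀ ℂ))

instance : Module ℂ HVir := inferInstanceAs (Module ℂ (HVirIdx →₀ ℂ))

instance : LieRing HVir where
  bracket x y := bracketExt HVirIdx.br x y
  add_lie x y z := LinearMap.congr_fun ((bracketExt HVirIdx.br).map_add x y) z
  lie_add x y z := (bracketExt HVirIdx.br x).map_add y z
  lie_self x := bracketExt_self _ HVirIdx.br_skew x
  leibniz_lie x y z := bracketExt_leibniz _ HVirIdx.br_jacobi x y z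

instance : LieAlgebra ℂ HVir where
  lie_smul c x y := (bracketExt HVirIdx.br x).map_smul c y

/-- The basis vector with label `i`. -/
def basisVec (i : HVirIdx) : HVir := Finsupp.single i (1 : ℂ)

/-- The universal enveloping algebra `U(HVir)`. -/
abbrev U : Type := UniversalEnvelopingAlgebra ℂ HVir

/-- A basis vector of the Lie algebra, seen in `U(HVir)`. -/
def gen (i : HVirIdx) : U := UniversalEnvelopingAlgebra.ι ℂ (basisVec i)

/-- `L(n)`, as an element of the enveloping algebra. -/
def L (n : ℤ) : U := gen (.L n)

/-- `I(n)`, as an element of the enveloping algebra. -/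
def I (n : ℤ) : U := gen (.I n)

/-- The left ideal of `U(HVir)` generated by `L(n)`, `I(n)` for `n > 0`, `L(0) - h`, `I(0) - h_I`,
`C_L - c_L`, `C_I - c_I` and `C_LI - c_LI`. -/
def vermaIdeal (cL cI cLI h hI : ℂ) : Submodule U U :=
  Submodule.span U
    ({x | ∃ n : ℤ, 0 < n ∧ (x = L n ∨ x = I n)} ∪
      {L 0 - algebraMap ℂ U h, I 0 - algebraMap ℂ U hI, gen .CL - algebraMap ℂ U cL,
        gen .CI - algebraMap ℂ U cI, gen .CLI - algebraMap ℂ U cLI})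

/-- The Verma module `V(c_L, c_I, c_LI, h, h_I)` of the twisted Heisenberg-Virasoro algebra. -/
abbrev Verma (cL cI cLI h hI : ℂ) : Type := U ⧸ vermaIdeal cL cI cLI h hI

/-- The highest weight vector of the Verma module. -/
def Verma.hwv (cL cI cLI h hI : ℂ) : Verma cL cI cLI h hI :=
  Submodule.Quotient.mk (1 : U)

/-- The maximal proper submodule of the Verma module (the sum of all proper submodules). -/
def Verma.maxSubmodule (cL cI cLI h hI : ℂ) : Submodule U (Verma cL cI cLI h hI) :=
  sSup {N | N ≠ ⊤}

/-- The irreducible highest weight module `L(c_L, c_I, c_LI, h, h_I)`. -/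
abbrev Irr (cL cI cLI h hI : ℂ) : Type :=
  Verma cL cI cLI h hI ⧸ Verma.maxSubmodule cL cI cLI h hI

/-- The space of the simple Heisenberg-Virasoro vertex algebra at level zero,
`L(c_L, c_LI) = L(c_L, 0, c_LI, 0, 0)`. -/
abbrev Vac (cL cLI : ℂ) : Type := Irr cL 0 cLI 0 0

/-- The vacuum vector `1` of `L(c_L, c_LI)`: the image of the highest weight vector. -/
def Vac.one (cL cLI : ℂ) : Vac cL cLI :=
  Submodule.Quotient.mk (Verma.hwv cL 0 cLI 0 0)

end HVir

/-! ### The Lie algebra `W(2,2)` -/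

/-- Labels of the standard basis of `W(2,2)`. -/
inductive W22Idx : Type
  | L (n : ℤ)
  | W (n : ℤ)
  | C
  | CW

/-- Structure constants: `[L n, L m] = (n - m) L (n + m) + δ (n³ - n) / 12 C`,
`[L n, W m] = (n - m) W (n + m) + δ (n³ - n) / 12 C_W`, `[W n, W m] = 0` with `δ = δ_{n,-m}`,
and `C`, `C_W` central. -/
def W22Idx.br : W22Idx → W22Idx → (W22Idx →₀ ℂ)
  | .L n, .L m => .single (.L (n + m)) ((n : ℂ) - m)
      + .single .C (if n + m = 0 then ((n : ℂ) ^ 3 - n) / 12 else 0)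
  | .L n, .W m => .single (.W (n + m)) ((n : ℂ) - m)
      + .single .CW (if n + m = 0 then ((n : ℂ) ^ 3 - n) / 12 else 0)
  | .W n, .L m => .single (.W (n + m)) ((n : ℂ) - m)
      + .single .CW (if n + m = 0 then ((n : ℂ) ^ 3 - n) / 12 else 0)
  | _, _ => 0

lemma W22Idx.br_skew (i j : W22Idx) : br i j = -br j i := by
  classical
  cases i <;> cases j <;> simp only [br, neg_zero]
  all_goals
    rename_i n m
    rw [add_comm m n]
    ext t
    by_cases h : n + m = 0
    · obtain rfl : m = -n := by omega
      cases t <;> simp [Finsupp.single_apply] <;> (try split_ifs) <;> ring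
    · cases t <;> simp [Finsupp.single_apply, h] <;> (try split_ifs) <;> ring

lemma W22Idx.br_jacobi (i j k : W22Idx) :
    bracketExt br (Finsupp.single i 1) (br j k) =
      bracketExt br (br i j) (Finsupp.single k 1) +
        bracketExt br (Finsupp.single j 1) (br i k) := by
  classical
  cases i <;> cases j <;> cases k <;>
    simp only [br, bracketExt_single, map_add, map_zero, LinearMap.add_apply,
      LinearMap.zero_apply, smul_zero, add_zero]
  all_goals
    rename_i a b c
    try rw [add_left_comm b a c]
    try rw [add_assoc a b c]
    ext t
    by_cases h : a + (b + c) = 0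
    · obtain rfl : c = -a - b := by omega
      cases t <;> simp [Finsupp.single_apply, h] <;> (try split_ifs) <;> ring
    · cases t <;> simp [Finsupp.single_apply, h] <;> (try split_ifs) <;> ring

/-- The Lie algebra `W(2,2)`: the complex Lie algebra with basis `L n`, `W n` (`n : ℤ`), `C`, `C_W`
and the brackets `W22Idx.br`. -/
def W22 : Type := W22Idx →₀ ℂ

namespace W22

instance : AddCommGroup W22 := inferInstanceAs (AddCommGroup (W22Idx →₀ ℂ))

instance : Module ℂ W22 := inferInstanceAs (Module ℂ (W22Idx →₀ ℂ))

instance : LieRing W22 where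
  bracket x y := bracketExt W22Idx.br x y
  add_lie x y z := LinearMap.congr_fun ((bracketExt W22Idx.br).map_add x y) z
  lie_add x y z := (bracketExt W22Idx.br x).map_add y z
  lie_self x := bracketExt_self _ W22Idx.br_skew x
  leibniz_lie x y z := bracketExt_leibniz _ W22Idx.br_jacobi x y z

instance : LieAlgebra ℂ W22 where
  lie_smul c x y := (bracketExt W22Idx.br x).map_smul c y

/-- The basis vector with label `i`. -/
def basisVec (i : W22Idx) : W22 := Finsupp.single i (1 : ℂ)

/-- The universal enveloping algebra `U(W(2,2))`. -/
abbrev U : Type := UniversalEnvelopingAlgebra ℂ W22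

/-- A basis vector of the Lie algebra, seen in `U(W(2,2))`. -/
def gen (i : W22Idx) : U := UniversalEnvelopingAlgebra.ι ℂ (basisVec i)

/-- `L(n)`, as an element of the enveloping algebra. -/
def L (n : ℤ) : U := gen (.L n)

/-- `W(n)`, as an element of the enveloping algebra. -/
def W (n : ℤ) : U := gen (.W n)

/-- The left ideal of `U(W(2,2))` generated by `L(n)`, `W(n)` for `n > 0`, `L(0) - h`, `W(0) - h_W`,
`C - c_L` and `C_W - c_W`. -/
def vermaIdeal (cL cW h hW : ℂ) : Submodule U U :=
  Submodule.span U
    ({x | ∃ n : ℤ, 0 < n ∧ (x = L n ∨ x = W n)} ∪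
      {L 0 - algebraMap ℂ U h, W 0 - algebraMap ℂ U hW, gen .C - algebraMap ℂ U cL,
        gen .CW - algebraMap ℂ U cW})

/-- The Verma module `V(c_L, c_W, h, h_W)` of `W(2,2)`. -/
abbrev Verma (cL cW h hW : ℂ) : Type := U ⧸ vermaIdeal cL cW h hW

/-- The highest weight vector of the Verma module. -/
def Verma.hwv (cL cW h hW : ℂ) : Verma cL cW h hW := Submodule.Quotient.mk (1 : U)

/-- The left ideal of `U(W(2,2))` generated by `L(n)`, `W(n)` for `n ≥ -1`, `C - c_L` and
`C_W - c_W`. -/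
def vacIdeal (cL cW : ℂ) : Submodule U U :=
  Submodule.span U
    ({x | ∃ n : ℤ, -1 ≤ n ∧ (x = L n ∨ x = W n)} ∪
      {gen .C - algebraMap ℂ U cL, gen .CW - algebraMap ℂ U cW})

/-- The universal vacuum module of `W(2,2)` with central charges `(c_L, c_W)`: the space of the
universal vertex algebra `L^{W(2,2)}(c_L, c_W)`. -/
abbrev Vac (cL cW : ℂ) : Type := U ⧸ vacIdeal cL cW

/-- The vacuum vector `1` of the universal vacuum module. -/
def Vac.one (cL cW : ℂ) : Vac cL cW := Submodule.Quotient.mk (1 : U)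

end W22

/-! ### Vertex algebras, their homomorphisms and their modules -/

/-- The Borcherds (Jacobi) identity for the modes `u_n v` (`u v : V`) and `u_n x` (`u : V`, `x : M`)
of state-field maps `Y` on `V` and `YM` on `M`. All three sums have finite support, since
vertex operators take values in Laurent series. -/
def BorcherdsIdentity {V M : Type} [AddCommGroup V] [Module ℂ V] [AddCommGroup M] [Module ℂ M]
    (Y : V →ₗ[ℂ] VertexOperator ℂ V) (YM : V →ₗ[ℂ] VertexOperator ℂ M) : Prop :=
  ∀ (a b : V) (x : M) (p q r : ℤ),
    ∑ᶠ i : ℕ, Ring.choose p i • (YM ((Y a).ncoeff (r + i) b)).ncoeff (p + q - i) x =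
      ∑ᶠ i : ℕ, ((-1 : ℤ) ^ i * Ring.choose r i) •
        ((YM a).ncoeff (p + r - i) ((YM b).ncoeff (q + i) x) -
          (-1 : ℂ) ^ r • (YM b).ncoeff (q + r - i) ((YM a).ncoeff (p + i) x))

/-- A vertex algebra structure on the complex vector space `V`: a vacuum vector and a state-field
map `Y(a, z) = ∑ a_n z^{-n-1}`, with `a_n = (Y a).ncoeff n`, satisfying the vacuum and creation
axioms and the Borcherds identity. -/
structure VertexAlgebra (V : Type) [AddCommGroup V] [Module ℂ V] where
  vac : V
  Y : V →ₗ[ℂ] VertexOperator ℂ V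
  vacuum : ∀ (n : ℤ) (b : V), (Y vac).ncoeff n b = if n = -1 then b else 0
  creation : ∀ a : V, (Y a).ncoeff (-1) vac = a
  creation_nonneg : ∀ (a : V) (n : ℤ), 0 ≤ n → (Y a).ncoeff n vac = 0
  borcherds : BorcherdsIdentity Y Y

namespace VertexAlgebra

variable {V V' : Type} [AddCommGroup V] [Module ℂ V] [AddCommGroup V'] [Module ℂ V']

/-- A homomorphism of vertex algebras: a linear map preserving the vacuum and all products
`a_n b`. -/
structure Hom (A : VertexAlgebra V) (B : VertexAlgebra V') extends V →ₗ[ℂ] V' where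
  map_vac : toFun A.vac = B.vac
  map_modes : ∀ (a b : V) (n : ℤ),
    toFun ((A.Y a).ncoeff n b) = (B.Y (toFun a)).ncoeff n (toFun b)

/-- The structure of a module over the vertex algebra `A` on the vector space `M`. -/
structure Mod (A : VertexAlgebra V) (M : Type) [AddCommGroup M] [Module ℂ M] where
  Y : V →ₗ[ℂ] VertexOperator ℂ M
  vacuum : ∀ (n : ℤ) (x : M), (Y A.vac).ncoeff n x = if n = -1 then x else 0
  borcherds : BorcherdsIdentity A.Y Y

/-- Restriction of a module along a homomorphism of vertex algebras. -/
def Mod.restrict {A : VertexAlgebra V} {B : VertexAlgebra V'} {M : Type} [AddCommGroup M]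
    [Module ℂ M] (S : B.Mod M) (Ψ : Hom A B) : A.Mod M where
  Y := S.Y ∘ₗ Ψ.toLinearMap
  vacuum n x := by
    have h := S.vacuum n x
    rw [← Ψ.map_vac] at h
    exact h
  borcherds a b x p q r := by
    have h := S.borcherds (Ψ.toLinearMap a) (Ψ.toLinearMap b) x p q r
    have e : ∀ n : ℤ, (B.Y (Ψ.toLinearMap a)).ncoeff n (Ψ.toLinearMap b) =
        Ψ.toLinearMap ((A.Y a).ncoeff n b) := fun n => (Ψ.map_modes a b n).symm
    simp only [e] at h
    exact h

end VertexAlgebra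

/-- `A` is the vertex algebra structure on the universal vacuum module of `W(2,2)`: its vacuum is
`1`, and with `ω = L(-2)1`, `w = W(-2)1` one has `Y(ω, z) = ∑ L(n) z^{-n-2}` and
`Y(w, z) = ∑ W(n) z^{-n-2}`. -/
structure W22.IsStandard {cL cW : ℂ} (A : VertexAlgebra (W22.Vac cL cW)) : Prop where
  vac_eq : A.vac = Vac.one cL cW
  omega : ∀ (n : ℤ) (x : Vac cL cW), (A.Y (L (-2) • Vac.one cL cW)).ncoeff (n + 1) x = L n • x
  w : ∀ (n : ℤ) (x : Vac cL cW), (A.Y (W (-2) • Vac.one cL cW)).ncoeff (n + 1) x = W n • x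

/-- `B` is the vertex algebra structure on `L(c_L, c_LI)`: its vacuum is `1`, and one has
`Y(L(-2)1, z) = ∑ L(n) z^{-n-2}` and `Y(I(-1)1, z) = ∑ I(n) z^{-n-1}`. -/
structure HVir.IsStandard {cL cLI : ℂ} (B : VertexAlgebra (HVir.Vac cL cLI)) : Prop where
  vac_eq : B.vac = Vac.one cL cLI
  omega : ∀ (n : ℤ) (x : Vac cL cLI), (B.Y (L (-2) • Vac.one cL cLI)).ncoeff (n + 1) x = L n • x
  heis : ∀ (n : ℤ) (x : Vac cL cLI), (B.Y (I (-1) • Vac.one cL cLI)).ncoeff n x = I n • x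

/-- The module structure `S` over the vertex algebra `L(c_L, c_LI)` on the `HVir`-module `M` induces
the given action of `HVir`: `L(-2)1` and `I(-1)1` act by `∑ L(n) z^{-n-2}` and
`∑ I(n) z^{-n-1}`. -/
structure HVir.IsCompatible {cL cLI : ℂ} {B : VertexAlgebra (HVir.Vac cL cLI)} {M : Type}
    [AddCommGroup M] [Module ℂ M] [Module HVir.U M] (S : B.Mod M) : Prop where
  omega : ∀ (n : ℤ) (x : M), (S.Y (L (-2) • Vac.one cL cLI)).ncoeff (n + 1) x = L n • x
  heis : ∀ (n : ℤ) (x : M), (S.Y (I (-1) • Vac.one cL cLI)).ncoeff n x = I n • x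

end

/-! Everything is read off from fields on a space `M`. For two fields the `n`-th product `nprod a b
n` is again a field, and for mutually local fields three facts hold: the Borcherds identity
(`IsLocal.borcherds`), Dong's lemma (`isLocal_nprod`) and the commutator formula for the operators
`b ↦ nprod a b n` (`IsLocal.nprod_comm`). By the last one, fields on `M` satisfying the operator
product expansions of one of the two Lie algebras make the whole space of fields on `M` a module
over that algebra, in which the identity field satisfies the vacuum relations. The universal
property of the vacuum module then gives a linear map from states to fields. `IsFieldMap.map_nprod`
shows that this map respects all products, which yields the vertex algebra structures and their
modules; uniqueness holds because such a map is determined on generators.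

For the Heisenberg-Virasoro algebra the vacuum space is the irreducible quotient, so its universal
property has to be proved: for `cLI ≠ 0` the maximal submodule is generated by `L(-1)v`
(`HVir.Verma.maxSubmodule_eq`). The module `U ⧸ vacIdeal` embeds in a polynomial Fock space through
a free field realization, where simplicity is visible: derivatives take any nonzero polynomial in
the relevant variables down to a constant.

The homomorphism `Ψ` exists because the field `:II: + 2 cLI ∂I` satisfies the `W(2,2)` relations
(`HVirFields.w22Fields`); the derivative term cancels the third-order pole and produces `cW = -24
cLI²`.

On vectors of highest weight `hI` for `I`, the operator `W(-1-n)` equals `2 (hI + n cLI) I(-1-n)`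
plus products of modes `I(-1-i)` with `i < n`. If none of the numbers `hI + n cLI` vanishes, this
triangular system can be solved for the `I(-1-n)`, so the map of Verma modules is surjective
(`HVirFields.eq_top_of_stable`). The same numbers are the pivots that make the leading symbols of
`L(-1-n)` and `W(-1-n)` on a Fock space algebraically independent, so the map is injective
(`Fock.wordMap_injective_w22`). Comparison of words with leading symbols takes the place of the
Poincaré-Birkhoff-Witt theorem throughout. -/

open VertexOperator

notation:max a:max "〚" n "〛" => VertexOperator.ncoeff a n

noncomputable section
/-! ### Eventually vanishing sequences and binomial sums -/

section Sums

variable {X X' : Type*} [AddCommGroup X] [AddCommGroup X']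

/-- A sequence that vanishes from some index on. -/
def EvZero (g : ℕ → X) : Prop := ∃ N, ∀ i ≥ N, g i = 0

lemma EvZero.finite {g : ℕ → X} (h : EvZero g) : (Function.support g).Finite := by
  obtain ⟨N, hN⟩ := h
  refine (Set.finite_lt_nat N).subset fun i hi => ?_
  by_contra h'
  exact hi (hN i (not_lt.mp h'))

lemma EvZero.add {f g : ℕ → X} (hf : EvZero f) (hg : EvZero g) : EvZero fun i => f i + g i := by
  obtain ⟨N, hN⟩ := hf
  obtain ⟨K, hK⟩ := hg
  exact ⟨max N K, fun i hi => by
    simp [hN i ((le_max_left _ _).trans hi), hK i ((le_max_right _ _).trans hi)]⟩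

lemma EvZero.neg {f : ℕ → X} (hf : EvZero f) : EvZero fun i => -f i := by
  obtain ⟨N, hN⟩ := hf
  exact ⟨N, fun i hi => by simp [hN i hi]⟩

lemma EvZero.sub {f g : ℕ → X} (hf : EvZero f) (hg : EvZero g) : EvZero fun i => f i - g i := by
  simpa only [sub_eq_add_neg] using hf.add hg.neg

lemma EvZero.map {f : ℕ → X} (hf : EvZero f) (φ : ℕ → X →+ X') : EvZero fun i => φ i (f i) := by
  obtain ⟨N, hN⟩ := hf
  exact ⟨N, fun i hi => by simp [hN i hi]⟩

lemma EvZero.smul {R : Type*} [Semiring R] [Module R X] {f : ℕ → X} (hf : EvZero f) (c : ℕ → R) :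
    EvZero fun i => c i • f i := by
  obtain ⟨N, hN⟩ := hf
  exact ⟨N, fun i hi => by simp [hN i hi]⟩

lemma EvZero.succ {f : ℕ → X} (hf : EvZero f) : EvZero fun i => f (i + 1) := by
  obtain ⟨N, hN⟩ := hf
  exact ⟨N, fun i hi => hN _ (by omega)⟩

lemma finsum_eq_sum_range {f : ℕ → X} {N : ℕ} (h : ∀ i ≥ N, f i = 0) :
    ∑ᶠ i, f i = ∑ i ∈ Finset.range N, f i :=
  finsum_eq_sum_of_support_subset _ fun i hi => by
    simp only [Finset.coe_range, Set.mem_Iio]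
    by_contra h'
    exact hi (h i (not_lt.mp h'))

lemma EvZero.finsum_add {f g : ℕ → X} (hf : EvZero f) (hg : EvZero g) :
    ∑ᶠ i, (f i + g i) = ∑ᶠ i, f i + ∑ᶠ i, g i :=
  finsum_add_distrib hf.finite hg.finite

lemma EvZero.finsum_sub {f g : ℕ → X} (hf : EvZero f) (hg : EvZero g) :
    ∑ᶠ i, (f i - g i) = ∑ᶠ i, f i - ∑ᶠ i, g i :=
  finsum_sub_distrib hf.finite hg.finite

lemma EvZero.map_finsum {f : ℕ → X} (hf : EvZero f) (φ : X →+ X') :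
    φ (∑ᶠ i, f i) = ∑ᶠ i, φ (f i) :=
  φ.map_finsum hf.finite

lemma EvZero.finsum_succ {f : ℕ → X} (hf : EvZero f) :
    ∑ᶠ i, f i = f 0 + ∑ᶠ i, f (i + 1) := by
  obtain ⟨N, hN⟩ := hf
  rw [finsum_eq_sum_range (N := N + 1) fun i hi => hN i (by omega),
    finsum_eq_sum_range (N := N) fun i hi => hN _ (by omega), Finset.sum_range_succ', add_comm]

/-- Signed binomial coefficients: the coefficients of `(1 - t) ^ r`. -/
def sbinom (r : ℤ) (i : ℕ) : ℤ := (-1) ^ i * Ring.choose r i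

@[simp] lemma sbinom_zero_right (r : ℤ) : sbinom r 0 = 1 := by simp [sbinom]

lemma sbinom_zero_succ (i : ℕ) : sbinom 0 (i + 1) = 0 := by
  simp [sbinom, Ring.choose_zero_succ]

/-- Coefficients of `(1 - t)^(r+1) = (1 - t) (1 - t)^r`. -/
lemma sbinom_succ_succ (r : ℤ) (i : ℕ) :
    sbinom (r + 1) (i + 1) = sbinom r (i + 1) - sbinom r i := by
  simp only [sbinom, Ring.choose_succ_succ, pow_succ]
  ring

/-- Pascal's rule and a shift of the summation index. Binomial sums whose upper index is an
arbitrary integer are handled below by recursion in that index. -/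
lemma EvZero.finsum_choose_succ {g : ℕ → X} (hg : EvZero g) (p : ℤ) :
    ∑ᶠ i, Ring.choose (p + 1) i • g i = ∑ᶠ i, Ring.choose p i • (g i + g (i + 1)) := by
  simp only [smul_add]
  rw [EvZero.finsum_add (hg.smul _) (hg.succ.smul _), (hg.smul _).finsum_succ,
    (hg.smul (Ring.choose p)).finsum_succ]
  simp only [Ring.choose_succ_succ, add_smul, Ring.choose_zero_right]
  rw [EvZero.finsum_add (hg.succ.smul _) (hg.succ.smul _)]
  abel

lemma EvZero.finsum_sbinom_succ {g : ℕ → X} (hg : EvZero g) (p : ℤ) :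
    ∑ᶠ i, sbinom (p + 1) i • g i = ∑ᶠ i, sbinom p i • (g i - g (i + 1)) := by
  simp only [smul_sub]
  rw [EvZero.finsum_sub (hg.smul _) (hg.succ.smul _), (hg.smul _).finsum_succ,
    (hg.smul (sbinom p)).finsum_succ]
  simp only [sbinom_succ_succ, sub_smul, sbinom_zero_right]
  rw [EvZero.finsum_sub (hg.succ.smul _) (hg.succ.smul _)]
  abel

lemma EvZero.finsum_choose_zero (g : ℕ → X) : ∑ᶠ i, Ring.choose (0 : ℤ) i • g i = g 0 := by
  rw [finsum_eq_sum_range (N := 1)]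
  · simp
  · intro i hi
    obtain ⟨j, rfl⟩ : ∃ j, i = j + 1 := ⟨i - 1, by omega⟩
    simp [Ring.choose_zero_succ]

lemma EvZero.finsum_sbinom_zero (g : ℕ → X) : ∑ᶠ i, sbinom 0 i • g i = g 0 := by
  rw [finsum_eq_sum_range (N := 1)]
  · simp
  · intro i hi
    obtain ⟨j, rfl⟩ : ∃ j, i = j + 1 := ⟨i - 1, by omega⟩
    simp [sbinom_zero_succ]

variable (X) in
/-- The difference operator `h(p + 1, q) - h(p, q + 1)`. -/
def dlt : Module.End ℤ (ℤ → ℤ → X) where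
  toFun h p q := h (p + 1) q - h p (q + 1)
  map_add' f g := by ext p q; simp; abel
  map_smul' c f := by ext p q; simp [smul_sub]

/-- On the generating series `∑ h(p, q) z^(-p-1) w^(-q-1)` the operator `dlt` is multiplication by
`z - w`. -/
lemma dlt_apply (h : ℤ → ℤ → X) (p q : ℤ) : dlt X h p q = h (p + 1) q - h p (q + 1) := rfl

/-- An array killed by `z - w` is constant on each antidiagonal `p + q`, and every antidiagonal
meets the region `0 ≤ p`. This extends identities from `p ≥ 0` to all integers `p`. -/
lemma eq_zero_of_dlt_pow {N : ℕ} : ∀ {h : ℤ → ℤ → X}, (dlt X ^ N) h = 0 →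
    (∀ p q : ℤ, 0 ≤ p → h p q = 0) → h = 0 := by
  induction N with
  | zero => intro h hN _; simpa using hN
  | succ N ih =>
    intro h hN hp
    rw [pow_succ, Module.End.mul_apply] at hN
    have h0 : dlt X h = 0 := ih hN fun p q hpq => by
      rw [dlt_apply, hp _ _ (by omega), hp _ _ hpq, sub_zero]
    have key : ∀ n : ℕ, ∀ q : ℤ, h (-n) q = 0 := by
      intro n
      induction n with
      | zero => intro q; exact hp _ _ (by simp)
      | succ n ihn =>
        intro q
        have := congrFun (congrFun h0 (-(n + 1 : ℕ))) (q - 1)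
        rw [dlt_apply] at this
        push_cast at this ihn ⊢
        rw [show -((n : ℤ) + 1) + 1 = -n by ring, ihn, sub_add_cancel, Pi.zero_apply, Pi.zero_apply,
          zero_sub, neg_eq_zero] at this
        exact this
    ext p q
    rcases le_or_gt 0 p with hpp | hpp
    · exact hp p q hpp
    · have := key p.natAbs q
      rwa [show (-(p.natAbs : ℤ)) = p by omega] at this

end Sums

/-! ### Fields and their products -/

section Fields

variable {M : Type} [AddCommGroup M] [Module ℂ M]

lemma field_ext {a b : VertexOperator ℂ M} (h : ∀ n x, a〚n〛 x = b〚n〛 x) : a = b := by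
  apply HVertexOperator.coeff_inj
  ext n x
  have := h (-n - 1) x
  rw [ncoeff_apply, ncoeff_apply, show -(-n - 1) - 1 = n by ring] at this
  exact this

lemma field_trunc (a : VertexOperator ℂ M) (x : M) : ∃ N : ℤ, ∀ n ≥ N, a〚n〛 x = 0 := by
  refine ⟨-HahnSeries.order ((HahnModule.of ℂ).symm (a x)), fun n hn => ?_⟩
  exact ncoeff_eq_zero_of_lt_order a n x (by omega)

/-- The field with given modes. -/
def mkField (f : ℤ → Module.End ℂ M) (hf : ∀ x, ∃ N : ℤ, ∀ n ≥ N, f n x = 0) :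
    VertexOperator ℂ M :=
  VertexOperator.of_coeff (fun n => f (-n - 1)) fun x => by
    obtain ⟨N, hN⟩ := hf x
    refine ⟨-N - 1, fun n hn => ?_⟩
    by_contra h
    exact hn (hN _ (by omega))

@[simp] lemma mkField_ncoeff (f : ℤ → Module.End ℂ M) (hf) (n : ℤ) :
    (mkField f hf)〚n〛 = f n := by
  rw [mkField, ncoeff_of_coeff]
  congr 1
  omega

lemma field_evZero (a : VertexOperator ℂ M) (m : ℤ) (x : M) :
    EvZero fun i : ℕ => a〚m + i〛 x := by
  obtain ⟨N, hN⟩ := field_trunc a x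
  exact ⟨(N - m).toNat, fun i hi => hN _ (by omega)⟩

/-- The summands on the right hand side of the Borcherds identity. -/
def borTerm (a b : VertexOperator ℂ M) (p q r : ℤ) (x : M) (i : ℕ) : M :=
  a〚p + r - i〛 (b〚q + i〛 x) - (-1 : ℂ) ^ r • b〚q + r - i〛 (a〚p + i〛 x)

lemma borTerm_evZero (a b : VertexOperator ℂ M) (p q r : ℤ) (x : M) :
    EvZero (borTerm a b p q r x) :=
  ((field_evZero b q x).map fun i => (a〚p + r - i〛).toAddMonoidHom).sub
    (((field_evZero a p x).map fun i => (b〚q + r - i〛).toAddMonoidHom).smul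
      fun _ => (-1 : ℂ) ^ r)

/-- The right hand side of the Borcherds identity. -/
def borSum (a b : VertexOperator ℂ M) (p q r : ℤ) (x : M) : M :=
  ∑ᶠ i, sbinom r i • borTerm a b p q r x i

/-- `borSum` is a coefficient of `(z - w)^r a(z) b(w)` expanded for `|z| > |w|` minus `(z - w)^r
b(w) a(z)` expanded for `|w| > |z|`. One more factor `z - w` acts as `dlt` in `(p, q)`, whatever the
sign of `r`. -/
lemma borSum_succ (a b : VertexOperator ℂ M) (p q r : ℤ) (x : M) :
    borSum a b p q (r + 1) x = borSum a b (p + 1) q r x - borSum a b p (q + 1) r x := by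
  rw [borSum, EvZero.finsum_sbinom_succ (borTerm_evZero ..), borSum, borSum, ← EvZero.finsum_sub
    ((borTerm_evZero ..).smul _) ((borTerm_evZero ..).smul _)]
  refine finsum_congr fun i => ?_
  rw [← smul_sub]
  congr 1
  simp only [borTerm, zpow_add_one₀ (show (-1 : ℂ) ≠ 0 by norm_num)]
  push_cast
  rw [show p + (r + 1) - (i : ℤ) = p + 1 + r - i by ring,
    show p + (r + 1) - ((i : ℤ) + 1) = p + r - i by ring,
    show q + (r + 1) - (i : ℤ) = q + 1 + r - i by ring,
    show q + (r + 1) - ((i : ℤ) + 1) = q + r - i by ring,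
    show q + ((i : ℤ) + 1) = q + 1 + i by ring, show p + ((i : ℤ) + 1) = p + 1 + i by ring]
  module

lemma borSum_zero (a b : VertexOperator ℂ M) (p q : ℤ) (x : M) :
    borSum a b p q 0 x = a〚p〛 (b〚q〛 x) - b〚q〛 (a〚p〛 x) := by
  rw [borSum, EvZero.finsum_sbinom_zero]
  simp [borTerm]

lemma borSum_add (a b : VertexOperator ℂ M) (p q r : ℤ) (x y : M) :
    borSum a b p q r (x + y) = borSum a b p q r x + borSum a b p q r y := by
  rw [borSum, borSum, borSum, ← EvZero.finsum_add ((borTerm_evZero ..).smul _)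
    ((borTerm_evZero ..).smul _)]
  refine finsum_congr fun i => ?_
  simp only [borTerm, map_add]
  module

lemma borSum_smul (a b : VertexOperator ℂ M) (p q r : ℤ) (c : ℂ) (x : M) :
    borSum a b p q r (c • x) = c • borSum a b p q r x := by
  rw [borSum, borSum, smul_finsum]
  refine finsum_congr fun i => ?_
  simp only [borTerm, map_smul]
  module

lemma field_trunc_finset (a : VertexOperator ℂ M) (s : ℕ → M) (n : ℕ) :
    ∃ N : ℤ, ∀ k ≥ N, ∀ i < n, a〚k〛 (s i) = 0 := by
  induction n with
  | zero => exact ⟨0, fun k _ i hi => absurd hi (by omega)⟩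
  | succ n ih =>
    obtain ⟨N, hN⟩ := ih
    obtain ⟨K, hK⟩ := field_trunc a (s n)
    refine ⟨max N K, fun k hk i hi => ?_⟩
    rcases Nat.lt_succ_iff_lt_or_eq.mp hi with h | rfl
    · exact hN k ((le_max_left _ _).trans hk) i h
    · exact hK k ((le_max_right _ _).trans hk)

/-- The `n`-th product of two fields. -/
def nprod (a b : VertexOperator ℂ M) (n : ℤ) : VertexOperator ℂ M :=
  mkField (fun m =>
    { toFun := borSum a b 0 m n
      map_add' := borSum_add a b 0 m n
      map_smul' := borSum_smul a b 0 m n }) fun x => by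
    obtain ⟨A, hA⟩ := field_trunc a x
    obtain ⟨B, hB⟩ := field_trunc b x
    obtain ⟨K, hK⟩ := field_trunc_finset b (fun i => a〚(i : ℤ)〛 x) A.toNat
    -- For `m ≥ B` the terms with `b` acting first vanish. In the others only the finitely many
    -- vectors `a_i x` with `i < A` are nonzero; `K` bounds the modes of `b` on all of them, and the
    -- mode in use is `m + n - i`.
    refine ⟨max B (K + A.toNat - n), fun m hm => ?_⟩
    have h1 := (le_max_left _ _).trans hm
    have h2 := (le_max_right _ _).trans hm
    refine (finsum_congr fun i => ?_).trans finsum_zero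
    rw [borTerm, hB _ (by omega), map_zero, zero_add]
    rcases lt_or_ge i A.toNat with h | h
    · rw [hK _ (by omega) i h]; simp
    · rw [hA _ (by omega)]; simp

lemma nprod_ncoeff (a b : VertexOperator ℂ M) (n m : ℤ) (x : M) :
    (nprod a b n)〚m〛 x = borSum a b 0 m n x := by
  rw [nprod, mkField_ncoeff]; rfl

lemma nprod_apply (a b : VertexOperator ℂ M) (n m : ℤ) (x : M) :
    (nprod a b n)〚m〛 x = ∑ᶠ i : ℕ, sbinom n i •
      (a〚n - i〛 (b〚m + i〛 x) - (-1 : ℂ) ^ n • b〚m + n - i〛 (a〚(i : ℤ)〛 x)) := by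
  rw [nprod_ncoeff, borSum]
  simp only [borTerm, zero_add]

/-- The commutator of the modes of two fields, applied to a vector. -/
def commFun (a b : VertexOperator ℂ M) (x : M) (p q : ℤ) : M :=
  a〚p〛 (b〚q〛 x) - b〚q〛 (a〚p〛 x)

/-- For a natural exponent both expansions of `(z - w)^r` coincide, so products of nonnegative index
depend only on the commutator. -/
lemma borSum_nat (a b : VertexOperator ℂ M) (r : ℕ) (x : M) :
    (fun p q => borSum a b p q r x) = (dlt M ^ r) (commFun a b x) := by
  induction r with
  | zero => ext p q; simp [borSum_zero, commFun]
  | succ r ih =>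
    rw [pow_succ', Module.End.mul_apply, ← ih]
    ext p q
    push_cast
    rw [borSum_succ, dlt_apply]

/-- Mutual locality of two fields. -/
def IsLocal (a b : VertexOperator ℂ M) : Prop := ∃ N : ℕ, ∀ x, (dlt M ^ N) (commFun a b x) = 0

lemma dlt_pow_le {X : Type*} [AddCommGroup X] {h : ℤ → ℤ → X} {N K : ℕ} (hNK : N ≤ K)
    (hN : (dlt X ^ N) h = 0) : (dlt X ^ K) h = 0 := by
  obtain ⟨j, rfl⟩ := Nat.exists_eq_add_of_le' hNK
  rw [pow_add, Module.End.mul_apply, hN, map_zero]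

lemma IsLocal.borSum_eq_zero {a b : VertexOperator ℂ M} (h : IsLocal a b) :
    ∃ N : ℕ, ∀ r : ℤ, N ≤ r → ∀ p q x, borSum a b p q r x = 0 := by
  obtain ⟨N, hN⟩ := h
  refine ⟨N, fun r hr p q x => ?_⟩
  lift r to ℕ using by omega
  have := congrFun (congrFun (borSum_nat a b r x) p) q
  rw [dlt_pow_le (by exact_mod_cast hr) (hN x)] at this
  exact this

lemma IsLocal.nprod_eq_zero {a b : VertexOperator ℂ M} (h : IsLocal a b) :
    ∃ N : ℕ, ∀ r : ℤ, N ≤ r → nprod a b r = 0 := by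
  obtain ⟨N, hN⟩ := h.borSum_eq_zero
  refine ⟨N, fun r hr => field_ext fun n x => ?_⟩
  rw [nprod_ncoeff, hN r hr]
  simp

/-- Exchanging the two variables changes `z - w` and the commutator by a sign. -/
lemma IsLocal.symm {a b : VertexOperator ℂ M} (h : IsLocal a b) : IsLocal b a := by
  obtain ⟨N, hN⟩ := h
  refine ⟨N, fun x => ?_⟩
  have key : ∀ (K : ℕ) (p q : ℤ), ((dlt M ^ K) (commFun b a x)) p q =
      -((-1 : ℤ) ^ K • ((dlt M ^ K) (commFun a b x)) q p) := by
    intro K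
    induction K with
    | zero => intro p q; simp [commFun]
    | succ K ih =>
      intro p q
      rw [pow_succ', Module.End.mul_apply, Module.End.mul_apply, dlt_apply, dlt_apply, ih, ih,
        pow_succ]
      module
  ext p q
  rw [key, hN]
  simp

/-- The Borcherds identity for two mutually local fields. -/
theorem IsLocal.borcherds {a b : VertexOperator ℂ M} (h : IsLocal a b) (p q r : ℤ) (x : M) :
    ∑ᶠ i : ℕ, Ring.choose p i • (nprod a b (r + i))〚p + q - i〛 x = borSum a b p q r x := by
  obtain ⟨N, hN⟩ := h.borSum_eq_zero
  obtain ⟨N', hN'⟩ := h.nprod_eq_zero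
  have ev : ∀ p q r : ℤ, EvZero fun i : ℕ => (nprod a b (r + i))〚p + q - i〛 x := fun p q r =>
    ⟨(N' - r).toNat, fun i hi => by simp only [hN' (r + i) (by omega)]; simp⟩
  set G : ℤ → ℤ → ℤ → M := fun p q r =>
    ∑ᶠ i : ℕ, Ring.choose p i • (nprod a b (r + i))〚p + q - i〛 x with hG
  -- Both sides obey this recursion, and at `p = 0` they agree by the definition of `nprod`.
  -- Positive `p` follow at once.
  have hrec : ∀ p q r, G (p + 1) q r = G p (q + 1) r + G p q (r + 1) := by
    intro p q r
    simp only [hG]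
    rw [EvZero.finsum_choose_succ (ev (p + 1) q r), ← EvZero.finsum_add ((ev ..).smul _)
      ((ev ..).smul _)]
    refine finsum_congr fun i => ?_
    rw [← smul_add]
    push_cast
    rw [show p + 1 + q - (i : ℤ) = p + (q + 1) - i by ring,
      show p + 1 + q - ((i : ℤ) + 1) = p + q - i by ring,
      show r + ((i : ℤ) + 1) = r + 1 + i by ring]
  have hF : ∀ p q r, borSum a b (p + 1) q r x = borSum a b p (q + 1) r x +
      borSum a b p q (r + 1) x := fun p q r => by rw [borSum_succ]; abel
  have h0 : ∀ q r, G 0 q r = borSum a b 0 q r x := fun q r => by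
    simp only [hG]
    rw [EvZero.finsum_choose_zero]
    simp [nprod_ncoeff]
  have hpos : ∀ n : ℕ, ∀ q r, G n q r = borSum a b n q r x := by
    intro n
    induction n with
    | zero => exact_mod_cast h0
    | succ n ih => intro q r; push_cast; rw [hrec, hF, ih, ih]
  have hneg : ∀ n : ℕ, ∀ q r, G (-n) q r = borSum a b (-n) q r x := by
    intro n
    induction n with
    | zero => simpa using h0
    | succ n ih =>
      -- Going down in `p`, the recursion expresses the value at `(q, r)` through the one at `(q -
      -- 1, r + 1)`. Locality supplies the start: both sides vanish for large `r`.
      have hlarge : ∀ q r, ((max N N' : ℕ) : ℤ) ≤ r → G (-(n + 1 : ℕ)) q r =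
          borSum a b (-(n + 1 : ℕ)) q r x := by
        intro q r hr
        have h1 : (N : ℤ) ≤ r := by omega
        have h2 : (N' : ℤ) ≤ r := by omega
        rw [hN r h1]
        refine (finsum_congr fun i => ?_).trans finsum_zero
        rw [hN' _ (by omega)]
        simp
      have hstep : ∀ k : ℕ, ∀ q r, ((max N N' : ℕ) : ℤ) ≤ r + k → G (-(n + 1 : ℕ)) q r =
          borSum a b (-(n + 1 : ℕ)) q r x := by
        intro k
        induction k with
        | zero => intro q r hr; exact hlarge q r (by simpa using hr)
        | succ k ihk =>
          intro q r hr
          have e1 := hrec (-(n + 1 : ℕ)) (q - 1) r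
          have e2 := hF (-(n + 1 : ℕ)) (q - 1) r
          have e3 := ihk (q - 1) (r + 1) (by push_cast at hr ⊢; omega)
          rw [show (-(n + 1 : ℕ) : ℤ) + 1 = -n by push_cast; ring, sub_add_cancel] at e1 e2
          rw [ih, e2, e3] at e1
          exact (add_right_cancel e1).symm
      intro q r
      exact hstep (((max N N' : ℕ) : ℤ) - r).toNat q r (by omega)
  change G p q r = _
  rcases le_or_gt 0 p with hp | hp
  · lift p to ℕ using hp
    exact hpos p q r
  · have := hneg p.natAbs q r
    rwa [show (-(p.natAbs : ℤ)) = p by omega] at this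

end Fields

section Products

variable {M : Type} [AddCommGroup M] [Module ℂ M]

/-! ### Bilinearity and shifts -/

lemma nprod_add_left (a a' b : VertexOperator ℂ M) (n : ℤ) :
    nprod (a + a') b n = nprod a b n + nprod a' b n := by
  refine field_ext fun m x => ?_
  simp only [nprod_ncoeff, map_add, Pi.add_apply, LinearMap.add_apply]
  rw [borSum, borSum, borSum, ← EvZero.finsum_add ((borTerm_evZero ..).smul _)
    ((borTerm_evZero ..).smul _)]
  refine finsum_congr fun i => ?_
  simp only [borTerm, map_add, Pi.add_apply, LinearMap.add_apply]
  module

lemma nprod_add_right (a b b' : VertexOperator ℂ M) (n : ℤ) :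
    nprod a (b + b') n = nprod a b n + nprod a b' n := by
  refine field_ext fun m x => ?_
  simp only [nprod_ncoeff, map_add, Pi.add_apply, LinearMap.add_apply]
  rw [borSum, borSum, borSum, ← EvZero.finsum_add ((borTerm_evZero ..).smul _)
    ((borTerm_evZero ..).smul _)]
  refine finsum_congr fun i => ?_
  simp only [borTerm, map_add, Pi.add_apply, LinearMap.add_apply]
  module

lemma nprod_smul_left (c : ℂ) (a b : VertexOperator ℂ M) (n : ℤ) :
    nprod (c • a) b n = c • nprod a b n := by
  refine field_ext fun m x => ?_
  simp only [nprod_ncoeff, map_smul, Pi.smul_apply, LinearMap.smul_apply]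
  rw [borSum, borSum, smul_finsum]
  refine finsum_congr fun i => ?_
  simp only [borTerm, map_smul, Pi.smul_apply, LinearMap.smul_apply]
  module

lemma nprod_smul_right (c : ℂ) (a b : VertexOperator ℂ M) (n : ℤ) :
    nprod a (c • b) n = c • nprod a b n := by
  refine field_ext fun m x => ?_
  simp only [nprod_ncoeff, map_smul, Pi.smul_apply, LinearMap.smul_apply]
  rw [borSum, borSum, smul_finsum]
  refine finsum_congr fun i => ?_
  simp only [borTerm, map_smul, Pi.smul_apply, LinearMap.smul_apply]
  module

/-- The `n`-th product as a bilinear map. -/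
def nprodₗ (n : ℤ) :
    VertexOperator ℂ M →ₗ[ℂ] VertexOperator ℂ M →ₗ[ℂ] VertexOperator ℂ M :=
  LinearMap.mk₂ ℂ (fun a b => nprod a b n) (fun a a' b => nprod_add_left a a' b n)
    (fun c a b => nprod_smul_left c a b n) (fun a b b' => nprod_add_right a b b' n)
    (fun c a b => nprod_smul_right c a b n)

@[simp] lemma nprodₗ_apply (a b : VertexOperator ℂ M) (n : ℤ) : nprodₗ n a b = nprod a b n := rfl

@[simp] lemma nprod_zero_left (b : VertexOperator ℂ M) (n : ℤ) : nprod 0 b n = 0 := by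
  rw [← nprodₗ_apply, map_zero, LinearMap.zero_apply]

@[simp] lemma nprod_zero_right (a : VertexOperator ℂ M) (n : ℤ) : nprod a 0 n = 0 := by
  rw [← nprodₗ_apply, map_zero]

/-- The field with modes shifted by `k`, i.e. multiplied by `z ^ k`. -/
def shiftF (k : ℤ) (a : VertexOperator ℂ M) : VertexOperator ℂ M :=
  mkField (fun n => a〚n + k〛) fun x => by
    obtain ⟨N, hN⟩ := field_trunc a x
    exact ⟨N - k, fun n hn => hN _ (by omega)⟩

@[simp] lemma shiftF_ncoeff (k : ℤ) (a : VertexOperator ℂ M) (n : ℤ) :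
    (shiftF k a)〚n〛 = a〚n + k〛 := mkField_ncoeff ..

@[simp] lemma shiftF_zero (a : VertexOperator ℂ M) : shiftF 0 a = a :=
  field_ext fun n x => by simp

lemma shiftF_shiftF (k l : ℤ) (a : VertexOperator ℂ M) :
    shiftF k (shiftF l a) = shiftF (l + k) a :=
  field_ext fun n x => by
    rw [shiftF_ncoeff, shiftF_ncoeff, shiftF_ncoeff, show n + k + l = n + (l + k) by ring]

lemma shiftF_sub (k : ℤ) (a b : VertexOperator ℂ M) :
    shiftF k (a - b) = shiftF k a - shiftF k b :=
  field_ext fun n x => by simp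

lemma borSum_shift (a b : VertexOperator ℂ M) (i j p q r : ℤ) (x : M) :
    borSum (shiftF i a) (shiftF j b) p q r x = borSum a b (p + i) (q + j) r x := by
  rw [borSum, borSum]
  refine finsum_congr fun l => ?_
  simp only [borTerm, shiftF_ncoeff]
  rw [show p + r - (l : ℤ) + i = p + i + r - l by ring, show q + (l : ℤ) + j = q + j + l by ring,
    show q + r - (l : ℤ) + j = q + j + r - l by ring, show p + (l : ℤ) + i = p + i + l by ring]

lemma nprod_shift_right (a b : VertexOperator ℂ M) (k n : ℤ) :
    nprod a (shiftF k b) n = shiftF k (nprod a b n) := by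
  refine field_ext fun m x => ?_
  rw [shiftF_ncoeff, nprod_ncoeff, nprod_ncoeff]
  simpa using borSum_shift a b 0 k 0 m n x

/-- The identity `z = (z - w) + w`. -/
lemma nprod_shift_left (a b : VertexOperator ℂ M) (n : ℤ) :
    nprod (shiftF 1 a) b n = nprod a b (n + 1) + shiftF 1 (nprod a b n) := by
  refine field_ext fun m x => ?_
  have h := borSum_shift a b 1 0 0 m n x
  rw [shiftF_zero, add_zero] at h
  simp only [map_add, Pi.add_apply, LinearMap.add_apply, shiftF_ncoeff, nprod_ncoeff]
  rw [h, borSum_succ]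
  abel

/-! ### Dong's lemma -/

section Lattice

variable (X : Type*) [AddCommGroup X]

/-- Difference operator in the first two variables. -/
def dlt12 : Module.End ℤ (ℤ → ℤ → ℤ → X) where
  toFun h i j k := h (i + 1) j k - h i (j + 1) k
  map_add' f g := by ext; simp; abel
  map_smul' c f := by ext; simp [smul_sub]

/-- Difference operator in the first and last variables. -/
def dlt13 : Module.End ℤ (ℤ → ℤ → ℤ → X) where
  toFun h i j k := h (i + 1) j k - h i j (k + 1)
  map_add' f g := by ext; simp; abel
  map_smul' c f := by ext; simp [smul_sub]

/-- Difference operator in the last two variables. -/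
def dlt23 : Module.End ℤ (ℤ → ℤ → ℤ → X) where
  toFun h i j k := h i (j + 1) k - h i j (k + 1)
  map_add' f g := by ext; simp; abel
  map_smul' c f := by ext; simp [smul_sub]

variable {X}

lemma dlt12_apply (h : ℤ → ℤ → ℤ → X) (i j k : ℤ) :
    dlt12 X h i j k = h (i + 1) j k - h i (j + 1) k := rfl

lemma dlt13_apply (h : ℤ → ℤ → ℤ → X) (i j k : ℤ) :
    dlt13 X h i j k = h (i + 1) j k - h i j (k + 1) := rfl

lemma dlt23_apply (h : ℤ → ℤ → ℤ → X) (i j k : ℤ) :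
    dlt23 X h i j k = h i (j + 1) k - h i j (k + 1) := rfl

/-- The identity `z₂ - z₃ = (z₁ - z₃) - (z₁ - z₂)`, on which Dong's lemma rests. -/
lemma dlt23_eq : dlt23 X = dlt13 X - dlt12 X := by
  ext h i j k
  simp [dlt12_apply, dlt13_apply, dlt23_apply]

lemma dlt_commute : Commute (dlt13 X) (dlt12 X) := by
  ext h i j k
  simp [dlt12_apply, dlt13_apply]
  abel

lemma dlt23_pow_apply (n : ℕ) (h : ℤ → ℤ → ℤ → X) (i : ℤ) :
    (dlt23 X ^ n) h i = (dlt X ^ n) (h i) := by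
  induction n with
  | zero => rfl
  | succ n ih =>
    rw [pow_succ', pow_succ', Module.End.mul_apply, Module.End.mul_apply, ← ih]
    rfl

lemma dlt13_pow_apply (n : ℕ) (h : ℤ → ℤ → ℤ → X) (i j k : ℤ) :
    (dlt13 X ^ n) h i j k = (dlt X ^ n) (fun i k => h i j k) i k := by
  induction n generalizing i k with
  | zero => rfl
  | succ n ih =>
    rw [pow_succ', pow_succ', Module.End.mul_apply, Module.End.mul_apply, dlt13_apply, ih, ih]
    rfl

/-- With `x`, `y`, `z` the three commuting difference operators, expand the factor `z^(N+A) = (y -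
x)^(N+A)`. Each term contains `y^N`, and then `y^N z^N` kills `T`, or it contains `x^A`. -/
lemma dlt23_pow_eq_zero {T : ℤ → ℤ → ℤ → X} {A N : ℕ} (hx : (dlt12 X ^ A) T = 0)
    (hyz : (dlt13 X ^ N) ((dlt23 X ^ N) T) = 0) : (dlt23 X ^ (N + (N + A))) T = 0 := by
  set x := dlt12 X
  set y := dlt13 X
  set z := dlt23 X
  have hyx : Commute y x := dlt_commute
  have hz : z = y + -x := by rw [← sub_eq_add_neg]; exact dlt23_eq
  have hzx : Commute z x := by rw [hz]; exact hyx.add_left (Commute.refl x).neg_left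
  have hyz' : Commute y z := by rw [hz]; exact (Commute.refl y).add_right hyx.neg_right
  have e := hyx.neg_right.add_pow (N + A)
  rw [← hz] at e
  rw [pow_add z, Module.End.mul_apply, e, LinearMap.sum_apply, map_sum]
  refine Finset.sum_eq_zero fun m hm => ?_
  rw [← Module.End.mul_apply, ← Nat.cast_comm, ← mul_assoc, ← mul_assoc]
  rcases le_or_gt N m with h | h
  · obtain ⟨s, rfl⟩ := Nat.exists_eq_add_of_le' h
    have e : z ^ N * ((N + A).choose (s + N) : Module.End ℤ (ℤ → ℤ → ℤ → X)) * y ^ (s + N) *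
        (-x) ^ (N + A - (s + N)) = ((N + A).choose (s + N) : Module.End ℤ (ℤ → ℤ → ℤ → X)) *
          (-x) ^ (N + A - (s + N)) * y ^ s * (y ^ N * z ^ N) := by
      have c1 := ((hyz'.symm.pow_pow N (s + N)))
      have c2 : Commute (z ^ N) ((-x) ^ (N + A - (s + N))) := hzx.neg_right.pow_pow _ _
      have c3 : Commute (y ^ (s + N)) ((-x) ^ (N + A - (s + N))) := hyx.neg_right.pow_pow _ _
      rw [← Nat.cast_comm, mul_assoc, mul_assoc, mul_assoc, mul_assoc, c3.eq, ← mul_assoc (z ^ N),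
        c2.eq, mul_assoc, c1.eq, pow_add, mul_assoc (y ^ s)]
    rw [e, Module.End.mul_apply, Module.End.mul_apply (y ^ N), hyz, map_zero]
  · obtain ⟨s, hs⟩ : ∃ s, N + A - m = s + A := ⟨N - m, by omega⟩
    rw [hs, neg_pow, pow_add x, ← mul_assoc, ← mul_assoc, Module.End.mul_apply _ (x ^ A), hx,
      map_zero]

end Lattice

section FinsumFamilies

variable {X : Type*} [AddCommGroup X] {ι : Type*}

lemma dlt_pow_finsum (n : ℕ) : ∀ {t : ι → ℤ → ℤ → X},
    (∀ i j, (Function.support fun l => t l i j).Finite) →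
    (∀ i j, (Function.support fun l => (dlt X ^ n) (t l) i j).Finite) ∧
    (dlt X ^ n) (fun i j => ∑ᶠ l, t l i j) = fun i j => ∑ᶠ l, (dlt X ^ n) (t l) i j := by
  induction n with
  | zero => intro t ht; exact ⟨ht, rfl⟩
  | succ n ih =>
    intro t ht
    simp only [pow_succ, Module.End.mul_apply]
    have e : dlt X (fun i j => ∑ᶠ l, t l i j) = fun i j => ∑ᶠ l, dlt X (t l) i j := by
      ext i j
      simp only [dlt_apply]
      rw [finsum_sub_distrib (ht _ _) (ht _ _)]
    rw [e]
    refine ih fun i j => ?_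
    refine ((ht (i + 1) j).union (ht i (j + 1))).subset fun l hl => ?_
    by_contra h
    simp only [Set.mem_union, Function.mem_support, not_or, not_not] at h
    exact hl (by simp [dlt_apply, h])

lemma dlt_pow_comp {Y : Type*} [AddCommGroup Y] (n : ℕ) (φ : X →+ Y) (h : ℤ → ℤ → X) (α β : ℤ) :
    (dlt Y ^ n) (fun p q => φ (h (p + α) (q + β))) =
      fun p q => φ ((dlt X ^ n) h (p + α) (q + β)) := by
  induction n with
  | zero => rfl
  | succ n ih =>
    rw [pow_succ', pow_succ', Module.End.mul_apply, Module.End.mul_apply, ih]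
    ext p q
    rw [dlt_apply, dlt_apply, map_sub, add_right_comm p, add_right_comm q]

end FinsumFamilies

end Products

section Dong

variable {M : Type} [AddCommGroup M] [Module ℂ M]

lemma dlt_pow_commFun {a b : VertexOperator ℂ M} {N : ℕ}
    (h : ∀ x, (dlt M ^ N) (commFun a b x) = 0) (φ : M →+ M) (α β : ℤ) (x : M) :
    (dlt M ^ N) (fun p q => φ (commFun a b x (p + α) (q + β))) = 0 := by
  rw [dlt_pow_comp, h]
  ext
  simp

/-- Dong's lemma. -/
theorem isLocal_nprod {a b c : VertexOperator ℂ M} (hab : IsLocal a b) (hac : IsLocal a c)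
    (hbc : IsLocal b c) (n : ℤ) : IsLocal (nprod a b n) c := by
  obtain ⟨A, hA⟩ := hab.borSum_eq_zero
  obtain ⟨N₁, hN₁⟩ := hac
  obtain ⟨N₂, hN₂⟩ := hbc
  set N := max N₁ N₂
  replace hN₁ : ∀ x, (dlt M ^ N) (commFun a c x) = 0 :=
    fun x => dlt_pow_le (le_max_left _ _) (hN₁ x)
  replace hN₂ : ∀ x, (dlt M ^ N) (commFun b c x) = 0 :=
    fun x => dlt_pow_le (le_max_right _ _) (hN₂ x)
  refine ⟨N + (N + (A + n.natAbs)), fun x => ?_⟩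
  -- The modes of `nprod a b r` are the slice `i = 0` of `borSum`. Keeping `i` free gives room for
  -- all three difference operators.
  set T : ℤ → ℤ → ℤ → ℤ → M := fun r i j k =>
    borSum a b i j r (c〚k〛 x) - c〚k〛 (borSum a b i j r x) with hT
  have hx1 : ∀ r, dlt12 M (T r) = T (r + 1) := fun r => by
    ext i j k
    simp only [hT, dlt12_apply, borSum_succ, map_sub]
    abel
  -- Each `dlt12` raises the product index by one, and from index `A` on everything vanishes by
  -- locality of `a` and `b`; `A + |n|` steps suffice from `n`.
  have hx : (dlt12 M ^ (A + n.natAbs)) (T n) = 0 := by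
    have : ∀ K : ℕ, (dlt12 M ^ K) (T n) = T (n + K) := by
      intro K
      induction K with
      | zero => simp
      | succ K ih =>
        rw [pow_succ', Module.End.mul_apply, ih, hx1]
        push_cast
        rw [add_assoc]
    rw [this]
    ext i j k
    simp only [hT]
    rw [hA _ (by omega), hA _ (by omega)]
    simp
  set t : ℕ → ℤ → ℤ → ℤ → M := fun l i j k =>
    sbinom n l • borTerm a b i j n (c〚k〛 x) l - sbinom n l • c〚k〛 (borTerm a b i j n x l) with ht
  have htfin : ∀ i j k, (Function.support fun l => t l i j k).Finite := fun i j k =>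
    (((borTerm_evZero a b i j n (c〚k〛 x)).smul (sbinom n)).sub
      (((borTerm_evZero a b i j n x).map fun _ => (c〚k〛).toAddMonoidHom).smul (sbinom n))).finite
  have hTt : T n = fun i j k => ∑ᶠ l, t l i j k := by
    ext i j k
    simp only [hT, ht, borSum]
    have ev : EvZero fun l => sbinom n l • c〚k〛 (borTerm a b i j n x l) :=
      ((borTerm_evZero a b i j n x).map fun _ => (c〚k〛).toAddMonoidHom).smul (sbinom n)
    rw [EvZero.finsum_sub ((borTerm_evZero ..).smul _) ev]
    congr 1
    refine (((borTerm_evZero a b i j n x).smul (sbinom n)).map_finsum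
      (c〚k〛).toAddMonoidHom).trans (finsum_congr fun l => ?_)
    simp
  have htl : ∀ l, (dlt13 M ^ N) ((dlt23 M ^ N) (t l)) = 0 := by
    intro l
    -- The Leibniz rule `[ab, c] = a [b, c] + [a, c] b`: `u` collects the commutators of `b` with
    -- `c`, killed by `dlt23^N`, and `v` those of `a` with `c`, killed by `dlt13^N`.
    set u : ℤ → ℤ → ℤ → M := fun i j k => sbinom n l •
      (a〚i + n - l〛 (commFun b c x (j + l) (k + 0)) -
        (-1 : ℂ) ^ n • commFun b c (a〚i + l〛 x) (j + (n - l)) (k + 0)) with hu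
    set v : ℤ → ℤ → ℤ → M := fun i j k => sbinom n l •
      (commFun a c (b〚j + l〛 x) (i + (n - l)) (k + 0) -
        (-1 : ℂ) ^ n • b〚j + n - l〛 (commFun a c x (i + l) (k + 0))) with hv
    have e : t l = u + v := by
      ext i j k
      simp only [ht, hu, hv, Pi.add_apply, borTerm, commFun, add_zero, map_sub, map_smul,
        add_sub_assoc]
      module
    have hu0 : (dlt23 M ^ N) u = 0 := by
      ext i j k
      rw [dlt23_pow_apply]
      have e : u i = sbinom n l • ((fun j k => a〚i + n - l〛 (commFun b c x (j + l) (k + 0))) -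
        fun j k => (-1 : ℂ) ^ n • commFun b c (a〚i + l〛 x) (j + (n - l)) (k + 0)) := rfl
      have e1 := dlt_pow_commFun hN₂ (a〚i + n - l〛).toAddMonoidHom l 0 x
      have e2 := dlt_pow_commFun hN₂ (DistribSMul.toAddMonoidHom M ((-1 : ℂ) ^ n)) (n - l) 0
        (a〚i + l〛 x)
      simp only [LinearMap.toAddMonoidHom_coe, DistribSMul.toAddMonoidHom_apply] at e1 e2
      rw [e, map_smul, map_sub, e1, e2]
      simp
    have hv0 : (dlt13 M ^ N) v = 0 := by
      ext i j k
      rw [dlt13_pow_apply]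
      have e : (fun i k => v i j k) = sbinom n l •
        ((fun i k => commFun a c (b〚j + l〛 x) (i + (n - l)) (k + 0)) -
          fun i k => (-1 : ℂ) ^ n • b〚j + n - l〛 (commFun a c x (i + l) (k + 0))) := rfl
      have e1 := dlt_pow_commFun hN₁ (AddMonoidHom.id M) (n - l) 0 (b〚j + l〛 x)
      have e2 := dlt_pow_commFun hN₁ ((DistribSMul.toAddMonoidHom M ((-1 : ℂ) ^ n)).comp
        (b〚j + n - l〛).toAddMonoidHom) l 0 x
      simp only [LinearMap.toAddMonoidHom_coe, DistribSMul.toAddMonoidHom_apply,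
        AddMonoidHom.id_apply, AddMonoidHom.comp_apply] at e1 e2
      rw [e, map_smul, map_sub, e1, e2]
      simp
    have hcomm : Commute (dlt13 M) (dlt23 M) := by
      rw [dlt23_eq]
      exact (Commute.refl _).sub_right dlt_commute
    rw [e, map_add, hu0, zero_add, ← Module.End.mul_apply, (hcomm.pow_pow N N).eq,
      Module.End.mul_apply, hv0, map_zero]
  have hyz : (dlt13 M ^ N) ((dlt23 M ^ N) (T n)) = 0 := by
    have e1 : (dlt23 M ^ N) (T n) = fun i j k => ∑ᶠ l, (dlt23 M ^ N) (t l) i j k := by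
      ext i j k
      rw [dlt23_pow_apply, hTt, (dlt_pow_finsum N (t := fun l => t l i) (htfin i)).2]
      simp only [dlt23_pow_apply]
    rw [e1]
    ext i j k
    rw [dlt13_pow_apply, (dlt_pow_finsum N (t := fun l i k => (dlt23 M ^ N) (t l) i j k) ?_).2]
    · simp only [← dlt13_pow_apply, htl]
      simp
    · intro i k
      simp only [dlt23_pow_apply]
      exact (dlt_pow_finsum N (t := fun l => t l i) (htfin i)).1 j k
  have key := dlt23_pow_eq_zero hx hyz
  have := congrFun key 0
  rw [dlt23_pow_apply] at this
  have e : commFun (nprod a b n) c x = T n 0 := by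
    ext j k
    simp only [commFun, hT, nprod_ncoeff]
  rw [e, this]
  rfl

end Dong

/-! ### The commutator formula for products of fields -/

section Commutator

variable {M : Type} [AddCommGroup M] [Module ℂ M]

lemma nprod_zero_ncoeff (a b : VertexOperator ℂ M) (m : ℤ) (x : M) :
    (nprod a b 0)〚m〛 x = a〚0〛 (b〚m〛 x) - b〚m〛 (a〚0〛 x) := by
  rw [nprod_ncoeff, borSum_zero]

/-- The product of index `0` with `a` is the commutator with the operator `a_0`, a derivation of
every bilinear expression in modes. -/
lemma nprod_zero_derivation (a b c : VertexOperator ℂ M) (q : ℤ) :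
    nprod a (nprod b c q) 0 - nprod b (nprod a c 0) q = nprod (nprod a b 0) c q := by
  rw [sub_eq_iff_eq_add]
  refine field_ext fun m x => ?_
  simp only [map_add, Pi.add_apply, LinearMap.add_apply]
  rw [nprod_zero_ncoeff]
  simp only [nprod_ncoeff _ _ q]
  have ev : EvZero fun l => sbinom q l • a〚0〛 (borTerm b c 0 m q x l) :=
    ((borTerm_evZero b c 0 m q x).map fun _ => (a〚0〛).toAddMonoidHom).smul (sbinom q)
  have e1 : a〚0〛 (borSum b c 0 m q x) = ∑ᶠ l, sbinom q l • a〚0〛 (borTerm b c 0 m q x l) :=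
    (((borTerm_evZero b c 0 m q x).smul (sbinom q)).map_finsum
      (a〚0〛).toAddMonoidHom).trans (finsum_congr fun l => by simp)
  rw [e1]
  simp only [borSum]
  rw [← EvZero.finsum_sub ev ((borTerm_evZero ..).smul _),
    ← EvZero.finsum_add ((borTerm_evZero ..).smul _) ((borTerm_evZero ..).smul _)]
  refine finsum_congr fun l => ?_
  simp only [borTerm, nprod_zero_ncoeff, map_sub, map_smul]
  module

lemma IsLocal.shift {a b : VertexOperator ℂ M} (h : IsLocal a b) (k : ℤ) :
    IsLocal (shiftF k a) b := by
  obtain ⟨N, hN⟩ := h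
  refine ⟨N, fun x => ?_⟩
  rw [← dlt_pow_commFun hN (AddMonoidHom.id M) k 0 x]
  congr 1
  ext p q
  simp [commFun]

/-- Shifting modes as an additive map. -/
def shiftHom (k : ℤ) : VertexOperator ℂ M →+ VertexOperator ℂ M where
  toFun := shiftF k
  map_zero' := field_ext fun n x => by simp
  map_add' a b := field_ext fun n x => by simp

/-- The right hand side of the commutator formula for products of fields. -/
def commSum (a b c : VertexOperator ℂ M) (s : ℕ) (p q : ℤ) : VertexOperator ℂ M :=
  ∑ᶠ l : ℕ, Ring.choose p l • nprod (nprod a b (l + s)) c (p + q - l)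

lemma IsLocal.commSum_evZero {a b : VertexOperator ℂ M} (h : IsLocal a b)
    (c : VertexOperator ℂ M) (s : ℕ) (p : ℤ) :
    EvZero fun l : ℕ => nprod (nprod a b (l + s)) c (p - l) := by
  obtain ⟨N, hN⟩ := h.nprod_eq_zero
  exact ⟨N, fun l hl => by simp only [hN (l + s) (by omega), nprod_zero_left]⟩

/-- The step from `p` to `p + 1` is traded for replacing `a(z)` by `z a(z)`. The commutator side
obeys the same rule, `commProd_succ_left`. -/
lemma IsLocal.commSum_shift {a b : VertexOperator ℂ M} (h : IsLocal a b)
    (c : VertexOperator ℂ M) (p q : ℤ) :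
    commSum a b c 0 (p + 1) q =
      commSum (shiftF 1 a) b c 0 p q - shiftF 1 (commSum a b c 0 p q) := by
  have h' := h.shift 1
  have e : shiftF 1 (commSum a b c 0 p q) =
      ∑ᶠ l : ℕ, Ring.choose p l • shiftF 1 (nprod (nprod a b (l + 0)) c (p + q - l)) :=
    (((h.commSum_evZero c 0 (p + q)).smul _).map_finsum (shiftHom 1)).trans
      (finsum_congr fun l => map_zsmul (shiftHom 1) _ _)
  have ev : EvZero fun l : ℕ =>
      Ring.choose p l • shiftF 1 (nprod (nprod a b (l + 0)) c (p + q - l)) :=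
    ((h.commSum_evZero c 0 (p + q)).map fun _ => shiftHom 1).smul _
  rw [e, commSum, commSum]
  have ev1 := h.commSum_evZero c 0 (p + 1 + q)
  have ev2 := h'.commSum_evZero c 0 (p + q)
  simp only [Nat.cast_zero] at ev1 ev2 ev ⊢
  rw [EvZero.finsum_choose_succ ev1, ← EvZero.finsum_sub (ev2.smul _) ev]
  refine finsum_congr fun l => ?_
  rw [← smul_sub]
  congr 1
  push_cast
  simp only [add_zero]
  rw [nprod_shift_left, nprod_add_left, nprod_shift_left,
    show p + 1 + q - (l : ℤ) = p + q - l + 1 by ring,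
    show p + 1 + q - ((l : ℤ) + 1) = p + q - l by ring]
  abel

/-- By Pascal's rule each difference shifts the index of the inner product `nprod a b l` by one, so
for large `n` locality makes the whole sum vanish. -/
lemma IsLocal.dlt_pow_commSum {a b : VertexOperator ℂ M} (h : IsLocal a b)
    (c : VertexOperator ℂ M) (n s : ℕ) :
    (dlt (VertexOperator ℂ M) ^ n) (commSum a b c s) = commSum a b c (s + n) := by
  induction n generalizing s with
  | zero => rfl
  | succ n ih =>
    have e : dlt (VertexOperator ℂ M) (commSum a b c s) = commSum a b c (s + 1) := by
      ext1 p
      ext1 q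
      rw [dlt_apply, commSum, commSum, commSum,
        EvZero.finsum_choose_succ (h.commSum_evZero c s (p + 1 + q)),
        ← EvZero.finsum_sub (((h.commSum_evZero c s (p + 1 + q)).add
          (h.commSum_evZero c s (p + 1 + q)).succ).smul _)
          ((h.commSum_evZero c s (p + (q + 1))).smul _)]
      refine finsum_congr fun l => ?_
      rw [← smul_sub]
      congr 1
      push_cast
      rw [show p + (q + 1) - (l : ℤ) = p + 1 + q - l by ring, add_sub_cancel_left,
        show p + 1 + q - ((l : ℤ) + 1) = p + q - l by ring, add_assoc, add_comm (1 : ℤ)]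
    rw [pow_succ, Module.End.mul_apply, e, ih, add_assoc, add_comm 1]

/-- The summands of a mode of an iterated product of fields. -/
def tripleTerm (a b c : VertexOperator ℂ M) (p q k : ℤ) (v : M) (l m : ℕ) : M :=
  a〚p - l〛 (b〚q - m〛 (c〚k + l + m〛 v)) - (-1 : ℂ) ^ q • a〚p - l〛 (c〚k + l + q - m〛 (b〚(m : ℤ)〛 v)) -
    (-1 : ℂ) ^ p • (b〚q - m〛 (c〚k + p - l + m〛 (a〚(l : ℤ)〛 v)) -
      (-1 : ℂ) ^ q • c〚k + p - l + q - m〛 (b〚(m : ℤ)〛 (a〚(l : ℤ)〛 v)))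

lemma tripleTerm_eq_zero (a b c : VertexOperator ℂ M) (p q k : ℤ) (v : M) :
    ∃ N, ∀ l m, N ≤ l ∨ N ≤ m → tripleTerm a b c p q k v l m = 0 := by
  obtain ⟨A, hA⟩ := field_trunc a v
  obtain ⟨B, hB⟩ := field_trunc b v
  obtain ⟨C, hC⟩ := field_trunc c v
  obtain ⟨C₂, hC₂⟩ := field_trunc_finset c (fun m => b〚(m : ℤ)〛 v) B.toNat
  obtain ⟨C₃, hC₃⟩ := field_trunc_finset c (fun l => a〚(l : ℤ)〛 v) A.toNat
  obtain ⟨B₄, hB₄⟩ := field_trunc_finset b (fun l => a〚(l : ℤ)〛 v) A.toNat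
  obtain ⟨N, n1, n2, n3, n4, n5, n6⟩ : ∃ N : ℕ, C - k ≤ N ∧ B.toNat ≤ N ∧ A.toNat ≤ N ∧
      C₂ - k - q + B.toNat ≤ N ∧ C₃ - k - p + A.toNat ≤ N ∧ B₄ ≤ N :=
    ⟨(C - k).toNat + B.toNat + A.toNat + (C₂ - k - q + B.toNat).toNat +
      (C₃ - k - p + A.toNat).toNat + B₄.toNat, by omega⟩
  refine ⟨N, fun l m hlm => ?_⟩
  have h1 : c〚k + l + m〛 v = 0 := hC _ (by omega)
  have h2 : c〚k + l + q - m〛 (b〚(m : ℤ)〛 v) = 0 := by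
    rcases lt_or_ge m B.toNat with hm | hm
    · exact hC₂ _ (by omega) m hm
    · rw [hB _ (by omega), map_zero]
  have h3 : c〚k + p - l + m〛 (a〚(l : ℤ)〛 v) = 0 := by
    rcases lt_or_ge l A.toNat with hl | hl
    · exact hC₃ _ (by omega) l hl
    · rw [hA _ (by omega), map_zero]
  have h4 : b〚(m : ℤ)〛 (a〚(l : ℤ)〛 v) = 0 := by
    rcases lt_or_ge l A.toNat with hl | hl
    · exact hB₄ _ (by omega) l hl
    · rw [hA _ (by omega), map_zero]
  simp [tripleTerm, h1, h2, h3, h4]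

lemma tripleTerm_finite (a b c : VertexOperator ℂ M) (p q k : ℤ) (v : M) :
    (Function.support fun lm : ℕ × ℕ =>
      (sbinom p lm.1 * sbinom q lm.2) • tripleTerm a b c p q k v lm.1 lm.2).Finite := by
  obtain ⟨N, hN⟩ := tripleTerm_eq_zero a b c p q k v
  refine ((Set.finite_lt_nat N).prod (Set.finite_lt_nat N)).subset fun lm h => ?_
  by_contra h'
  refine h ?_
  simp only [Set.mem_prod, Set.mem_ofPred_eq, not_and_or, not_lt] at h'
  simp [hN _ _ h']

lemma nprod_nprod_ncoeff (a b c : VertexOperator ℂ M) (p q k : ℤ) (v : M) :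
    (nprod a (nprod b c q) p)〚k〛 v =
      ∑ᶠ lm : ℕ × ℕ, (sbinom p lm.1 * sbinom q lm.2) • tripleTerm a b c p q k v lm.1 lm.2 := by
  rw [finsum_curry _ (tripleTerm_finite a b c p q k v), nprod_apply]
  refine finsum_congr fun l => ?_
  simp only [nprod_ncoeff]
  have e1 : a〚p - l〛 (borSum b c 0 (k + l) q v) =
      ∑ᶠ m, sbinom q m • a〚p - l〛 (borTerm b c 0 (k + l) q v m) :=
    (((borTerm_evZero b c 0 (k + l) q v).smul (sbinom q)).map_finsum
      (a〚p - l〛).toAddMonoidHom).trans (finsum_congr fun m => by simp)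
  have ev : EvZero fun m => sbinom q m • a〚p - l〛 (borTerm b c 0 (k + l) q v m) :=
    ((borTerm_evZero b c 0 (k + l) q v).map fun _ => (a〚p - l〛).toAddMonoidHom).smul (sbinom q)
  have ev' : EvZero fun m => (-1 : ℂ) ^ p • sbinom q m • borTerm b c 0 (k + p - l) q (a〚(l : ℤ)〛 v) m :=
    ((borTerm_evZero b c 0 (k + p - l) q (a〚(l : ℤ)〛 v)).smul (sbinom q)).smul fun _ => (-1 : ℂ) ^ p
  rw [e1, borSum, smul_finsum, ← EvZero.finsum_sub ev ev']
  refine ((ev.sub ev').map_finsum (zsmulAddGroupHom (sbinom p l))).trans ?_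
  refine finsum_congr fun m => ?_
  simp only [borTerm, tripleTerm, map_sub, map_smul, zero_add, zsmulAddGroupHom_apply]
  module

/-- The commutator of the operations of two shifted fields on a third field. -/
def commProd (a b c : VertexOperator ℂ M) (p q i j : ℤ) : VertexOperator ℂ M :=
  nprod (shiftF i a) (nprod (shiftF j b) c q) p - nprod (shiftF j b) (nprod (shiftF i a) c p) q

lemma commProd_succ_left (a b c : VertexOperator ℂ M) (p q i j : ℤ) :
    commProd a b c (p + 1) q i j = commProd a b c p q (i + 1) j - shiftF 1 (commProd a b c p q i j) := by
  simp only [commProd]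
  rw [← shiftF_shiftF 1 i a, nprod_shift_left, nprod_shift_left, nprod_add_right, nprod_shift_right,
    shiftF_sub]
  abel

lemma commProd_succ_right (a b c : VertexOperator ℂ M) (p q i j : ℤ) :
    commProd a b c p (q + 1) i j = commProd a b c p q i (j + 1) - shiftF 1 (commProd a b c p q i j) := by
  simp only [commProd]
  rw [← shiftF_shiftF 1 j b, nprod_shift_left, nprod_shift_left, nprod_add_right, nprod_shift_right,
    shiftF_sub]
  abel

/-- The corrections `shiftF 1` in the two preceding recursions cancel in a difference. So
differences in the product indices become differences in the shifts `i`, `j`, where locality of `a`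
and `b` can be applied. -/
lemma dlt_pow_commProd (a b c : VertexOperator ℂ M) (n : ℕ) (p q i j : ℤ) :
    (dlt (VertexOperator ℂ M) ^ n) (fun p q => commProd a b c p q i j) p q =
      (dlt (VertexOperator ℂ M) ^ n) (commProd a b c p q) i j := by
  induction n generalizing p q i j with
  | zero => rfl
  | succ n ih =>
    have e : dlt (VertexOperator ℂ M) (fun p q => commProd a b c p q i j) =
        (fun p q => commProd a b c p q (i + 1) j) - fun p q => commProd a b c p q i (j + 1) := by
      ext1 p
      ext1 q
      rw [dlt_apply, commProd_succ_left, commProd_succ_right]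
      simp
    rw [pow_succ, Module.End.mul_apply, e, map_sub, Pi.sub_apply, Pi.sub_apply, ih, ih, ← pow_succ,
      pow_succ', Module.End.mul_apply, dlt_apply]

/-- The terms in which `c` stands between `a` and `b` cancel; what is left are commutators of `a`
and `b` to the left or right of `c`. -/
lemma commProd_ncoeff (a b c : VertexOperator ℂ M) (p q i j k : ℤ) (v : M) :
    (commProd a b c p q i j)〚k〛 v = ∑ᶠ lm : ℕ × ℕ, (sbinom p lm.1 * sbinom q lm.2) •
      (commFun a b (c〚k + lm.1 + lm.2〛 v) (i + (p - lm.1)) (j + (q - lm.2)) -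
        (-1 : ℂ) ^ (p + q) • c〚k + p + q - lm.1 - lm.2〛 (commFun a b v (i + lm.1) (j + lm.2))) := by
  simp only [commProd, map_sub, Pi.sub_apply, LinearMap.sub_apply, nprod_nprod_ncoeff]
  have e : ∑ᶠ lm : ℕ × ℕ, (sbinom q lm.1 * sbinom p lm.2) •
        tripleTerm (shiftF j b) (shiftF i a) c q p k v lm.1 lm.2 =
      ∑ᶠ lm : ℕ × ℕ, (sbinom q lm.2 * sbinom p lm.1) •
        tripleTerm (shiftF j b) (shiftF i a) c q p k v lm.2 lm.1 :=
    (finsum_comp_equiv (Equiv.prodComm ℕ ℕ)).symm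
  have fin := tripleTerm_finite (shiftF j b) (shiftF i a) c q p k v
  have fin' : (Function.support fun lm : ℕ × ℕ => (sbinom q lm.2 * sbinom p lm.1) •
      tripleTerm (shiftF j b) (shiftF i a) c q p k v lm.2 lm.1).Finite :=
    (fin.preimage (Equiv.prodComm ℕ ℕ).injective.injOn)
  rw [e, ← finsum_sub_distrib (tripleTerm_finite ..) fin']
  refine finsum_congr fun lm => ?_
  obtain ⟨l, m⟩ := lm
  simp only [tripleTerm, shiftF_ncoeff, commFun, map_sub, zpow_add₀ (show (-1 : ℂ) ≠ 0 by norm_num)]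
  rw [show p - (l : ℤ) + i = i + (p - l) by ring, show q - (m : ℤ) + j = j + (q - m) by ring,
    show (l : ℤ) + i = i + l by ring, show (m : ℤ) + j = j + m by ring,
    show k + (m : ℤ) + l = k + l + m by ring, show k + q - (m : ℤ) + l = k + l + q - m by ring,
    show k + (m : ℤ) + p - l = k + p - l + m by ring,
    show k + q - (m : ℤ) + p - l = k + p + q - l - m by ring,
    show k + p - (l : ℤ) + q - m = k + p + q - l - m by ring]
  module

lemma commFun_pairs_finite (a b c : VertexOperator ℂ M) (p q k i j : ℤ) (v : M) :
    (Function.support fun lm : ℕ × ℕ => (sbinom p lm.1 * sbinom q lm.2) •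
      (commFun a b (c〚k + lm.1 + lm.2〛 v) (i + (p - lm.1)) (j + (q - lm.2)) -
        (-1 : ℂ) ^ (p + q) •
          c〚k + p + q - lm.1 - lm.2〛 (commFun a b v (i + lm.1) (j + lm.2)))).Finite := by
  obtain ⟨A, hA⟩ := field_trunc a v
  obtain ⟨B, hB⟩ := field_trunc b v
  obtain ⟨C, hC⟩ := field_trunc c v
  obtain ⟨A', hA'⟩ := field_trunc_finset a (fun m => b〚j + m〛 v) (B - j).toNat
  obtain ⟨B', hB'⟩ := field_trunc_finset b (fun l => a〚i + l〛 v) (A - i).toNat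
  obtain ⟨N, n1, n2, n3, n4, n5⟩ : ∃ N : ℕ, C - k ≤ N ∧ (B - j).toNat ≤ N ∧ (A - i).toNat ≤ N ∧
      A' - i ≤ N ∧ B' - j ≤ N :=
    ⟨(C - k).toNat + (B - j).toNat + (A - i).toNat + (A' - i).toNat + (B' - j).toNat, by omega⟩
  refine ((Set.finite_lt_nat N).prod (Set.finite_lt_nat N)).subset fun lm h => ?_
  obtain ⟨l, m⟩ := lm
  by_contra h'
  refine h ?_
  simp only [Set.mem_prod, Set.mem_ofPred_eq, not_and_or, not_lt] at h'
  have h1 : c〚k + l + m〛 v = 0 := hC _ (by omega)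
  have h2 : a〚i + l〛 (b〚j + m〛 v) = 0 := by
    rcases lt_or_ge m (B - j).toNat with hm | hm
    · exact hA' _ (by omega) m hm
    · rw [hB _ (by omega), map_zero]
  have h3 : b〚j + m〛 (a〚i + l〛 v) = 0 := by
    rcases lt_or_ge l (A - i).toNat with hl | hl
    · exact hB' _ (by omega) l hl
    · rw [hA _ (by omega), map_zero]
  simp [commFun, h1, h2, h3]

lemma IsLocal.dlt_pow_commProd_eq_zero {a b : VertexOperator ℂ M} (h : IsLocal a b) :
    ∃ N : ℕ, ∀ c i j,
      (dlt (VertexOperator ℂ M) ^ N) (fun p q => commProd a b c p q i j) = 0 := by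
  obtain ⟨N, hN⟩ := h
  refine ⟨N, fun c i j => ?_⟩
  ext1 p
  ext1 q
  rw [dlt_pow_commProd]
  refine field_ext fun k v => ?_
  have e := dlt_pow_comp N (AddMonoidHom.mk' (fun a : VertexOperator ℂ M => a〚k〛 v) (by simp))
    (commProd a b c p q) 0 0
  simp only [add_zero] at e
  have e' := congrFun (congrFun e i) j
  change _ = ((dlt (VertexOperator ℂ M) ^ N) (commProd a b c p q) i j)〚k〛 v at e'
  rw [← e']
  change (dlt M ^ N) (fun i j => (commProd a b c p q i j)〚k〛 v) i j = _
  simp only [commProd_ncoeff]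
  rw [(dlt_pow_finsum (t := fun (lm : ℕ × ℕ) i j => (sbinom p lm.1 * sbinom q lm.2) •
      (commFun a b (c〚k + lm.1 + lm.2〛 v) (i + (p - lm.1)) (j + (q - lm.2)) -
        (-1 : ℂ) ^ (p + q) • c〚k + p + q - lm.1 - lm.2〛 (commFun a b v (i + lm.1) (j + lm.2)))) N
    fun i j => commFun_pairs_finite a b c p q k i j v).2]
  simp only [Pi.zero_apply, map_zero, LinearMap.zero_apply]
  refine (finsum_congr fun lm => ?_).trans finsum_zero
  have e1 := dlt_pow_commFun hN (AddMonoidHom.id M) (p - lm.1) (q - lm.2) (c〚k + lm.1 + lm.2〛 v)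
  have e2 := dlt_pow_commFun hN ((DistribSMul.toAddMonoidHom M ((-1 : ℂ) ^ (p + q))).comp
    (c〚k + p + q - lm.1 - lm.2〛).toAddMonoidHom) lm.1 lm.2 v
  simp only [LinearMap.toAddMonoidHom_coe, DistribSMul.toAddMonoidHom_apply,
    AddMonoidHom.id_apply, AddMonoidHom.comp_apply] at e1 e2
  have e3 : (fun i j => (sbinom p lm.1 * sbinom q lm.2) •
      (commFun a b (c〚k + lm.1 + lm.2〛 v) (i + (p - lm.1)) (j + (q - lm.2)) -
        (-1 : ℂ) ^ (p + q) • c〚k + p + q - lm.1 - lm.2〛 (commFun a b v (i + lm.1) (j + lm.2)))) =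
      (sbinom p lm.1 * sbinom q lm.2) •
      ((fun i j => commFun a b (c〚k + lm.1 + lm.2〛 v) (i + (p - lm.1)) (j + (q - lm.2))) -
        fun i j => (-1 : ℂ) ^ (p + q) •
          c〚k + p + q - lm.1 - lm.2〛 (commFun a b v (i + lm.1) (j + lm.2))) := rfl
  rw [e3, map_smul, map_sub, e1, e2]
  simp

/-- The commutator formula for products with two mutually local fields. -/
theorem IsLocal.nprod_comm {a b : VertexOperator ℂ M} (h : IsLocal a b)
    (c : VertexOperator ℂ M) (p q : ℤ) :
    nprod a (nprod b c q) p - nprod b (nprod a c p) q =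
      ∑ᶠ l : ℕ, Ring.choose p l • nprod (nprod a b l) c (p + q - l) := by
  -- The field `a` varies in the induction because the step from `n` to `n + 1` replaces it by
  -- `shiftF 1 a`.
  have hpos : ∀ n : ℕ, ∀ {a : VertexOperator ℂ M}, IsLocal a b → ∀ q,
      nprod a (nprod b c q) n - nprod b (nprod a c n) q = commSum a b c 0 n q := by
    intro n
    induction n with
    | zero =>
      intro a _ q
      rw [commSum, Nat.cast_zero, EvZero.finsum_choose_zero, nprod_zero_derivation]
      simp
    | succ n ih =>
      intro a ha q
      push_cast
      rw [ha.commSum_shift, ← ih (ha.shift 1), ← ih ha]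
      have := commProd_succ_left a b c n q 0 0
      simpa [commProd] using this
  obtain ⟨N, hN⟩ := h.dlt_pow_commProd_eq_zero
  obtain ⟨K, hK⟩ := h.nprod_eq_zero
  have h1 : (dlt (VertexOperator ℂ M) ^ K) (commSum a b c 0) = 0 := by
    rw [h.dlt_pow_commSum]
    ext1 p
    ext1 q
    refine (finsum_congr fun l => ?_).trans finsum_zero
    rw [hK _ (by omega), nprod_zero_left, smul_zero]
  have h2 := hN c 0 0
  -- The difference of the two sides is killed by a power of `z - w` and vanishes for `p ≥ 0`, hence
  -- everywhere.
  have h3 : (fun p q => commProd a b c p q 0 0) - commSum a b c 0 = 0 := by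
    refine eq_zero_of_dlt_pow (N := max N K) ?_ ?_
    · rw [map_sub, dlt_pow_le (le_max_left _ _) h2, dlt_pow_le (le_max_right _ _) h1, sub_zero]
    · intro p q hp
      lift p to ℕ using hp
      have := hpos p h q
      simp only [Pi.sub_apply, commProd, shiftF_zero, this, sub_self]
  have h4 := congrFun (congrFun h3 p) q
  simp only [Pi.sub_apply, commProd, shiftF_zero, Pi.zero_apply, sub_eq_zero] at h4
  rw [h4, commSum]
  simp

end Commutator

section Identity

variable {M : Type} [AddCommGroup M] [Module ℂ M]

/-! ### The identity field and the derivative -/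

variable (M) in
/-- The identity field. -/
def idF : VertexOperator ℂ M :=
  mkField (fun n => if n = -1 then 1 else 0) fun _ => ⟨0, fun n hn => by
    rw [if_neg (by omega), LinearMap.zero_apply]⟩

lemma idF_ncoeff (n : ℤ) (x : M) : (idF M)〚n〛 x = if n = -1 then x else 0 := by
  rw [idF, mkField_ncoeff]
  split_ifs <;> rfl

lemma commFun_idF (a : VertexOperator ℂ M) (x : M) : commFun a (idF M) x = 0 := by
  ext p q
  simp only [commFun, idF_ncoeff]
  split_ifs <;> simp

lemma isLocal_idF (a : VertexOperator ℂ M) : IsLocal a (idF M) :=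
  ⟨0, fun x => by rw [commFun_idF]; simp⟩

lemma sbinom_of_lt {n : ℤ} {i : ℕ} (hn : 0 ≤ n) (h : n < i) : sbinom n i = 0 := by
  lift n to ℕ using hn
  rw [sbinom, Ring.choose_natCast, Nat.choose_eq_zero_of_lt (by exact_mod_cast h)]
  simp

lemma nprod_idF_left (b : VertexOperator ℂ M) (n : ℤ) :
    nprod (idF M) b n = if n = -1 then b else 0 := by
  refine field_ext fun m x => ?_
  have e : (nprod (idF M) b n)〚m〛 x =
      ∑ᶠ i : ℕ, sbinom n i • (if n - i = -1 then b〚m + i〛 x else 0) := by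
    rw [nprod_apply]
    refine finsum_congr fun i => ?_
    rw [idF_ncoeff, idF_ncoeff, if_neg (show ¬ (i : ℤ) = -1 by omega)]
    simp
  rw [e]
  rcases lt_or_ge n (-1) with h | h
  · rw [if_neg (by omega)]
    refine ((finsum_congr fun i => ?_).trans finsum_zero).trans (by simp)
    rw [if_neg (by omega), smul_zero]
  · rw [finsum_eq_single _ (n + 1).toNat fun i hi => by rw [if_neg (by omega), smul_zero],
      if_pos (by omega)]
    split_ifs with h'
    · subst h'; simp
    · rw [sbinom_of_lt (by omega) (by omega)]
      simp

lemma nprod_idF_of_nonneg (a : VertexOperator ℂ M) {n : ℤ} (hn : 0 ≤ n) :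
    nprod a (idF M) n = 0 := by
  lift n to ℕ using hn
  refine field_ext fun m x => ?_
  have := congrFun (congrFun (borSum_nat a (idF M) n x) 0) m
  simp only [commFun_idF, map_zero] at this
  rw [nprod_ncoeff, this]
  simp

lemma sbinom_neg_one (i : ℕ) : sbinom (-1) i = 1 := by
  induction i with
  | zero => simp
  | succ i ih =>
    have := sbinom_succ_succ (-1) i
    rw [neg_add_cancel, sbinom_zero_succ] at this
    omega

lemma nprod_neg_one_apply (a b : VertexOperator ℂ M) (m : ℤ) (x : M) :
    (nprod a b (-1))〚m〛 x = ∑ᶠ i : ℕ, (a〚-1 - i〛 (b〚m + i〛 x) + b〚m - 1 - i〛 (a〚(i : ℤ)〛 x)) := by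
  rw [nprod_apply]
  refine finsum_congr fun i => ?_
  rw [sbinom_neg_one, one_smul, show m + -1 - (i : ℤ) = m - 1 - i by ring]
  simp

lemma nprod_idF_neg_one (a : VertexOperator ℂ M) : nprod a (idF M) (-1) = a := by
  refine field_ext fun m x => ?_
  rw [nprod_neg_one_apply]
  simp only [idF_ncoeff]
  rcases lt_or_ge m 0 with h | h
  · rw [finsum_eq_single _ (-1 - m).toNat fun i hi => by
      rw [if_neg (by omega), if_neg (by omega), map_zero, add_zero], if_pos (by omega),
      if_neg (by omega), add_zero, show -1 - (((-1 - m).toNat : ℕ) : ℤ) = m by omega]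
  · rw [finsum_eq_single _ m.toNat fun i hi => by
      rw [if_neg (by omega), if_neg (by omega), map_zero, add_zero], if_neg (by omega),
      if_pos (by omega), map_zero, zero_add, show ((m.toNat : ℕ) : ℤ) = m by omega]

/-- The derivative of a field. -/
def derF : VertexOperator ℂ M →ₗ[ℂ] VertexOperator ℂ M where
  toFun a := mkField (fun n => (-(n : ℂ)) • a〚n - 1〛) fun x => by
    obtain ⟨N, hN⟩ := field_trunc a x
    exact ⟨N + 1, fun n hn => by rw [LinearMap.smul_apply, hN _ (by omega), smul_zero]⟩
  map_add' a b := field_ext fun n x => by simp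
  map_smul' c a := field_ext fun n x => by simp; rw [smul_comm]

lemma derF_ncoeff (a : VertexOperator ℂ M) (n : ℤ) (x : M) :
    (derF a)〚n〛 x = (-(n : ℂ)) • a〚n - 1〛 x := by
  change (mkField _ _)〚n〛 x = _
  rw [mkField_ncoeff]
  rfl

@[simp] lemma derF_idF : derF (idF M) = 0 := by
  refine field_ext fun n x => ?_
  rw [derF_ncoeff, idF_ncoeff]
  rcases eq_or_ne n 0 with rfl | h
  · simp
  · rw [if_neg (by omega)]; simp

/-- Coefficients of `d/dt (1 - t)^n = -n (1 - t)^(n-1)`. -/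
lemma sbinom_succ_mul (n : ℤ) (i : ℕ) : (i + 1 : ℤ) * sbinom n (i + 1) = -n * sbinom (n - 1) i := by
  have h := Ring.choose_smul_choose n (n := i + 1) (k := 1) (by omega)
  simp only [Nat.choose_one_right, Ring.choose_one_right, Nat.cast_one, nsmul_eq_mul,
    Nat.add_sub_cancel] at h
  push_cast at h
  rw [sbinom, sbinom, pow_succ]
  linear_combination (-1) ^ (i + 1) * h

/-- Coefficients of `n (1 - t)^n - t d/dt (1 - t)^n = n (1 - t)^(n-1)`. -/
lemma sbinom_mul_sub (n : ℤ) (i : ℕ) : (n - i : ℤ) * sbinom n i = n * sbinom (n - 1) i := by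
  cases i with
  | zero => simp
  | succ i =>
    have h1 := sbinom_succ_mul n i
    have h2 := sbinom_succ_succ (n - 1) i
    rw [sub_add_cancel] at h2
    push_cast
    linear_combination n * h2 - h1

variable {X : Type*} [AddCommGroup X] in
lemma finsum_sbinom_mul (g : ℕ → X) (hg : EvZero g) (n : ℤ) :
    ∑ᶠ i : ℕ, sbinom n i • (i : ℤ) • g i = -n • ∑ᶠ i : ℕ, sbinom (n - 1) i • g (i + 1) := by
  rw [((hg.smul (fun i : ℕ => (i : ℤ))).smul (sbinom n)).finsum_succ]
  simp only [Nat.cast_zero, zero_smul, smul_zero, zero_add]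
  refine (finsum_congr fun i => ?_).trans
    ((hg.succ.smul (sbinom (n - 1))).map_finsum (zsmulAddGroupHom (-n))).symm
  rw [smul_smul, zsmulAddGroupHom_apply, smul_smul, ← sbinom_succ_mul, mul_comm]
  push_cast
  rfl

variable {X : Type*} [AddCommGroup X] in
lemma finsum_sbinom_mul_sub (g : ℕ → X) (hg : EvZero g) (n : ℤ) :
    ∑ᶠ i : ℕ, sbinom n i • (n - i : ℤ) • g i = n • ∑ᶠ i : ℕ, sbinom (n - 1) i • g i := by
  refine (finsum_congr fun i => ?_).trans
    ((hg.smul (sbinom (n - 1))).map_finsum (zsmulAddGroupHom n)).symm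
  rw [smul_smul, zsmulAddGroupHom_apply, smul_smul, ← sbinom_mul_sub, mul_comm]

lemma leftTerm_evZero (a b : VertexOperator ℂ M) (m : ℤ) (α : ℕ → ℤ) (x : M) :
    EvZero fun i : ℕ => a〚α i〛 (b〚m + i〛 x) :=
  (field_evZero b m x).map fun i => (a〚α i〛).toAddMonoidHom

lemma nprod_eq_sub (a b : VertexOperator ℂ M) (n m : ℤ) (x : M) :
    (nprod a b n)〚m〛 x = ∑ᶠ i : ℕ, sbinom n i • a〚n - i〛 (b〚m + i〛 x) -
      (-1 : ℂ) ^ n • ∑ᶠ i : ℕ, sbinom n i • b〚m + n - i〛 (a〚0 + i〛 x) := by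
  rw [nprod_apply, smul_finsum, ← EvZero.finsum_sub ((leftTerm_evZero ..).smul _)
    (((leftTerm_evZero b a 0 (fun i => m + n - i) x).smul (sbinom n)).smul
      fun _ => (-1 : ℂ) ^ n)]
  refine finsum_congr fun i => ?_
  rw [zero_add]
  module

/-- Integration by parts moves the derivative from `a(z)` to `(z - w)^n`; the two binomial
identities do this in the two expansions. -/
lemma nprod_derF_left (a b : VertexOperator ℂ M) (n : ℤ) :
    nprod (derF a) b n = (-(n : ℂ)) • nprod a b (n - 1) := by
  refine field_ext fun m x => ?_
  rw [map_smul, Pi.smul_apply, LinearMap.smul_apply, nprod_eq_sub, nprod_eq_sub]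
  simp only [derF_ncoeff]
  have h1 := finsum_sbinom_mul_sub _ (leftTerm_evZero a b m (fun i => n - 1 - i) x) n
  have h2 := finsum_sbinom_mul _ (leftTerm_evZero b a (-1) (fun i => m + n - i) x) n
  have e1 : ∑ᶠ i : ℕ, sbinom n i • (-((n - i : ℤ) : ℂ)) • a〚n - i - 1〛 (b〚m + i〛 x) =
      -∑ᶠ i : ℕ, sbinom n i • (n - i : ℤ) • a〚n - 1 - i〛 (b〚m + i〛 x) := by
    rw [← finsum_neg_distrib]
    refine finsum_congr fun i => ?_
    rw [show n - (i : ℤ) - 1 = n - 1 - i by ring]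
    module
  have e2 : ∑ᶠ i : ℕ, sbinom n i • b〚m + n - i〛 ((-((0 + i : ℤ) : ℂ)) • a〚0 + (i : ℤ) - 1〛 x) =
      -∑ᶠ i : ℕ, sbinom n i • (i : ℤ) • b〚m + n - i〛 (a〚-1 + i〛 x) := by
    rw [← finsum_neg_distrib]
    refine finsum_congr fun i => ?_
    rw [show 0 + (i : ℤ) - 1 = -1 + i by ring, zero_add, map_smul]
    module
  rw [e1, e2, h1, h2]
  have e3 : ∑ᶠ i : ℕ, sbinom (n - 1) i • b〚m + n - (i + 1 : ℕ)〛 (a〚-1 + (i + 1 : ℕ)〛 x) =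
      ∑ᶠ i : ℕ, sbinom (n - 1) i • b〚m + (n - 1) - i〛 (a〚0 + i〛 x) := by
    refine finsum_congr fun i => ?_
    push_cast
    rw [show m + n - ((i : ℤ) + 1) = m + (n - 1) - i by ring, show -1 + ((i : ℤ) + 1) = 0 + i by ring]
  rw [e3, zpow_sub_one₀ (show (-1 : ℂ) ≠ 0 by norm_num)]
  set P := ∑ᶠ i : ℕ, sbinom (n - 1) i • a〚n - 1 - i〛 (b〚m + i〛 x)
  set Q := ∑ᶠ i : ℕ, sbinom (n - 1) i • b〚m + (n - 1) - i〛 (a〚0 + i〛 x)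
  module

/-- The derivative in `w` hits `b(w)` and `(z - w)^n`; the second contribution is `nprod (derF a) b
n` by `nprod_derF_left`. -/
lemma derF_nprod (a b : VertexOperator ℂ M) (n : ℤ) :
    derF (nprod a b n) = nprod (derF a) b n + nprod a (derF b) n := by
  refine field_ext fun m x => ?_
  simp only [map_add, Pi.add_apply, LinearMap.add_apply]
  rw [nprod_derF_left, map_smul, Pi.smul_apply, LinearMap.smul_apply, derF_ncoeff, nprod_eq_sub,
    nprod_eq_sub, nprod_eq_sub]
  simp only [derF_ncoeff]
  have ev1 := leftTerm_evZero a b (m - 1) (fun i => n - i) x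
  have ev2 := leftTerm_evZero b a 0 (fun i => m + n - 1 - i) x
  have h1 := finsum_sbinom_mul _ ev1 n
  have h2 := finsum_sbinom_mul_sub _ ev2 n
  have e1 : ∑ᶠ i : ℕ, sbinom n i • a〚n - i〛 ((-((m + i : ℤ) : ℂ)) • b〚m + (i : ℤ) - 1〛 x) =
      -((m : ℂ) • ∑ᶠ i : ℕ, sbinom n i • a〚n - i〛 (b〚m - 1 + i〛 x)) -
        ∑ᶠ i : ℕ, sbinom n i • (i : ℤ) • a〚n - i〛 (b〚m - 1 + i〛 x) := by
    rw [smul_finsum, ← finsum_neg_distrib, ← EvZero.finsum_sub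
      ((ev1.smul (sbinom n)).smul fun _ => (m : ℂ)).neg ((ev1.smul fun i : ℕ => (i : ℤ)).smul _)]
    refine finsum_congr fun i => ?_
    rw [show m + (i : ℤ) - 1 = m - 1 + i by ring, map_smul]
    module
  have e2 : ∑ᶠ i : ℕ, sbinom n i • (-((m + n - i : ℤ) : ℂ)) • b〚m + n - i - 1〛 (a〚0 + (i : ℤ)〛 x) =
      -((m : ℂ) • ∑ᶠ i : ℕ, sbinom n i • b〚m + n - 1 - i〛 (a〚0 + (i : ℤ)〛 x)) -
        ∑ᶠ i : ℕ, sbinom n i • (n - i : ℤ) • b〚m + n - 1 - i〛 (a〚0 + (i : ℤ)〛 x) := by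
    rw [smul_finsum, ← finsum_neg_distrib, ← EvZero.finsum_sub
      ((ev2.smul (sbinom n)).smul fun _ => (m : ℂ)).neg
      ((ev2.smul fun i : ℕ => (n - i : ℤ)).smul _)]
    refine finsum_congr fun i => ?_
    rw [show m + n - (i : ℤ) - 1 = m + n - 1 - i by ring]
    module
  rw [e1, e2, h1, h2]
  have e3 : ∑ᶠ i : ℕ, sbinom (n - 1) i • a〚n - (i + 1 : ℕ)〛 (b〚m - 1 + (i + 1 : ℕ)〛 x) =
      ∑ᶠ i : ℕ, sbinom (n - 1) i • a〚n - 1 - i〛 (b〚m + i〛 x) := by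
    refine finsum_congr fun i => ?_
    push_cast
    rw [show n - ((i : ℤ) + 1) = n - 1 - i by ring, show m - 1 + ((i : ℤ) + 1) = m + i by ring]
  rw [e3, zpow_sub_one₀ (show (-1 : ℂ) ≠ 0 by norm_num), show m - 1 + n = m + n - 1 by ring,
    show m + (n - 1) = m + n - 1 by ring]
  set P := ∑ᶠ i : ℕ, sbinom (n - 1) i • a〚n - 1 - i〛 (b〚m + i〛 x)
  set Q := ∑ᶠ i : ℕ, sbinom (n - 1) i • b〚m + n - 1 - i〛 (a〚0 + (i : ℤ)〛 x)
  set R := ∑ᶠ i : ℕ, sbinom n i • a〚n - i〛 (b〚m - 1 + i〛 x)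
  set S := ∑ᶠ i : ℕ, sbinom n i • b〚m + n - 1 - i〛 (a〚0 + (i : ℤ)〛 x)
  module

/-- As a product with the identity field, the derivative comes under Dong's lemma and the other
facts about products. -/
lemma derF_eq_nprod (a : VertexOperator ℂ M) : derF a = nprod a (idF M) (-2) := by
  have := nprod_derF_left a (idF M) (-1)
  rw [nprod_idF_neg_one] at this
  rw [this]
  norm_num

lemma isLocal_derF {a b : VertexOperator ℂ M} (h : IsLocal a b) : IsLocal (derF a) b := by
  rw [derF_eq_nprod]
  exact isLocal_nprod (isLocal_idF a) h (isLocal_idF b).symm _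

/-! ### Operator product expansions and commutators of modes -/

/-- The commutator formula for modes. -/
lemma IsLocal.commFun_eq {a b : VertexOperator ℂ M} (h : IsLocal a b) (x : M) (p q : ℤ) :
    commFun a b x p q = ∑ᶠ l : ℕ, Ring.choose p l • (nprod a b l)〚p + q - l〛 x := by
  have := h.borcherds p q 0 x
  rw [borSum_zero] at this
  rw [commFun, ← this]
  simp

/-- The array consists of the coefficients of `d(w)` times the `l`-th divided derivative of the
delta function; a factor `z - w` lowers the order of that derivative by one. -/
lemma dlt_pow_choose {X : Type*} [AddCommGroup X] (d : ℤ → X) (l n : ℕ) :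
    (dlt X ^ n) (fun p q => Ring.choose p l • d (p + q - l)) =
      if n ≤ l then fun p q => Ring.choose p (l - n) • d (p + q - (l - n : ℕ)) else 0 := by
  have step : ∀ l : ℕ, dlt X (fun p q => Ring.choose p (l + 1) • d (p + q - (l + 1 : ℕ))) =
      fun p q => Ring.choose p l • d (p + q - l) := by
    intro l
    ext p q
    rw [dlt_apply, Ring.choose_succ_succ]
    push_cast
    rw [show p + 1 + q - ((l : ℤ) + 1) = p + q - l by ring,
      show p + (q + 1) - ((l : ℤ) + 1) = p + q - l by ring]
    module
  have step0 : dlt X (fun p q => Ring.choose p 0 • d (p + q - (0 : ℕ))) = 0 := by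
    ext p q
    rw [dlt_apply]
    simp only [Ring.choose_zero_right, one_smul, Nat.cast_zero, sub_zero]
    rw [show p + 1 + q = p + (q + 1) by ring, sub_self]
    rfl
  induction n generalizing l with
  | zero => simp
  | succ n ih =>
    rw [pow_succ, Module.End.mul_apply]
    cases l with
    | zero => rw [step0]; simp
    | succ l =>
      rw [step, ih]
      simp only [Nat.add_le_add_iff_right, Nat.add_sub_add_right]

/-- Converse of `IsLocal.commFun_eq`: a finite expansion of the commutator proves locality and
determines the products of nonnegative index. After `n` differences, evaluation at `p = 0` leaves
only the term `l = n`. -/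
lemma nprod_of_commFun {a b : VertexOperator ℂ M} {N : ℕ} {d : ℕ → VertexOperator ℂ M}
    (h : ∀ x p q, commFun a b x p q =
      ∑ l ∈ Finset.range N, Ring.choose p l • (d l)〚p + q - l〛 x) :
    IsLocal a b ∧ ∀ l : ℕ, nprod a b l = if l < N then d l else 0 := by
  have key : ∀ (n : ℕ) x, (dlt M ^ n) (commFun a b x) = ∑ l ∈ Finset.range N,
      if n ≤ l then fun p q => Ring.choose p (l - n) • (d l)〚p + q - (l - n : ℕ)〛 x else 0 := by
    intro n x
    have e : commFun a b x = ∑ l ∈ Finset.range N,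
        fun p q => Ring.choose p l • (d l)〚p + q - l〛 x := by
      ext p q
      simp [h]
    rw [e, map_sum]
    exact Finset.sum_congr rfl fun l _ => dlt_pow_choose (fun k => (d l)〚k〛 x) l n
  refine ⟨⟨N, fun x => ?_⟩, fun n => field_ext fun k x => ?_⟩
  · rw [key]
    exact Finset.sum_eq_zero fun l hl => if_neg (by simpa using hl)
  · have := congrFun (congrFun (borSum_nat a b n x) 0) k
    rw [key] at this
    rw [nprod_ncoeff, this]
    simp only [Finset.sum_apply]
    rw [Finset.sum_eq_ite n]
    · simp only [Finset.mem_range]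
      split_ifs <;> simp_all
    · intro l _ hl
      rcases lt_or_ge l n with h' | h'
      · rw [if_neg (by omega)]; rfl
      · obtain ⟨j, hj⟩ : ∃ j, l - n = j + 1 := ⟨l - n - 1, by omega⟩
        rw [if_pos h', hj, Ring.choose_zero_succ, zero_smul]

lemma isLocal_of_commFun_eq_zero {a b : VertexOperator ℂ M} (h : ∀ x, commFun a b x = 0) :
    IsLocal a b := ⟨0, fun x => by rw [h]; simp⟩

lemma nprod_eq_zero_of_commFun_eq_zero {a b : VertexOperator ℂ M} (h : ∀ x, commFun a b x = 0)
    (n : ℕ) : nprod a b n = 0 := by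
  have := (nprod_of_commFun (N := 0) (d := fun _ => 0) (a := a) (b := b) fun x p q => by
    simp [h]).2 n
  simpa using this

end Identity

section Reconstruction

/-! ### Reconstruction of vertex algebras and modules from generating fields -/

variable {X V M : Type} [AddCommGroup V] [Module ℂ V] [AddCommGroup M] [Module ℂ M]

lemma commFun_add_left (a a' b : VertexOperator ℂ M) (x : M) :
    commFun (a + a') b x = commFun a b x + commFun a' b x := by
  ext p q
  simp [commFun]
  abel

lemma commFun_smul_left (c : ℂ) (a b : VertexOperator ℂ M) (x : M) :
    commFun (c • a) b x = commFun a b (c • x) := by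
  ext p q
  simp [commFun]

lemma IsLocal.add {a a' b : VertexOperator ℂ M} (h : IsLocal a b) (h' : IsLocal a' b) :
    IsLocal (a + a') b := by
  obtain ⟨N, hN⟩ := h
  obtain ⟨K, hK⟩ := h'
  refine ⟨max N K, fun x => ?_⟩
  rw [commFun_add_left, map_add, dlt_pow_le (le_max_left _ _) (hN x),
    dlt_pow_le (le_max_right _ _) (hK x), add_zero]

lemma IsLocal.smul {a b : VertexOperator ℂ M} (h : IsLocal a b) (c : ℂ) : IsLocal (c • a) b := by
  obtain ⟨N, hN⟩ := h
  exact ⟨N, fun x => by rw [commFun_smul_left, hN]⟩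

lemma IsLocal.zero (b : VertexOperator ℂ M) : IsLocal 0 b :=
  isLocal_of_commFun_eq_zero fun x => by ext; simp [commFun]

/-- Mutually local fields; the mode `0` of the field with label `t` acts as the derivative. -/
structure Currents (s : X → VertexOperator ℂ M) (t : X) : Prop where
  loc : ∀ x y, IsLocal (s x) (s y)
  der : ∀ x, nprod (s t) (s x) 0 = derF (s x)

/-- The vector `one` generates `V` under the modes of the fields `s`, and the nonnegative modes
annihilate it. -/
structure Generates (s : X → VertexOperator ℂ V) (one : V) : Prop where
  top : ∀ P : Submodule ℂ V, one ∈ P → (∀ x k, ∀ v ∈ P, (s x)〚k〛 v ∈ P) → P = ⊤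
  annihilates : ∀ x k, 0 ≤ k → (s x)〚k〛 one = 0

lemma Generates.induction {s : X → VertexOperator ℂ V} {one : V} (h : Generates s one)
    {p : V → Prop} (h1 : p one) (h0 : p 0) (hadd : ∀ u v, p u → p v → p (u + v))
    (hsmul : ∀ (c : ℂ) u, p u → p (c • u)) (hmode : ∀ x k v, p v → p ((s x)〚k〛 v)) (v : V) :
    p v := by
  let P : Submodule ℂ V :=
    { carrier := {v | p v}
      add_mem' := fun {u v} hu hv => hadd u v hu hv
      zero_mem' := h0
      smul_mem' := fun c u hu => hsmul c u hu }
  have : v ∈ P := by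
    rw [h.top P h1 hmode]
    trivial
  exact this

/-- A linear map into fields that sends `one` to the identity field and modes of generating
fields to products of fields. -/
structure IsFieldMap (sV : X → VertexOperator ℂ V) (one : V) (s : X → VertexOperator ℂ M)
    (φ : V →ₗ[ℂ] VertexOperator ℂ M) : Prop where
  map_one : φ one = idF M
  map_mode : ∀ x k v, φ ((sV x)〚k〛 v) = nprod (s x) (φ v) k

variable {sV : X → VertexOperator ℂ V} {one : V} {s : X → VertexOperator ℂ M} {t : X}
  {φ ψ : V →ₗ[ℂ] VertexOperator ℂ M} {φV : V →ₗ[ℂ] VertexOperator ℂ V}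

lemma IsFieldMap.unique (hg : Generates sV one) (h : IsFieldMap sV one s φ)
    (h' : IsFieldMap sV one s ψ) : φ = ψ := by
  ext1 v
  induction v using hg.induction with
  | h1 => rw [h.map_one, h'.map_one]
  | h0 => simp
  | hadd u v hu hv => rw [map_add, map_add, hu, hv]
  | hsmul c u hu => rw [map_smul, map_smul, hu]
  | hmode x k v hv => rw [h.map_mode, h'.map_mode, hv]

lemma IsFieldMap.isLocal_gen (hg : Generates sV one) (hs : Currents s t)
    (h : IsFieldMap sV one s φ) (v : V) : ∀ x, IsLocal (φ v) (s x) := by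
  induction v using hg.induction with
  | h1 => intro x; rw [h.map_one]; exact (isLocal_idF _).symm
  | h0 => intro x; rw [map_zero]; exact IsLocal.zero _
  | hadd u v hu hv => intro x; rw [map_add]; exact (hu x).add (hv x)
  | hsmul c u hu => intro x; rw [map_smul]; exact (hu x).smul c
  | hmode y k v hv =>
    intro x
    rw [h.map_mode]
    exact isLocal_nprod (hv y).symm (hs.loc y x) (hv x) k

lemma IsFieldMap.isLocal (hg : Generates sV one) (hs : Currents s t)
    (h : IsFieldMap sV one s φ) (u v : V) : IsLocal (φ u) (φ v) := by
  induction u using hg.induction with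
  | h1 => rw [h.map_one]; exact (isLocal_idF _).symm
  | h0 => rw [map_zero]; exact IsLocal.zero _
  | hadd u u' hu hv => rw [map_add]; exact hu.add hv
  | hsmul c u hu => rw [map_smul]; exact hu.smul c
  | hmode y k u hu =>
    rw [h.map_mode]
    exact isLocal_nprod (h.isLocal_gen hg hs u y).symm (h.isLocal_gen hg hs v y).symm hu k

/-- Both sides are derivations of all products, and they agree on the generating fields. -/
lemma IsFieldMap.der (hg : Generates sV one) (hs : Currents s t)
    (h : IsFieldMap sV one s φ) (v : V) : nprod (s t) (φ v) 0 = derF (φ v) := by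
  induction v using hg.induction with
  | h1 => rw [h.map_one, derF_idF, nprod_idF_of_nonneg _ le_rfl]
  | h0 => simp
  | hadd u v hu hv => rw [map_add, nprod_add_right, hu, hv, map_add]
  | hsmul c u hu => rw [map_smul, nprod_smul_right, hu, map_smul]
  | hmode x k v hv =>
    rw [h.map_mode, derF_nprod, ← hs.der, ← hv, ← nprod_zero_derivation]
    abel

/-- For a product with a generating field only the first term can act nontrivially on `one`:
nonnegative modes of the generator kill `one`, and so do the nonnegative modes of the field given by
induction. -/
lemma IsFieldMap.creation (hg : Generates sV one) (h : IsFieldMap sV one sV φV) (v : V) :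
    ∀ n : ℤ, -1 ≤ n → (φV v)〚n〛 one = if n = -1 then v else 0 := by
  induction v using hg.induction with
  | h1 => intro n _; rw [h.map_one, idF_ncoeff]
  | h0 => intro n _; simp
  | hadd u v hu hv =>
    intro n hn
    rw [map_add, map_add, Pi.add_apply, LinearMap.add_apply, hu n hn, hv n hn]
    split_ifs <;> simp
  | hsmul c u hu =>
    intro n hn
    rw [map_smul, map_smul, Pi.smul_apply, LinearMap.smul_apply, hu n hn]
    split_ifs <;> simp
  | hmode x k v hv =>
    intro n hn
    rw [h.map_mode, nprod_apply, finsum_eq_single _ 0]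
    · have h0 := hg.annihilates x 0 le_rfl
      simp only [Nat.cast_zero, sub_zero, add_zero, h0, map_zero, smul_zero, hv n hn,
        sbinom_zero_right, one_smul]
      split_ifs <;> simp
    · intro i hi
      rw [hg.annihilates x i (by omega), hv _ (by omega), if_neg (by omega)]
      simp

/-- Field maps turn products of vectors into products of fields. -/
theorem IsFieldMap.map_nprod (hg : Generates sV one) (hsV : Currents sV t) (hs : Currents s t)
    (hV : IsFieldMap sV one sV φV) (h : IsFieldMap sV one s φ) (b : V) :
    ∀ a n, φ ((φV a)〚n〛 b) = nprod (φ a) (φ b) n := by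
  induction b using hg.induction with
  | h1 =>
    intro a n
    -- The mode `0` of the generator `t` acts as the derivative on both sides, so the vector
    -- `a_(-2-k) one` is `1/(k+1)` times its value on `a_(-1-k) one`; this fixes all negative modes
    -- from `a_(-1) one = a`.
    have hneg : ∀ k : ℕ, φ ((φV a)〚-1 - k〛 one) = nprod (φ a) (idF M) (-1 - k) := by
      intro k
      induction k with
      | zero =>
        have := hV.creation hg a (-1) le_rfl
        simp [this, nprod_idF_neg_one]
      | succ k ih =>
        have hk : (-((-1 - k : ℤ) : ℂ)) ≠ 0 := by
          rw [neg_ne_zero, Int.cast_ne_zero]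
          omega
        have e1 : (-((-1 - k : ℤ) : ℂ)) • (φV a)〚-1 - k - 1〛 one =
            (sV t)〚0〛 ((φV a)〚-1 - k〛 one) := by
          rw [← derF_ncoeff, ← hV.der hg hsV, nprod_zero_ncoeff, hg.annihilates t 0 le_rfl, map_zero,
            sub_zero]
        have e2 := congrArg φ e1
        rw [map_smul, h.map_mode, ih] at e2
        have e3 := nprod_zero_derivation (s t) (φ a) (idF M) (-1 - k)
        rw [nprod_idF_of_nonneg _ le_rfl, nprod_zero_right, sub_zero, h.der hg hs,
          nprod_derF_left] at e3
        rw [e3] at e2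
        have := smul_right_injective _ hk e2
        push_cast
        rwa [show (-1 : ℤ) - (k + 1) = -1 - k - 1 by ring]
    rw [h.map_one]
    rcases lt_or_ge n 0 with hn | hn
    · have := hneg (-1 - n).toNat
      rwa [show -1 - (((-1 - n).toNat : ℕ) : ℤ) = n by omega] at this
    · rw [hV.creation hg a n (by omega), if_neg (by omega), map_zero, nprod_idF_of_nonneg _ hn]
  | h0 => simp
  | hadd u v hu hv => intro a n; rw [map_add, map_add, hu, hv, map_add, nprod_add_right]
  | hsmul c u hu => intro a n; rw [map_smul, map_smul, hu, map_smul, nprod_smul_right]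
  | hmode x k b hb =>
    intro a n
    have loc := (hV.isLocal_gen hg hsV a x).symm
    have loc' := (h.isLocal_gen hg hs a x).symm
    -- The commutator formula rewrites `a_n x_k b` through `x_k a_n b` and the products of the
    -- states `x_l a` with `b`. The induction hypothesis covers both, as it is about all first
    -- arguments.
    have e1 := loc.commFun_eq b k n
    rw [commFun, sub_eq_iff_eq_add', ← sub_eq_iff_eq_add] at e1
    obtain ⟨N, hN⟩ := loc.nprod_eq_zero
    have ev : EvZero fun l : ℕ => (nprod (sV x) (φV a) l)〚k + n - l〛 b :=
      ⟨N, fun l hl => by simp only [hN l (by omega)]; simp⟩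
    have e2 : φ (∑ᶠ l : ℕ, Ring.choose k l • (nprod (sV x) (φV a) l)〚k + n - l〛 b) =
        ∑ᶠ l : ℕ, Ring.choose k l • nprod (nprod (s x) (φ a) l) (φ b) (k + n - l) := by
      refine ((ev.smul (Ring.choose k)).map_finsum φ.toAddMonoidHom).trans (finsum_congr fun l => ?_)
      rw [LinearMap.toAddMonoidHom_coe, map_zsmul, ← hV.map_mode, hb, h.map_mode]
    rw [← e1, map_sub, e2, h.map_mode, hb, ← loc'.nprod_comm, h.map_mode]
    abel

theorem IsFieldMap.borcherds (hg : Generates sV one) (hsV : Currents sV t) (hs : Currents s t)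
    (hV : IsFieldMap sV one sV φV) (h : IsFieldMap sV one s φ) : BorcherdsIdentity φV φ := by
  intro a b x p q r
  have := (h.isLocal hg hs a b).borcherds p q r x
  simp only [← IsFieldMap.map_nprod hg hsV hs hV h] at this
  exact this

lemma BorcherdsIdentity.map_mode {Y : V →ₗ[ℂ] VertexOperator ℂ V}
    {YM : V →ₗ[ℂ] VertexOperator ℂ M} (h : BorcherdsIdentity Y YM) (a b : V) (r : ℤ) :
    YM ((Y a)〚r〛 b) = nprod (YM a) (YM b) r := by
  refine field_ext fun q x => ?_
  have := h a b x 0 q r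
  rw [EvZero.finsum_choose_zero] at this
  rw [nprod_ncoeff]
  simp only [Nat.cast_zero, add_zero, sub_zero] at this
  rw [zero_add] at this
  exact this

/-- The vertex algebra generated by a family of fields. -/
def IsFieldMap.vertexAlgebra (hg : Generates sV one) (hsV : Currents sV t)
    (hV : IsFieldMap sV one sV φV) : VertexAlgebra V where
  vac := one
  Y := φV
  vacuum n b := by rw [hV.map_one, idF_ncoeff]
  creation a := by rw [hV.creation hg a _ le_rfl, if_pos rfl]
  creation_nonneg a n hn := by rw [hV.creation hg a _ (by omega), if_neg (by omega)]
  borcherds := hV.borcherds hg hsV hsV hV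

lemma idF_of_vacuum {f : VertexOperator ℂ M} (h : ∀ n x, f〚n〛 x = if n = -1 then x else 0) :
    f = idF M := field_ext fun n x => by rw [h, idF_ncoeff]

lemma VertexAlgebra.ext_Y {A B : VertexAlgebra V} (h1 : A.vac = B.vac) (h2 : A.Y = B.Y) :
    A = B := by
  cases A
  cases B
  subst h1 h2
  rfl

lemma VertexAlgebra.Mod.ext_Y {A : VertexAlgebra V} {S T : A.Mod M} (h : S.Y = T.Y) : S = T := by
  cases S
  cases T
  subst h
  rfl

lemma VertexAlgebra.isFieldMap (A : VertexAlgebra V) (hvac : A.vac = one) (e : X → V)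
    (he : ∀ x, A.Y (e x) = sV x) : IsFieldMap sV one sV A.Y where
  map_one := idF_of_vacuum fun n x => by rw [← hvac, A.vacuum]
  map_mode x k v := by rw [← he, BorcherdsIdentity.map_mode A.borcherds]

lemma VertexAlgebra.Mod.isFieldMap {A : VertexAlgebra V} (S : A.Mod M) (hvac : A.vac = one)
    (e : X → V) (he : ∀ x, A.Y (e x) = sV x) (he' : ∀ x, S.Y (e x) = s x) :
    IsFieldMap sV one s S.Y where
  map_one := idF_of_vacuum fun n x => by rw [← hvac, S.vacuum]
  map_mode x k v := by rw [← he, BorcherdsIdentity.map_mode S.borcherds, he']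

lemma map_borSum (Ψ : V →ₗ[ℂ] M) {a b : VertexOperator ℂ V} {a' b' : VertexOperator ℂ M}
    (ha : ∀ n x, Ψ (a〚n〛 x) = a'〚n〛 (Ψ x)) (hb : ∀ n x, Ψ (b〚n〛 x) = b'〚n〛 (Ψ x))
    (p q r : ℤ) (x : V) : Ψ (borSum a b p q r x) = borSum a' b' p q r (Ψ x) := by
  refine (((borTerm_evZero a b p q r x).smul (sbinom r)).map_finsum Ψ.toAddMonoidHom).trans
    (finsum_congr fun i => ?_)
  simp only [borTerm, LinearMap.toAddMonoidHom_coe, map_zsmul, map_sub, map_smul, ha, hb]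

/-- A linear map that intertwines the generating fields is a homomorphism of vertex algebras. -/
def VertexAlgebra.homOfGenerates {A : VertexAlgebra V} {B : VertexAlgebra M}
    (hg : Generates sV one) (hvac : A.vac = one) (e : X → V) (he : ∀ x, A.Y (e x) = sV x)
    (Ψ : V →ₗ[ℂ] M) (h1 : Ψ one = B.vac)
    (hΨ : ∀ x n v, Ψ ((sV x)〚n〛 v) = (B.Y (Ψ (e x)))〚n〛 (Ψ v)) : VertexAlgebra.Hom A B where
  toLinearMap := Ψ
  map_vac := by rw [hvac]; exact h1
  map_modes a b n := by
    change Ψ ((A.Y a)〚n〛 b) = (B.Y (Ψ a))〚n〛 (Ψ b)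
    induction a using hg.induction generalizing b n with
    | h1 =>
      rw [h1, ← hvac, A.vacuum, B.vacuum]
      split_ifs <;> simp
    | h0 => simp
    | hadd u v hu hv => simp [hu, hv]
    | hsmul c u hu => simp [hu]
    | hmode x k v hv =>
      rw [hΨ, ← he, BorcherdsIdentity.map_mode A.borcherds, BorcherdsIdentity.map_mode B.borcherds,
        nprod_ncoeff, nprod_ncoeff]
      exact map_borSum Ψ (fun n x' => by rw [he, hΨ]) (fun n x' => hv x' n) _ _ _ _

end Reconstruction

section OPE

/-! ### Operator product expansions with a conformal field -/

variable {M : Type} [AddCommGroup M] [Module ℂ M]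

lemma choose_succ_mul (m : ℤ) (i : ℕ) :
    ((i : ℂ) + 1) * (Ring.choose m (i + 1) : ℤ) = (m - i) * (Ring.choose m i : ℤ) := by
  have h1 := sbinom_succ_mul m i
  have h2 := sbinom_mul_sub m i
  have h3 : ((i : ℤ) + 1) * Ring.choose m (i + 1) = (m - i) * Ring.choose m i := by
    rw [sbinom, pow_succ] at h1
    rw [sbinom] at h2
    have h0 : ((-1 : ℤ) ^ i) ≠ 0 := by simp
    refine mul_left_cancel₀ h0 ?_
    linear_combination -h1 - h2
  exact_mod_cast h3

lemma choose_two (m : ℤ) : ((Ring.choose m 2 : ℤ) : ℂ) = m * (m - 1) / 2 := by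
  have h := choose_succ_mul m 1
  rw [Ring.choose_one_right] at h
  push_cast at h
  norm_num at h
  linear_combination h / 2

lemma choose_three (m : ℤ) : ((Ring.choose m 3 : ℤ) : ℂ) = m * (m - 1) * (m - 2) / 6 := by
  have h := choose_succ_mul m 2
  rw [choose_two] at h
  norm_num at h
  linear_combination h / 3

/-- The expansion of `L(z) a(w)` for a field `a` of weight one, up to a factor `κ`. -/
structure OPE2 (L a : VertexOperator ℂ M) (κ γ : ℂ) : Prop where
  loc : IsLocal L a
  zero : nprod L a 0 = κ • derF a
  one : nprod L a 1 = κ • a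
  two : nprod L a 2 = γ • idF M
  ge : ∀ l : ℤ, 3 ≤ l → nprod L a l = 0

/-- The expansion of `L(z) b(w)` for a field `b` of weight two, up to a factor `κ`. -/
structure OPE3 (L b : VertexOperator ℂ M) (κ : ℂ) (e : VertexOperator ℂ M) (c : ℂ) : Prop where
  loc : IsLocal L b
  zero : nprod L b 0 = κ • derF b
  one : nprod L b 1 = (2 * κ) • b
  two : nprod L b 2 = e
  three : nprod L b 3 = c • idF M
  ge : ∀ l : ℤ, 4 ≤ l → nprod L b l = 0

variable {L a b b' : VertexOperator ℂ M}

lemma OPE3.add {κ c c' : ℂ} {e e' : VertexOperator ℂ M} (h : OPE3 L b κ e c)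
    (h' : OPE3 L b' κ e' c') : OPE3 L (b + b') κ (e + e') (c + c') where
  loc := (h.loc.symm.add h'.loc.symm).symm
  zero := by rw [nprod_add_right, h.zero, h'.zero, map_add, smul_add]
  one := by rw [nprod_add_right, h.one, h'.one, smul_add]
  two := by rw [nprod_add_right, h.two, h'.two]
  three := by rw [nprod_add_right, h.three, h'.three, add_smul]
  ge l hl := by rw [nprod_add_right, h.ge l hl, h'.ge l hl, add_zero]

lemma OPE3.smul {κ c : ℂ} {e : VertexOperator ℂ M} (h : OPE3 L b κ e c) (r : ℂ) :
    OPE3 L (r • b) κ (r • e) (r * c) where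
  loc := (h.loc.symm.smul r).symm
  zero := by rw [nprod_smul_right, h.zero, map_smul, smul_comm]
  one := by rw [nprod_smul_right, h.one, smul_comm]
  two := by rw [nprod_smul_right, h.two]
  three := by rw [nprod_smul_right, h.three, mul_smul]
  ge l hl := by rw [nprod_smul_right, h.ge l hl, smul_zero]

lemma OPE2.derF {κ γ : ℂ} (h : OPE2 L a κ γ) :
    OPE3 L (derF a) κ ((2 * κ) • a) (3 * γ) := by
  have key : ∀ l : ℤ, nprod L (_root_.derF a) l =
      _root_.derF (nprod L a l) + (l : ℂ) • nprod L a (l - 1) := fun l => by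
    rw [derF_nprod, nprod_derF_left]
    module
  refine ⟨(isLocal_derF h.loc.symm).symm, ?_, ?_, ?_, ?_, fun l hl => ?_⟩
  · rw [key, h.zero, map_smul]; simp
  · rw [key, h.one, sub_self, h.zero, map_smul]; push_cast; module
  · rw [key, h.two, show (2 : ℤ) - 1 = 1 by rfl, h.one, map_smul, derF_idF]; push_cast; module
  · rw [key, h.ge 3 le_rfl, show (3 : ℤ) - 1 = 2 by rfl, h.two, map_zero]; push_cast; module
  · rw [key, h.ge l (by omega), h.ge (l - 1) (by omega)]; simp

/-- Wick's formula: commute `L_(l)` past `a_(-1)`. The contributions of `L_(0) a` and `L_(1) a` add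
up to `κ a_(l-2) b`, that of `L_(2) a` survives only for `l = 2`. -/
lemma OPE2.normal {κ γ δ g : ℂ} (ha : OPE2 L a κ γ) (hb : OPE2 L b κ δ) (hab : IsLocal a b)
    (h0 : nprod a b 0 = 0) (h1 : nprod a b 1 = g • idF M)
    (h2 : ∀ l : ℤ, 2 ≤ l → nprod a b l = 0) :
    OPE3 L (nprod a b (-1)) κ (γ • b + δ • a) (κ * g) := by
  have key : ∀ l : ℤ, nprod L (nprod a b (-1)) l =
      nprod a (nprod L b l) (-1) + κ • nprod a b (l - 2) + if l = 2 then γ • b else 0 := by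
    intro l
    have h := ha.loc.nprod_comm b l (-1)
    rw [finsum_eq_sum_range (N := 3) fun i hi => by
      rw [ha.ge i (by omega), nprod_zero_left, smul_zero], sub_eq_iff_eq_add] at h
    rw [h]
    simp only [Finset.sum_range_succ, Finset.sum_range_zero, Nat.cast_zero, Nat.cast_one,
      Nat.cast_ofNat, Ring.choose_zero_right, Ring.choose_one_right, zero_add, ha.zero, ha.one,
      ha.two, nprod_smul_left, nprod_derF_left, nprod_idF_left, sub_zero]
    rw [show l + -1 - 1 = l - 2 by ring]
    have e : Ring.choose l 2 • γ • (if l + -1 - 2 = -1 then b else 0) =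
        if l = 2 then γ • b else 0 := by
      by_cases hl : l = 2
      · subst hl
        have : Ring.choose (2 : ℤ) 2 = 1 := by
          have := Ring.choose_natCast (R := ℤ) 2 2
          simpa using this
        simp [this]
      · rw [if_neg (by omega), if_neg hl]
        simp
    rw [e]
    push_cast
    module
  refine ⟨(isLocal_nprod hab ha.loc.symm hb.loc.symm _).symm, ?_, ?_, ?_, ?_, fun l hl => ?_⟩
  · rw [key, hb.zero, nprod_smul_right, derF_nprod, nprod_derF_left]
    norm_num
    module
  · rw [key, hb.one, nprod_smul_right]
    norm_num
    module
  · rw [key, hb.two, nprod_smul_right, nprod_idF_neg_one, sub_self, h0, if_pos rfl]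
    module
  · rw [key, hb.ge 3 le_rfl, show (3 : ℤ) - 2 = 1 by rfl, h1]
    norm_num
    module
  · rw [key, hb.ge l (by omega), h2 (l - 2) (by omega), if_neg (by omega)]
    simp

lemma OPE2.commFun_eq {κ γ : ℂ} (h : OPE2 L a κ γ) (x : M) (p q : ℤ) :
    commFun L a x p q = (-κ * q) • a〚p + q - 1〛 x +
      (if p + q = 1 then γ * (p * (p - 1) / 2) else 0) • x := by
  rw [h.loc.commFun_eq, finsum_eq_sum_range (N := 3) fun i hi => by
    rw [h.ge i (by omega)]; simp]
  simp only [Finset.sum_range_succ, Finset.sum_range_zero, Nat.cast_zero, Nat.cast_one,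
    Nat.cast_ofNat, Ring.choose_zero_right, Ring.choose_one_right, zero_add, h.zero, h.one, h.two,
    map_smul, Pi.smul_apply, LinearMap.smul_apply, derF_ncoeff, idF_ncoeff, sub_zero]
  rw [← Int.cast_smul_eq_zsmul ℂ (Ring.choose p 2), choose_two]
  by_cases hpq : p + q = 1
  · rw [if_pos (by omega), if_pos hpq]
    push_cast
    module
  · rw [if_neg (by omega), if_neg hpq]
    push_cast
    module

lemma OPE3.commFun_eq {c : ℂ} (h : OPE3 L b 1 0 c) (x : M) (p q : ℤ) :
    commFun L b x p q = ((p : ℂ) - q) • b〚p + q - 1〛 x +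
      (if p + q = 2 then c * (p * (p - 1) * (p - 2) / 6) else 0) • x := by
  rw [h.loc.commFun_eq, finsum_eq_sum_range (N := 4) fun i hi => by
    rw [h.ge i (by omega)]; simp]
  simp only [Finset.sum_range_succ, Finset.sum_range_zero, Nat.cast_zero, Nat.cast_one,
    Nat.cast_ofNat, Ring.choose_zero_right, Ring.choose_one_right, zero_add, h.zero, h.one, h.two,
    h.three, map_smul, Pi.smul_apply, LinearMap.smul_apply, derF_ncoeff, idF_ncoeff, sub_zero,
    map_zero, Pi.zero_apply, LinearMap.zero_apply]
  rw [← Int.cast_smul_eq_zsmul ℂ (Ring.choose p 3), choose_three]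
  by_cases hpq : p + q = 2
  · rw [if_pos (by omega), if_pos hpq]
    push_cast
    module
  · rw [if_neg (by omega), if_neg hpq]
    push_cast
    module

lemma OPE2.of_commFun {κ γ : ℂ} (h : ∀ x p q, commFun L a x p q = (-κ * q) • a〚p + q - 1〛 x +
    (if p + q = 1 then γ * (p * (p - 1) / 2) else 0) • x) : OPE2 L a κ γ := by
  obtain ⟨h1, h2⟩ := nprod_of_commFun (a := L) (b := a) (N := 3) (d := fun l => match l with
    | 0 => κ • _root_.derF a
    | 1 => κ • a
    | _ => γ • idF M) fun x p q => by
      rw [h]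
      simp only [Finset.sum_range_succ, Finset.sum_range_zero, Nat.cast_zero, Nat.cast_one,
        Nat.cast_ofNat, Ring.choose_zero_right, Ring.choose_one_right, zero_add,
        map_smul, Pi.smul_apply, LinearMap.smul_apply, derF_ncoeff, idF_ncoeff, sub_zero]
      rw [← Int.cast_smul_eq_zsmul ℂ (Ring.choose p 2), choose_two]
      by_cases hpq : p + q = 1
      · rw [if_pos (show p + q - 2 = -1 by omega), if_pos hpq]
        push_cast
        module
      · rw [if_neg (show ¬ p + q - 2 = -1 by omega), if_neg hpq]
        push_cast
        module
  refine ⟨h1, ?_, ?_, ?_, fun l hl => ?_⟩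
  · simpa using h2 0
  · simpa using h2 1
  · simpa using h2 2
  · lift l to ℕ using by omega
    rw [h2, if_neg (by omega)]

lemma OPE3.of_commFun {c : ℂ} (h : ∀ x p q, commFun L b x p q = ((p : ℂ) - q) • b〚p + q - 1〛 x +
    (if p + q = 2 then c * (p * (p - 1) * (p - 2) / 6) else 0) • x) : OPE3 L b 1 0 c := by
  obtain ⟨h1, h2⟩ := nprod_of_commFun (a := L) (b := b) (N := 4) (d := fun l => match l with
    | 0 => _root_.derF b
    | 1 => (2 : ℂ) • b
    | 2 => 0
    | _ => c • idF M) fun x p q => by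
      rw [h]
      simp only [Finset.sum_range_succ, Finset.sum_range_zero, Nat.cast_zero, Nat.cast_one,
        Nat.cast_ofNat, Ring.choose_zero_right, Ring.choose_one_right, zero_add,
        map_smul, Pi.smul_apply, LinearMap.smul_apply, derF_ncoeff, idF_ncoeff, sub_zero,
        map_zero, Pi.zero_apply, LinearMap.zero_apply]
      rw [← Int.cast_smul_eq_zsmul ℂ (Ring.choose p 3), choose_three]
      by_cases hpq : p + q = 2
      · rw [if_pos (show p + q - 3 = -1 by omega), if_pos hpq]
        push_cast
        module
      · rw [if_neg (show ¬ p + q - 3 = -1 by omega), if_neg hpq]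
        push_cast
        module
  refine ⟨h1, ?_, ?_, ?_, ?_, fun l hl => ?_⟩
  · simpa using h2 0
  · simpa using h2 1
  · simpa using h2 2
  · simpa using h2 3
  · lift l to ℕ using by omega
    rw [h2, if_neg (by omega)]

/-! ### Fields of the twisted Heisenberg-Virasoro algebra and of `W(2,2)` -/

/-- Fields `L`, `I` that satisfy the relations of the twisted Heisenberg-Virasoro algebra at level
zero. -/
structure HVirFields (cL cLI : ℂ) (L I : VertexOperator ℂ M) : Prop where
  LL : OPE3 L L 1 0 (cL / 2)
  LI : OPE2 L I 1 (-2 * cLI)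
  II : ∀ x, commFun I I x = 0

/-- Fields `L`, `W` that satisfy the relations of `W(2,2)`. -/
structure W22Fields (cL cW : ℂ) (L W : VertexOperator ℂ M) : Prop where
  LL : OPE3 L L 1 0 (cL / 2)
  LW : OPE3 L W 1 0 (cW / 2)
  WW : ∀ x, commFun W W x = 0

lemma commFun_eq_zero_iff {a b : VertexOperator ℂ M} :
    (∀ x, commFun a b x = 0) ↔ ∀ p q x, a〚p〛 (b〚q〛 x) = b〚q〛 (a〚p〛 x) := by
  constructor
  · intro h p q x
    exact sub_eq_zero.mp (congrFun (congrFun (h x) p) q)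
  · intro h x
    ext p q
    exact sub_eq_zero.mpr (h p q x)

/-- An operator that commutes with all modes of `a` and `b` passes through the sum defining their
product. -/
lemma commFun_nprod_eq_zero {a b c : VertexOperator ℂ M} (ha : ∀ x, commFun a c x = 0)
    (hb : ∀ x, commFun b c x = 0) (n : ℤ) (x : M) : commFun (nprod a b n) c x = 0 := by
  rw [commFun_eq_zero_iff] at ha hb
  ext p q
  rw [commFun, nprod_ncoeff, nprod_ncoeff,
    ← map_borSum (c〚q〛) (fun n x => (ha n q x).symm) (fun n x => (hb n q x).symm), sub_self]
  rfl

/-- The weight two field of `W(2,2)` inside the twisted Heisenberg-Virasoro vertex algebra. -/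
def wField (cLI : ℂ) (I : VertexOperator ℂ M) : VertexOperator ℂ M :=
  nprod I I (-1) + (2 * cLI) • derF I

lemma commFun_wField {cLI : ℂ} {I c : VertexOperator ℂ M} (h : ∀ x, commFun I c x = 0) (x : M) :
    commFun (wField cLI I) c x = 0 := by
  rw [wField, commFun_add_left, commFun_nprod_eq_zero h h, commFun_smul_left, derF_eq_nprod,
    commFun_nprod_eq_zero h fun x => ?_, add_zero]
  rw [commFun_eq_zero_iff.mpr]
  intro p q x
  have := commFun_eq_zero_iff.mp (commFun_idF c) q p x
  exact this.symm

lemma commFun_symm {a b : VertexOperator ℂ M} (h : ∀ x, commFun a b x = 0) (x : M) :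
    commFun b a x = 0 := by
  rw [commFun_eq_zero_iff] at h
  exact commFun_eq_zero_iff.mpr (fun p q x => (h q p x).symm) x

/-- At third order each factor of `:II:` contributes `-2 cLI I` and `2 cLI ∂I` contributes `4 cLI
I`, so the pole cancels exactly for this coefficient. The fourth-order pole is `2 cLI · 3 · (-2 cLI)
= -12 cLI²`, which is half of `cW`. The modes of `W` commute because those of `I` do. -/
theorem HVirFields.w22Fields {cL cLI : ℂ} {L I : VertexOperator ℂ M} (h : HVirFields cL cLI L I) :
    W22Fields cL (-24 * cLI ^ 2) L (wField cLI I) where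
  LL := h.LL
  LW := by
    have loc := isLocal_of_commFun_eq_zero h.II
    have z : ∀ l : ℤ, 0 ≤ l → nprod I I l = 0 := fun l hl => by
      lift l to ℕ using hl
      exact nprod_eq_zero_of_commFun_eq_zero h.II l
    have h1 := h.LI.normal (g := 0) h.LI loc (z 0 le_rfl) (by rw [z 1 (by omega), zero_smul])
      fun l hl => z l (by omega)
    have h2 := h1.add (h.LI.derF.smul (2 * cLI))
    have e : (-2 * cLI) • I + (-2 * cLI) • I + (2 * cLI) • ((2 * (1 : ℂ)) • I) = 0 := by module
    rw [e, show 1 * 0 + 2 * cLI * (3 * (-2 * cLI)) = -24 * cLI ^ 2 / 2 by ring] at h2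
    exact h2
  WW := commFun_wField (commFun_symm (commFun_wField h.II))

lemma HVirFields.currents {cL cLI : ℂ} {L I : VertexOperator ℂ M} (h : HVirFields cL cLI L I) :
    Currents (X := Bool) (fun x => if x then L else I) true where
  loc x y := by
    cases x <;> cases y <;> simp only [if_true, Bool.false_eq_true, if_false]
    · exact isLocal_of_commFun_eq_zero h.II
    · exact h.LI.loc.symm
    · exact h.LI.loc
    · exact h.LL.loc
  der x := by
    cases x <;> simp only [if_true, Bool.false_eq_true, if_false]
    · rw [h.LI.zero, one_smul]
    · rw [h.LL.zero, one_smul]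

lemma W22Fields.currents {cL cW : ℂ} {L W : VertexOperator ℂ M} (h : W22Fields cL cW L W) :
    Currents (X := Bool) (fun x => if x then L else W) true where
  loc x y := by
    cases x <;> cases y <;> simp only [if_true, Bool.false_eq_true, if_false]
    · exact isLocal_of_commFun_eq_zero h.WW
    · exact h.LW.loc.symm
    · exact h.LW.loc
    · exact h.LL.loc
  der x := by
    cases x <;> simp only [if_true, Bool.false_eq_true, if_false]
    · rw [h.LW.zero, one_smul]
    · rw [h.LL.zero, one_smul]

end OPE

section Representations

/-! ### Representations of the two Lie algebras by operators -/

attribute [local instance 100] LieRing.ofAssociativeRing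

variable {E : Type} [AddCommGroup E] [Module ℂ E]

/-- Operators that represent the twisted Heisenberg-Virasoro algebra with central charges
`(cL, 0, cLI)`. -/
structure HVirRep (cL cLI : ℂ) (ρL ρI : ℤ → Module.End ℂ E) : Prop where
  LL : ∀ n m, ρL n * ρL m - ρL m * ρL n = ((n : ℂ) - m) • ρL (n + m) +
    (if n + m = 0 then ((n : ℂ) ^ 3 - n) / 12 * cL else 0) • 1
  LI : ∀ n m, ρL n * ρI m - ρI m * ρL n = (-(m : ℂ)) • ρI (n + m) -
    (if n + m = 0 then ((n : ℂ) ^ 2 + n) * cLI else 0) • 1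
  II : ∀ n m, ρI n * ρI m = ρI m * ρI n

/-- Operators that represent `W(2,2)` with central charges `(cL, cW)`. -/
structure W22Rep (cL cW : ℂ) (ρL ρW : ℤ → Module.End ℂ E) : Prop where
  LL : ∀ n m, ρL n * ρL m - ρL m * ρL n = ((n : ℂ) - m) • ρL (n + m) +
    (if n + m = 0 then ((n : ℂ) ^ 3 - n) / 12 * cL else 0) • 1
  LW : ∀ n m, ρL n * ρW m - ρW m * ρL n = ((n : ℂ) - m) • ρW (n + m) +
    (if n + m = 0 then ((n : ℂ) ^ 3 - n) / 12 * cW else 0) • 1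
  WW : ∀ n m, ρW n * ρW m = ρW m * ρW n

lemma linearCombination_bracketExt {ι : Type} (br : ι → ι → (ι →₀ ℂ)) (r : ι → Module.End ℂ E)
    (h : ∀ i j, Finsupp.linearCombination ℂ r (br i j) = r i * r j - r j * r i) (x y : ι →₀ ℂ) :
    Finsupp.linearCombination ℂ r (bracketExt br x y) =
      Finsupp.linearCombination ℂ r x * Finsupp.linearCombination ℂ r y -
        Finsupp.linearCombination ℂ r y * Finsupp.linearCombination ℂ r x := by
  induction x using Finsupp.induction_linear with
  | zero => simp
  | add f g hf hg => simp only [map_add, LinearMap.add_apply, hf, hg]; noncomm_ring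
  | single i a =>
    induction y using Finsupp.induction_linear with
    | zero => simp
    | add f g hf hg => simp only [map_add, hf, hg]; noncomm_ring
    | single j b =>
      rw [bracketExt_single, map_smul, h]
      simp only [Finsupp.linearCombination_single, smul_mul_assoc, mul_smul_comm, smul_sub,
        smul_smul, mul_comm a b]

variable {cL cLI cW : ℂ} {ρL ρI ρW : ℤ → Module.End ℂ E}

/-- The action of basis elements of the twisted Heisenberg-Virasoro algebra. -/
def HVirRep.act (cL cLI : ℂ) (ρL ρI : ℤ → Module.End ℂ E) : HVirIdx → Module.End ℂ E
  | .L n => ρL n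
  | .I n => ρI n
  | .CL => cL • 1
  | .CLI => cLI • 1
  | .CI => 0

/-- The action of basis elements of `W(2,2)`. -/
def W22Rep.act (cL cW : ℂ) (ρL ρW : ℤ → Module.End ℂ E) : W22Idx → Module.End ℂ E
  | .L n => ρL n
  | .W n => ρW n
  | .C => cL • 1
  | .CW => cW • 1

lemma HVirRep.act_br (h : HVirRep cL cLI ρL ρI) (i j : HVirIdx) :
    Finsupp.linearCombination ℂ (act cL cLI ρL ρI) (HVirIdx.br i j) =
      act cL cLI ρL ρI i * act cL cLI ρL ρI j - act cL cLI ρL ρI j * act cL cLI ρL ρI i := by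
  have skew : ∀ a b : HVirIdx, Finsupp.linearCombination ℂ (act cL cLI ρL ρI) (HVirIdx.br a b) =
      act cL cLI ρL ρI a * act cL cLI ρL ρI b - act cL cLI ρL ρI b * act cL cLI ρL ρI a →
      Finsupp.linearCombination ℂ (act cL cLI ρL ρI) (HVirIdx.br b a) =
      act cL cLI ρL ρI b * act cL cLI ρL ρI a - act cL cLI ρL ρI a * act cL cLI ρL ρI b := by
    intro a b hab
    rw [HVirIdx.br_skew, map_neg, hab, neg_sub]
  have hLI : ∀ n m, Finsupp.linearCombination ℂ (act cL cLI ρL ρI) (HVirIdx.br (.L n) (.I m)) =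
      ρL n * ρI m - ρI m * ρL n := by
    intro n m
    rw [h.LI, HVirIdx.br, map_sub, Finsupp.linearCombination_single,
      Finsupp.linearCombination_single, act, act, smul_smul]
    split_ifs <;> simp
  cases i with
  | L n =>
    cases j with
    | L m =>
      rw [act, act, h.LL, HVirIdx.br, map_add, Finsupp.linearCombination_single,
        Finsupp.linearCombination_single, act, act, smul_smul]
      split_ifs <;> simp
    | I m => exact hLI n m
    | _ => simp [HVirIdx.br, act]
  | I n =>
    cases j with
    | L m => exact skew _ _ (hLI m n)
    | I m => simp [HVirIdx.br, act, h.II n m]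
    | _ => simp [HVirIdx.br, act]
  | _ => cases j <;> simp [HVirIdx.br, act, smul_comm cL cLI]

lemma W22Rep.act_br (h : W22Rep cL cW ρL ρW) (i j : W22Idx) :
    Finsupp.linearCombination ℂ (act cL cW ρL ρW) (W22Idx.br i j) =
      act cL cW ρL ρW i * act cL cW ρL ρW j - act cL cW ρL ρW j * act cL cW ρL ρW i := by
  have skew : ∀ a b : W22Idx, Finsupp.linearCombination ℂ (act cL cW ρL ρW) (W22Idx.br a b) =
      act cL cW ρL ρW a * act cL cW ρL ρW b - act cL cW ρL ρW b * act cL cW ρL ρW a →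
      Finsupp.linearCombination ℂ (act cL cW ρL ρW) (W22Idx.br b a) =
      act cL cW ρL ρW b * act cL cW ρL ρW a - act cL cW ρL ρW a * act cL cW ρL ρW b := by
    intro a b hab
    rw [W22Idx.br_skew, map_neg, hab, neg_sub]
  have hLW : ∀ n m, Finsupp.linearCombination ℂ (act cL cW ρL ρW) (W22Idx.br (.L n) (.W m)) =
      ρL n * ρW m - ρW m * ρL n := by
    intro n m
    rw [h.LW, W22Idx.br, map_add, Finsupp.linearCombination_single,
      Finsupp.linearCombination_single, act, act, smul_smul]
    split_ifs <;> simp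
  cases i with
  | L n =>
    cases j with
    | L m =>
      rw [act, act, h.LL, W22Idx.br, map_add, Finsupp.linearCombination_single,
        Finsupp.linearCombination_single, act, act, smul_smul]
      split_ifs <;> simp
    | W m => exact hLW n m
    | _ => simp [W22Idx.br, act]
  | W n =>
    cases j with
    | L m => exact skew _ _ (hLW m n)
    | W m => simp [W22Idx.br, act, h.WW n m]
    | _ => simp [W22Idx.br, act]
  | _ => cases j <;> simp [W22Idx.br, act, smul_comm cL cW]

/-- The Lie algebra homomorphism given by a representation by operators. -/
def HVirRep.lieHom (h : HVirRep cL cLI ρL ρI) : HVir →ₗ⁅ℂ⁆ Module.End ℂ E :=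
  { (Finsupp.linearCombination ℂ (act cL cLI ρL ρI) : (HVirIdx →₀ ℂ) →ₗ[ℂ] Module.End ℂ E) with
    map_lie' := fun {x y} => linearCombination_bracketExt _ _ h.act_br x y }

/-- The Lie algebra homomorphism given by a representation by operators. -/
def W22Rep.lieHom (h : W22Rep cL cW ρL ρW) : W22 →ₗ⁅ℂ⁆ Module.End ℂ E :=
  { (Finsupp.linearCombination ℂ (act cL cW ρL ρW) : (W22Idx →₀ ℂ) →ₗ[ℂ] Module.End ℂ E) with
    map_lie' := fun {x y} => linearCombination_bracketExt _ _ h.act_br x y }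

/-- The action of the enveloping algebra. -/
def HVirRep.hom (h : HVirRep cL cLI ρL ρI) : HVir.U →ₐ[ℂ] Module.End ℂ E :=
  UniversalEnvelopingAlgebra.lift ℂ h.lieHom

/-- The action of the enveloping algebra. -/
def W22Rep.hom (h : W22Rep cL cW ρL ρW) : W22.U →ₐ[ℂ] Module.End ℂ E :=
  UniversalEnvelopingAlgebra.lift ℂ h.lieHom

lemma HVirRep.hom_gen (h : HVirRep cL cLI ρL ρI) (i : HVirIdx) :
    h.hom (HVir.gen i) = act cL cLI ρL ρI i := by
  rw [hom, HVir.gen, UniversalEnvelopingAlgebra.lift_ι_apply]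
  change Finsupp.linearCombination ℂ (act cL cLI ρL ρI) (Finsupp.single i 1) = _
  rw [Finsupp.linearCombination_single, one_smul]

lemma W22Rep.hom_gen (h : W22Rep cL cW ρL ρW) (i : W22Idx) :
    h.hom (W22.gen i) = act cL cW ρL ρW i := by
  rw [hom, W22.gen, UniversalEnvelopingAlgebra.lift_ι_apply]
  change Finsupp.linearCombination ℂ (act cL cW ρL ρW) (Finsupp.single i 1) = _
  rw [Finsupp.linearCombination_single, one_smul]

lemma HVirRep.hom_L (h : HVirRep cL cLI ρL ρI) (n : ℤ) : h.hom (HVir.L n) = ρL n := h.hom_gen _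

lemma HVirRep.hom_I (h : HVirRep cL cLI ρL ρI) (n : ℤ) : h.hom (HVir.I n) = ρI n := h.hom_gen _

lemma W22Rep.hom_L (h : W22Rep cL cW ρL ρW) (n : ℤ) : h.hom (W22.L n) = ρL n := h.hom_gen _

lemma W22Rep.hom_W (h : W22Rep cL cW ρL ρW) (n : ℤ) : h.hom (W22.W n) = ρW n := h.hom_gen _

/-! ### Maps out of modules given by generators and relations -/

section Cyclic

variable {U : Type} [Ring U] [Algebra ℂ U] {S : Set U} (ρ : U →ₐ[ℂ] Module.End ℂ E) (v : E)

lemma annihilates_span (h : ∀ s ∈ S, ρ s v = 0) {u : U} (hu : u ∈ Submodule.span U S) :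
    ρ u v = 0 := by
  induction hu using Submodule.span_induction with
  | mem s hs => exact h s hs
  | zero => simp
  | add x y _ _ hx hy => simp [hx, hy]
  | smul a x _ hx => simp [hx]

/-- The map `u ↦ u • v` on a cyclic module. -/
def cyclicLift (J : Submodule U U) (h : ∀ u ∈ J, ρ u v = 0) : (U ⧸ J) →ₗ[ℂ] E where
  toFun := Quotient.lift (s := J.quotientRel) (fun u => ρ u v) fun a b hab => by
    have : a - b ∈ J := (Submodule.quotientRel_def J).mp hab
    have := h _ this
    rwa [map_sub, LinearMap.sub_apply, sub_eq_zero] at this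
  map_add' x y := by
    obtain ⟨x, rfl⟩ := Submodule.Quotient.mk_surjective J x
    obtain ⟨y, rfl⟩ := Submodule.Quotient.mk_surjective J y
    change ρ (x + y) v = ρ x v + ρ y v
    simp
  map_smul' c x := by
    obtain ⟨x, rfl⟩ := Submodule.Quotient.mk_surjective J x
    change ρ (c • x) v = c • ρ x v
    simp

lemma cyclicLift_mk (J : Submodule U U) (h : ∀ u ∈ J, ρ u v = 0) (u : U) :
    cyclicLift ρ v J h (Submodule.Quotient.mk u) = ρ u v := rfl

lemma cyclicLift_smul (J : Submodule U U) (h : ∀ u ∈ J, ρ u v = 0) (u : U) (x : U ⧸ J) :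
    cyclicLift ρ v J h (u • x) = ρ u (cyclicLift ρ v J h x) := by
  obtain ⟨x, rfl⟩ := Submodule.Quotient.mk_surjective J x
  rw [← Submodule.Quotient.mk_smul, cyclicLift_mk, cyclicLift_mk, smul_eq_mul, map_mul]
  rfl

end Cyclic

end Representations

/-! ### Representations by modes and by products with fields -/

section FieldReps

variable {M : Type} [AddCommGroup M] [Module ℂ M] {cL cLI cW : ℂ} {L I W : VertexOperator ℂ M}

lemma OPE3.mode_comm {b : VertexOperator ℂ M} {c : ℂ} (h : OPE3 L b 1 0 (c / 2)) (n m : ℤ) :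
    L〚n + 1〛 * b〚m + 1〛 - b〚m + 1〛 * L〚n + 1〛 = ((n : ℂ) - m) • b〚n + m + 1〛 +
      (if n + m = 0 then ((n : ℂ) ^ 3 - n) / 12 * c else 0) • 1 := by
  ext x
  have := h.commFun_eq x (n + 1) (m + 1)
  simp only [LinearMap.sub_apply, Module.End.mul_apply, LinearMap.add_apply, LinearMap.smul_apply,
    Module.End.one_apply]
  rw [← commFun, this, show n + 1 + (m + 1) - 1 = n + m + 1 by ring]
  by_cases hnm : n + m = 0
  · rw [if_pos hnm, if_pos (by omega)]
    push_cast
    module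
  · rw [if_neg hnm, if_neg (by omega)]
    push_cast
    module

lemma OPE2.mode_comm {a : VertexOperator ℂ M} {c : ℂ} (h : OPE2 L a 1 (-2 * c)) (n m : ℤ) :
    L〚n + 1〛 * a〚m〛 - a〚m〛 * L〚n + 1〛 = (-(m : ℂ)) • a〚n + m〛 -
      (if n + m = 0 then ((n : ℂ) ^ 2 + n) * c else 0) • 1 := by
  ext x
  have := h.commFun_eq x (n + 1) m
  simp only [LinearMap.sub_apply, Module.End.mul_apply, LinearMap.smul_apply,
    Module.End.one_apply]
  rw [← commFun, this, show n + 1 + m - 1 = n + m by ring]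
  by_cases hnm : n + m = 0
  · rw [if_pos hnm, if_pos (by omega)]
    push_cast
    module
  · rw [if_neg hnm, if_neg (by omega)]
    module

lemma HVirFields.rep (h : HVirFields cL cLI L I) :
    HVirRep cL cLI (fun n => L〚n + 1〛) (fun n => I〚n〛) where
  LL := h.LL.mode_comm
  LI := h.LI.mode_comm
  II n m := LinearMap.ext fun x => commFun_eq_zero_iff.mp h.II n m x

lemma W22Fields.rep (h : W22Fields cL cW L W) :
    W22Rep cL cW (fun n => L〚n + 1〛) (fun n => W〚n + 1〛) where
  LL := h.LL.mode_comm
  LW := h.LW.mode_comm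
  WW n m := LinearMap.ext fun x => commFun_eq_zero_iff.mp h.WW (n + 1) (m + 1) x

lemma OPE3.nprod_comm {b : VertexOperator ℂ M} {c : ℂ} (h : OPE3 L b 1 0 (c / 2)) (n m : ℤ) :
    (nprodₗ (M := M) (n + 1) L) * nprodₗ (m + 1) b - nprodₗ (m + 1) b * nprodₗ (n + 1) L =
      ((n : ℂ) - m) • nprodₗ (n + m + 1) b +
        (if n + m = 0 then ((n : ℂ) ^ 3 - n) / 12 * c else 0) • 1 := by
  ext1 x
  simp only [LinearMap.sub_apply, Module.End.mul_apply, LinearMap.add_apply, LinearMap.smul_apply,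
    Module.End.one_apply, nprodₗ_apply]
  rw [h.loc.nprod_comm, finsum_eq_sum_range (N := 4) fun i hi => by
    rw [h.ge i (by omega)]; simp]
  simp only [Finset.sum_range_succ, Finset.sum_range_zero, Nat.cast_zero, Nat.cast_one,
    Nat.cast_ofNat, Ring.choose_zero_right, Ring.choose_one_right, zero_add, h.zero, h.one, h.two,
    h.three, nprod_smul_left, nprod_derF_left, nprod_idF_left, nprod_zero_left]
  rw [← Int.cast_smul_eq_zsmul ℂ (Ring.choose (n + 1) 3), choose_three,
    show n + 1 + (m + 1) - 0 - 1 = n + m + 1 by ring, show n + 1 + (m + 1) - 1 = n + m + 1 by ring]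
  by_cases hnm : n + m = 0
  · rw [if_pos hnm, if_pos (by omega)]
    push_cast
    module
  · rw [if_neg hnm, if_neg (by omega)]
    push_cast
    module

lemma OPE2.nprod_comm {a : VertexOperator ℂ M} {c : ℂ} (h : OPE2 L a 1 (-2 * c)) (n m : ℤ) :
    (nprodₗ (M := M) (n + 1) L) * nprodₗ m a - nprodₗ m a * nprodₗ (n + 1) L =
      (-(m : ℂ)) • nprodₗ (n + m) a -
        (if n + m = 0 then ((n : ℂ) ^ 2 + n) * c else 0) • 1 := by
  ext1 x
  simp only [LinearMap.sub_apply, Module.End.mul_apply, LinearMap.smul_apply,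
    Module.End.one_apply, nprodₗ_apply]
  rw [h.loc.nprod_comm, finsum_eq_sum_range (N := 3) fun i hi => by
    rw [h.ge i (by omega)]; simp]
  simp only [Finset.sum_range_succ, Finset.sum_range_zero, Nat.cast_zero, Nat.cast_one,
    Nat.cast_ofNat, Ring.choose_zero_right, Ring.choose_one_right, zero_add, h.zero, h.one, h.two,
    nprod_smul_left, nprod_derF_left, nprod_idF_left]
  rw [← Int.cast_smul_eq_zsmul ℂ (Ring.choose (n + 1) 2), choose_two,
    show n + 1 + m - 0 - 1 = n + m by ring, show n + 1 + m - 1 = n + m by ring]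
  by_cases hnm : n + m = 0
  · rw [if_pos hnm, if_pos (by omega)]
    push_cast
    module
  · rw [if_neg hnm, if_neg (by omega)]
    push_cast
    module

lemma nprod_comm_of_commFun_eq_zero {a b : VertexOperator ℂ M} (h : ∀ x, commFun a b x = 0)
    (n m : ℤ) : (nprodₗ (M := M) n a) * nprodₗ m b = nprodₗ m b * nprodₗ n a := by
  ext1 x
  have := (isLocal_of_commFun_eq_zero h).nprod_comm x n m
  rw [finsum_eq_sum_range (N := 0) fun i _ => by
    rw [nprod_eq_zero_of_commFun_eq_zero h, nprod_zero_left, smul_zero] ] at this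
  simpa [sub_eq_zero] using this

/-- The space of all fields on `M` becomes a module over the Lie algebra. Nonnegative products with
`idF M` vanish, so `idF M` can serve as the image of the vacuum; this is the source of the
state-field map. -/
lemma HVirFields.nprodRep (h : HVirFields cL cLI L I) :
    HVirRep cL cLI (fun n => nprodₗ (n + 1) L) (fun n => nprodₗ n I) where
  LL := h.LL.nprod_comm
  LI := h.LI.nprod_comm
  II := nprod_comm_of_commFun_eq_zero h.II

lemma W22Fields.nprodRep (h : W22Fields cL cW L W) :
    W22Rep cL cW (fun n => nprodₗ (n + 1) L) (fun n => nprodₗ (n + 1) W) where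
  LL := h.LL.nprod_comm
  LW := h.LW.nprod_comm
  WW n m := nprod_comm_of_commFun_eq_zero h.WW (n + 1) (m + 1)

end FieldReps

/-! ### Subspaces stable under the enveloping algebras -/

section Stable

attribute [local instance 100] LieRing.ofAssociativeRing

variable {E : Type} [AddCommGroup E] [Module ℂ E]

/-- A subspace that is stable under a Lie algebra is stable under its enveloping algebra. -/
lemma stable_of_ι {𝔤 : Type} [LieRing 𝔤] [LieAlgebra ℂ 𝔤]
    (ρ : UniversalEnvelopingAlgebra ℂ 𝔤 →ₐ[ℂ] Module.End ℂ E) (P : Submodule ℂ E)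
    (h : ∀ x : 𝔤, ∀ v ∈ P, ρ (UniversalEnvelopingAlgebra.ι ℂ x) v ∈ P)
    (u : UniversalEnvelopingAlgebra ℂ 𝔤) : ∀ v ∈ P, ρ u v ∈ P := by
  let S : Subalgebra ℂ (UniversalEnvelopingAlgebra ℂ 𝔤) :=
    { carrier := {u | ∀ v ∈ P, ρ u v ∈ P}
      mul_mem' := fun {a b} ha hb v hv => by
        rw [map_mul, Module.End.mul_apply]
        exact ha _ (hb v hv)
      add_mem' := fun {a b} ha hb v hv => by
        rw [map_add, LinearMap.add_apply]
        exact P.add_mem (ha v hv) (hb v hv)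
      algebraMap_mem' := fun r v hv => by
        rw [AlgHom.commutes, Module.algebraMap_end_apply]
        exact P.smul_mem r hv }
  let f : 𝔤 →ₗ⁅ℂ⁆ S :=
    { toFun := fun x => ⟨UniversalEnvelopingAlgebra.ι ℂ x, h x⟩
      map_add' := fun x y => Subtype.ext (by simp)
      map_smul' := fun c x => Subtype.ext (by simp)
      map_lie' := fun {x y} => Subtype.ext (by
        change UniversalEnvelopingAlgebra.ι ℂ ⁅x, y⁆ = _
        rw [LieHom.map_lie]
        rfl) }
  -- The universal property splits the inclusion of the subalgebra `S` of elements that preserve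
  -- `P`, so `S` is everything.
  have e : S.val.comp (UniversalEnvelopingAlgebra.lift ℂ f) = AlgHom.id ℂ _ := by
    refine UniversalEnvelopingAlgebra.hom_ext ℂ (LieHom.ext fun x => ?_)
    change (UniversalEnvelopingAlgebra.lift ℂ f (UniversalEnvelopingAlgebra.ι ℂ x) :
      UniversalEnvelopingAlgebra ℂ 𝔤) = UniversalEnvelopingAlgebra.ι ℂ x
    rw [UniversalEnvelopingAlgebra.lift_ι_apply]
    rfl
  have : u = (UniversalEnvelopingAlgebra.lift ℂ f u : S) := (DFunLike.congr_fun e u).symm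
  rw [this]
  exact (UniversalEnvelopingAlgebra.lift ℂ f u).2

/-- The identification of the Lie algebra with the space of coordinates. -/
def HVir.ofCoord : (HVirIdx →₀ ℂ) →ₗ[ℂ] HVir where
  toFun x := x
  map_add' _ _ := rfl
  map_smul' _ _ := rfl

lemma HVir.ι_ofCoord (x : HVirIdx →₀ ℂ) :
    UniversalEnvelopingAlgebra.ι ℂ (HVir.ofCoord x) = Finsupp.linearCombination ℂ HVir.gen x := by
  have : (UniversalEnvelopingAlgebra.ι ℂ : HVir →ₗ⁅ℂ⁆ HVir.U).toLinearMap ∘ₗ HVir.ofCoord =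
      Finsupp.linearCombination ℂ HVir.gen := by
    ext i
    simp only [LinearMap.comp_apply, Finsupp.lsingle_apply, Finsupp.linearCombination_single,
      one_smul]
    rfl
  exact LinearMap.congr_fun this x

lemma HVir.stable (ρ : HVir.U →ₐ[ℂ] Module.End ℂ E) (P : Submodule ℂ E)
    (h : ∀ i, ∀ v ∈ P, ρ (HVir.gen i) v ∈ P) (u : HVir.U) : ∀ v ∈ P, ρ u v ∈ P := by
  refine stable_of_ι ρ P (fun x v hv => ?_) u
  obtain ⟨x, rfl⟩ : ∃ y, HVir.ofCoord y = x := ⟨x, rfl⟩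
  rw [HVir.ι_ofCoord, Finsupp.linearCombination_apply, Finsupp.sum, map_sum, LinearMap.sum_apply]
  refine P.sum_mem fun i _ => ?_
  rw [map_smul]
  exact P.smul_mem _ (h i v hv)

/-- The identification of the Lie algebra with the space of coordinates. -/
def W22.ofCoord : (W22Idx →₀ ℂ) →ₗ[ℂ] W22 where
  toFun x := x
  map_add' _ _ := rfl
  map_smul' _ _ := rfl

lemma W22.ι_ofCoord (x : W22Idx →₀ ℂ) :
    UniversalEnvelopingAlgebra.ι ℂ (W22.ofCoord x) = Finsupp.linearCombination ℂ W22.gen x := by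
  have : (UniversalEnvelopingAlgebra.ι ℂ : W22 →ₗ⁅ℂ⁆ W22.U).toLinearMap ∘ₗ W22.ofCoord =
      Finsupp.linearCombination ℂ W22.gen := by
    ext i
    simp only [LinearMap.comp_apply, Finsupp.lsingle_apply, Finsupp.linearCombination_single,
      one_smul]
    rfl
  exact LinearMap.congr_fun this x

lemma W22.stable (ρ : W22.U →ₐ[ℂ] Module.End ℂ E) (P : Submodule ℂ E)
    (h : ∀ i, ∀ v ∈ P, ρ (W22.gen i) v ∈ P) (u : W22.U) : ∀ v ∈ P, ρ u v ∈ P := by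
  refine stable_of_ι ρ P (fun x v hv => ?_) u
  obtain ⟨x, rfl⟩ : ∃ y, W22.ofCoord y = x := ⟨x, rfl⟩
  rw [W22.ι_ofCoord, Finsupp.linearCombination_apply, Finsupp.sum, map_sum, LinearMap.sum_apply]
  refine P.sum_mem fun i _ => ?_
  rw [map_smul]
  exact P.smul_mem _ (h i v hv)

end Stable

/-! ### From restricted representations to fields -/

section Restricted

variable {E : Type} [AddCommGroup E] [Module ℂ E]

/-- The vector `v` generates `E` under two families of operators. -/
def CyclicVector (ρ ρ' : ℤ → Module.End ℂ E) (v : E) : Prop :=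
  ∀ P : Submodule ℂ E, v ∈ P → (∀ n, ∀ x ∈ P, ρ n x ∈ P) → (∀ n, ∀ x ∈ P, ρ' n x ∈ P) → P = ⊤

/-- Every vector is annihilated by all operators of sufficiently large index. -/
def Restricted (ρ : ℤ → Module.End ℂ E) : Prop := ∀ x, ∃ N : ℤ, ∀ n ≥ N, ρ n x = 0

variable {cL cLI cW : ℂ} {ρL ρI ρW : ℤ → Module.End ℂ E} {v : E}

/-- The vectors annihilated by almost all nonnegative modes. -/
def restrictedVectors (ρ ρ' : ℤ → Module.End ℂ E) : Submodule ℂ E where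
  carrier := {x | ∃ N : ℤ, ∀ n ≥ N, ρ n x = 0 ∧ ρ' n x = 0}
  zero_mem' := ⟨0, by simp⟩
  add_mem' := by
    rintro x y ⟨N, hN⟩ ⟨K, hK⟩
    refine ⟨max N K, fun n hn => ?_⟩
    have h1 := hN n (by omega)
    have h2 := hK n (by omega)
    simp [h1.1, h1.2, h2.1, h2.2]
  smul_mem' := by
    rintro c x ⟨N, hN⟩
    exact ⟨N, fun n hn => by simp [(hN n hn).1, (hN n hn).2]⟩

lemma HVirRep.restricted (h : HVirRep cL cLI ρL ρI) (hv : CyclicVector ρL ρI v)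
    (h0 : ∃ N : ℤ, ∀ n ≥ N, ρL n v = 0 ∧ ρI n v = 0) : Restricted ρL ∧ Restricted ρI := by
  have top : restrictedVectors ρL ρI = ⊤ := by
    refine hv _ h0 ?_ ?_
    · rintro m x ⟨N, hN⟩
      -- The bound `N - m` makes the operator of index `n + m` kill `x`; the bound `1 - m` makes `n
      -- + m` positive, so no central term occurs.
      refine ⟨max N (max (N - m) (1 - m)), fun n hn => ⟨?_, ?_⟩⟩
      · have := LinearMap.congr_fun (h.LL n m) x
        simp only [LinearMap.sub_apply, Module.End.mul_apply,
          LinearMap.smul_apply, (hN n (by omega)).1, (hN (n + m) (by omega)).1, map_zero,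
          if_neg (show ¬ n + m = 0 by omega), zero_smul, smul_zero, sub_zero, add_zero] at this
        exact this
      · have := LinearMap.congr_fun (h.LI m n) x
        simp only [LinearMap.sub_apply, Module.End.mul_apply,
          LinearMap.smul_apply, (hN n (by omega)).2, (hN (m + n) (by omega)).2, map_zero,
          if_neg (show ¬ m + n = 0 by omega), zero_smul, smul_zero, sub_zero, zero_sub] at this
        exact neg_eq_zero.mp this
    · rintro m x ⟨N, hN⟩
      refine ⟨max N (max (N - m) (1 - m)), fun n hn => ⟨?_, ?_⟩⟩
      · have := LinearMap.congr_fun (h.LI n m) x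
        simp only [LinearMap.sub_apply, Module.End.mul_apply,
          LinearMap.smul_apply, (hN n (by omega)).1, (hN (n + m) (by omega)).2, map_zero,
          if_neg (show ¬ n + m = 0 by omega), zero_smul, smul_zero, sub_zero] at this
        exact this
      · have := LinearMap.congr_fun (h.II n m) x
        simp only [Module.End.mul_apply, (hN n (by omega)).2, map_zero] at this
        exact this
  have all : ∀ x, x ∈ restrictedVectors ρL ρI := fun x => by rw [top]; trivial
  refine ⟨fun x => ?_, fun x => ?_⟩
  · obtain ⟨N, hN⟩ := all x
    exact ⟨N, fun n hn => (hN n hn).1⟩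
  · obtain ⟨N, hN⟩ := all x
    exact ⟨N, fun n hn => (hN n hn).2⟩

lemma W22Rep.restricted (h : W22Rep cL cW ρL ρW) (hv : CyclicVector ρL ρW v)
    (h0 : ∃ N : ℤ, ∀ n ≥ N, ρL n v = 0 ∧ ρW n v = 0) : Restricted ρL ∧ Restricted ρW := by
  have top : restrictedVectors ρL ρW = ⊤ := by
    refine hv _ h0 ?_ ?_
    · rintro m x ⟨N, hN⟩
      refine ⟨max N (max (N - m) (1 - m)), fun n hn => ⟨?_, ?_⟩⟩
      · have := LinearMap.congr_fun (h.LL n m) x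
        simp only [LinearMap.sub_apply, Module.End.mul_apply,
          LinearMap.smul_apply, (hN n (by omega)).1, (hN (n + m) (by omega)).1, map_zero,
          if_neg (show ¬ n + m = 0 by omega), zero_smul, smul_zero, sub_zero, add_zero] at this
        exact this
      · have := LinearMap.congr_fun (h.LW m n) x
        simp only [LinearMap.sub_apply, Module.End.mul_apply,
          LinearMap.smul_apply, (hN n (by omega)).2, (hN (m + n) (by omega)).2, map_zero,
          if_neg (show ¬ m + n = 0 by omega), zero_smul, smul_zero, zero_sub, add_zero] at this
        exact neg_eq_zero.mp this
    · rintro m x ⟨N, hN⟩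
      refine ⟨max N (max (N - m) (1 - m)), fun n hn => ⟨?_, ?_⟩⟩
      · have := LinearMap.congr_fun (h.LW n m) x
        simp only [LinearMap.sub_apply, Module.End.mul_apply,
          LinearMap.smul_apply, (hN n (by omega)).1, (hN (n + m) (by omega)).2, map_zero,
          if_neg (show ¬ n + m = 0 by omega), zero_smul, smul_zero, sub_zero, add_zero] at this
        exact this
      · have := LinearMap.congr_fun (h.WW n m) x
        simp only [Module.End.mul_apply, (hN n (by omega)).2, map_zero] at this
        exact this
  have all : ∀ x, x ∈ restrictedVectors ρL ρW := fun x => by rw [top]; trivial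
  refine ⟨fun x => ?_, fun x => ?_⟩
  · obtain ⟨N, hN⟩ := all x
    exact ⟨N, fun n hn => (hN n hn).1⟩
  · obtain ⟨N, hN⟩ := all x
    exact ⟨N, fun n hn => (hN n hn).2⟩

/-- The field `∑ ρ(n) z^{-n-2}`. -/
def Restricted.weightTwo {ρ : ℤ → Module.End ℂ E} (h : Restricted ρ) : VertexOperator ℂ E :=
  mkField (fun n => ρ (n - 1)) fun x => by
    obtain ⟨N, hN⟩ := h x
    exact ⟨N + 1, fun n hn => hN _ (by omega)⟩

/-- The field `∑ ρ(n) z^{-n-1}`. -/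
def Restricted.weightOne {ρ : ℤ → Module.End ℂ E} (h : Restricted ρ) : VertexOperator ℂ E :=
  mkField ρ h

@[simp] lemma Restricted.weightTwo_ncoeff {ρ : ℤ → Module.End ℂ E} (h : Restricted ρ) (n : ℤ) :
    h.weightTwo〚n〛 = ρ (n - 1) := mkField_ncoeff _ _ n

@[simp] lemma Restricted.weightOne_ncoeff {ρ : ℤ → Module.End ℂ E} (h : Restricted ρ) (n : ℤ) :
    h.weightOne〚n〛 = ρ n := mkField_ncoeff _ _ n

lemma OPE3.of_rep {ρ ρ' : ℤ → Module.End ℂ E} (h : Restricted ρ) (h' : Restricted ρ') {c : ℂ}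
    (hc : ∀ n m, ρ n * ρ' m - ρ' m * ρ n = ((n : ℂ) - m) • ρ' (n + m) +
      (if n + m = 0 then ((n : ℂ) ^ 3 - n) / 12 * c else 0) • 1) :
    OPE3 h.weightTwo h'.weightTwo 1 0 (c / 2) := by
  refine OPE3.of_commFun fun x p q => ?_
  have := LinearMap.congr_fun (hc (p - 1) (q - 1)) x
  simp only [LinearMap.sub_apply, Module.End.mul_apply, LinearMap.add_apply, LinearMap.smul_apply,
    Module.End.one_apply] at this
  rw [commFun]
  simp only [Restricted.weightTwo_ncoeff]
  rw [this, show p - 1 + (q - 1) = p + q - 1 - 1 by ring]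
  by_cases hpq : p + q - 1 - 1 = 0
  · rw [if_pos hpq, if_pos (by omega)]
    push_cast
    module
  · rw [if_neg hpq, if_neg (by omega)]
    push_cast
    module

lemma HVirRep.fields (h : HVirRep cL cLI ρL ρI) (hL : Restricted ρL) (hI : Restricted ρI) :
    HVirFields cL cLI hL.weightTwo hI.weightOne where
  LL := OPE3.of_rep hL hL h.LL
  LI := by
    refine OPE2.of_commFun fun x p q => ?_
    have := LinearMap.congr_fun (h.LI (p - 1) q) x
    simp only [LinearMap.sub_apply, Module.End.mul_apply, LinearMap.smul_apply,
      Module.End.one_apply] at this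
    rw [commFun]
    simp only [Restricted.weightTwo_ncoeff, Restricted.weightOne_ncoeff]
    rw [this, show p - 1 + q = p + q - 1 by ring]
    by_cases hpq : p + q - 1 = 0
    · rw [if_pos hpq, if_pos (by omega)]
      push_cast
      module
    · rw [if_neg hpq, if_neg (by omega)]
      module
  II := commFun_eq_zero_iff.mpr fun p q x => by
    simpa using LinearMap.congr_fun (h.II p q) x

lemma W22Rep.fields (h : W22Rep cL cW ρL ρW) (hL : Restricted ρL) (hW : Restricted ρW) :
    W22Fields cL cW hL.weightTwo hW.weightTwo where
  LL := OPE3.of_rep hL hL h.LL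
  LW := OPE3.of_rep hL hW h.LW
  WW := commFun_eq_zero_iff.mpr fun p q x => by
    simpa using LinearMap.congr_fun (h.WW (p - 1) (q - 1)) x

end Restricted

/-! ### Commutation relations in the enveloping algebras and cyclic modules -/

section Modules

attribute [local instance 100] LieRing.ofAssociativeRing

lemma HVir.gen_comm (i j : HVirIdx) : gen i * gen j - gen j * gen i =
    Finsupp.linearCombination ℂ gen (HVirIdx.br i j) := by
  have : HVir.ofCoord (HVirIdx.br i j) = ⁅basisVec i, basisVec j⁆ := by
    change _ = bracketExt HVirIdx.br (Finsupp.single i 1) (Finsupp.single j 1)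
    rw [bracketExt_single, mul_one, one_smul]
    rfl
  rw [← HVir.ι_ofCoord, this, LieHom.map_lie, LieRing.of_associative_ring_bracket]
  rfl

lemma W22.gen_comm (i j : W22Idx) : gen i * gen j - gen j * gen i =
    Finsupp.linearCombination ℂ gen (W22Idx.br i j) := by
  have : W22.ofCoord (W22Idx.br i j) = ⁅basisVec i, basisVec j⁆ := by
    change _ = bracketExt W22Idx.br (Finsupp.single i 1) (Finsupp.single j 1)
    rw [bracketExt_single, mul_one, one_smul]
    rfl
  rw [← W22.ι_ofCoord, this, LieHom.map_lie, LieRing.of_associative_ring_bracket]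
  rfl

lemma HVir.L_mul_L (n m : ℤ) : L n * L m - L m * L n = ((n : ℂ) - m) • L (n + m) +
    (if n + m = 0 then ((n : ℂ) ^ 3 - n) / 12 else 0) • gen .CL := by
  refine (gen_comm _ _).trans ?_
  rw [HVirIdx.br, map_add, Finsupp.linearCombination_single, Finsupp.linearCombination_single]
  rfl

lemma HVir.L_mul_I (n m : ℤ) : L n * I m - I m * L n = (-(m : ℂ)) • I (n + m) -
    (if n + m = 0 then (n : ℂ) ^ 2 + n else 0) • gen .CLI := by
  refine (gen_comm _ _).trans ?_
  rw [HVirIdx.br, map_sub, Finsupp.linearCombination_single, Finsupp.linearCombination_single]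
  rfl

lemma HVir.I_mul_I (n m : ℤ) : I n * I m - I m * I n =
    (if n + m = 0 then (n : ℂ) else 0) • gen .CI := by
  refine (gen_comm _ _).trans ?_
  rw [HVirIdx.br, Finsupp.linearCombination_single]

lemma W22.L_mul_L (n m : ℤ) : L n * L m - L m * L n = ((n : ℂ) - m) • L (n + m) +
    (if n + m = 0 then ((n : ℂ) ^ 3 - n) / 12 else 0) • gen .C := by
  refine (gen_comm _ _).trans ?_
  rw [W22Idx.br, map_add, Finsupp.linearCombination_single, Finsupp.linearCombination_single]
  rfl

lemma W22.L_mul_W (n m : ℤ) : L n * W m - W m * L n = ((n : ℂ) - m) • W (n + m) +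
    (if n + m = 0 then ((n : ℂ) ^ 3 - n) / 12 else 0) • gen .CW := by
  refine (gen_comm _ _).trans ?_
  rw [W22Idx.br, map_add, Finsupp.linearCombination_single, Finsupp.linearCombination_single]
  rfl

lemma W22.W_mul_W (n m : ℤ) : W n * W m - W m * W n = 0 := by
  refine (gen_comm _ _).trans ?_
  rw [show W22Idx.br (.W n) (.W m) = 0 from rfl, map_zero]

lemma HVir.gen_central {i : HVirIdx} (hi : i = .CL ∨ i = .CLI ∨ i = .CI) (j : HVirIdx) :
    gen j * gen i = gen i * gen j := by
  refine sub_eq_zero.mp ((gen_comm _ _).trans ?_)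
  have : HVirIdx.br j i = 0 := by
    rcases hi with rfl | rfl | rfl <;> cases j <;> rfl
  rw [this, map_zero]

lemma W22.gen_central {i : W22Idx} (hi : i = .C ∨ i = .CW) (j : W22Idx) :
    gen j * gen i = gen i * gen j := by
  refine sub_eq_zero.mp ((gen_comm _ _).trans ?_)
  have : W22Idx.br j i = 0 := by
    rcases hi with rfl | rfl <;> cases j <;> rfl
  rw [this, map_zero]

/-- The operator by which an element of an algebra acts on a module. -/
abbrev opOf {U : Type} [Ring U] [Algebra ℂ U] (Q : Type) [AddCommGroup Q] [Module ℂ Q] [Module U Q]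
    [IsScalarTower ℂ U Q] : U →ₐ[ℂ] Module.End ℂ Q :=
  haveI := IsScalarTower.to_smulCommClass (R := ℂ) (A := U) (M := Q)
  Algebra.lsmul ℂ ℂ Q

variable {Q : Type} [AddCommGroup Q] [Module ℂ Q]

/-- The modules of the twisted Heisenberg-Virasoro algebra of central charges `(cL, 0, cLI)` that
are generated by `v`. -/
structure HVir.IsCyclic [Module HVir.U Q] [IsScalarTower ℂ HVir.U Q] (cL cLI : ℂ) (v : Q) :
    Prop where
  cL : gen .CL • v = cL • v
  cLI : gen .CLI • v = cLI • v
  cI : gen .CI • v = 0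
  span : ∀ x : Q, ∃ u : HVir.U, x = u • v

/-- The modules of `W(2,2)` of central charges `(cL, cW)` that are generated by `v`. -/
structure W22.IsCyclic [Module W22.U Q] [IsScalarTower ℂ W22.U Q] (cL cW : ℂ) (v : Q) :
    Prop where
  cL : gen .C • v = cL • v
  cW : gen .CW • v = cW • v
  span : ∀ x : Q, ∃ u : W22.U, x = u • v

/-- The eigenspace of a central element is stable under the enveloping algebra, and here it contains
a generator. -/
lemma HVir.central_smul [Module HVir.U Q] [IsScalarTower ℂ HVir.U Q] {v : Q}
    (hs : ∀ x : Q, ∃ u : HVir.U, x = u • v) {i : HVirIdx} (hi : i = .CL ∨ i = .CLI ∨ i = .CI)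
    {c : ℂ} (hc : gen i • v = c • v) (x : Q) : gen i • x = c • x := by
  have := IsScalarTower.to_smulCommClass (R := ℂ) (A := HVir.U) (M := Q)
  have := HVir.stable (opOf Q) (LinearMap.ker (opOf Q (gen i) - c • 1)) (fun j x hx => by
    rw [LinearMap.mem_ker, LinearMap.sub_apply, sub_eq_zero] at hx ⊢
    change gen i • x = c • x at hx
    change gen i • gen j • x = c • gen j • x
    rw [smul_smul, ← gen_central hi, mul_smul, hx, smul_comm])
  obtain ⟨u, rfl⟩ := hs x
  exact sub_eq_zero.mp (this u v (sub_eq_zero.mpr hc))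

lemma W22.central_smul [Module W22.U Q] [IsScalarTower ℂ W22.U Q] {v : Q}
    (hs : ∀ x : Q, ∃ u : W22.U, x = u • v) {i : W22Idx} (hi : i = .C ∨ i = .CW)
    {c : ℂ} (hc : gen i • v = c • v) (x : Q) : gen i • x = c • x := by
  have := IsScalarTower.to_smulCommClass (R := ℂ) (A := W22.U) (M := Q)
  have := W22.stable (opOf Q) (LinearMap.ker (opOf Q (gen i) - c • 1)) (fun j x hx => by
    rw [LinearMap.mem_ker, LinearMap.sub_apply, sub_eq_zero] at hx ⊢
    change gen i • x = c • x at hx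
    change gen i • gen j • x = c • gen j • x
    rw [smul_smul, ← gen_central hi, mul_smul, hx, smul_comm])
  obtain ⟨u, rfl⟩ := hs x
  exact sub_eq_zero.mp (this u v (sub_eq_zero.mpr hc))

section HVirModules

variable [Module HVir.U Q] [IsScalarTower ℂ HVir.U Q] {cL cLI : ℂ} {v : Q}

lemma HVir.IsCyclic.rep (h : HVir.IsCyclic cL cLI v) :
    HVirRep cL cLI (fun n => opOf Q (HVir.L n)) (fun n => opOf Q (HVir.I n)) where
  LL n m := by
    have e : opOf Q (gen .CL) = cL • 1 := LinearMap.ext (central_smul h.span (by simp) h.cL)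
    rw [← map_mul, ← map_mul, ← map_sub, L_mul_L, map_add, map_smul, map_smul, e, smul_smul]
    split_ifs <;> simp
  LI n m := by
    have e : opOf Q (gen .CLI) = cLI • 1 := LinearMap.ext (central_smul h.span (by simp) h.cLI)
    rw [← map_mul, ← map_mul, ← map_sub, L_mul_I, map_sub, map_smul, map_smul, e, smul_smul]
    split_ifs <;> simp
  II n m := by
    have e : opOf Q (gen .CI) = 0 := LinearMap.ext fun x =>
      (central_smul (c := 0) h.span (by simp) (by rw [h.cI, zero_smul]) x).trans (zero_smul ℂ x)
    rw [← sub_eq_zero, ← map_mul, ← map_mul, ← map_sub, I_mul_I, map_smul, e, smul_zero]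

lemma HVir.IsCyclic.cyclicVector (h : HVir.IsCyclic cL cLI v) :
    CyclicVector (fun n => opOf Q (HVir.L n)) (fun n => opOf Q (HVir.I n)) v := by
  intro P hv hL hI
  refine eq_top_iff.mpr fun x _ => ?_
  obtain ⟨u, rfl⟩ := h.span x
  refine HVir.stable (opOf Q) P (fun i y hy => ?_) u v hv
  change gen i • y ∈ P
  cases i with
  | L n => exact hL n y hy
  | I n => exact hI n y hy
  | CL => rw [central_smul h.span (by simp) h.cL]; exact P.smul_mem _ hy
  | CLI => rw [central_smul h.span (by simp) h.cLI]; exact P.smul_mem _ hy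
  | CI =>
    rw [central_smul (c := 0) h.span (by simp) (by rw [h.cI, zero_smul])]
    exact P.smul_mem _ hy

end HVirModules

section W22Modules

variable [Module W22.U Q] [IsScalarTower ℂ W22.U Q] {cL cW : ℂ} {v : Q}

lemma W22.IsCyclic.rep (h : W22.IsCyclic cL cW v) :
    W22Rep cL cW (fun n => opOf Q (W22.L n)) (fun n => opOf Q (W22.W n)) where
  LL n m := by
    have e : opOf Q (gen .C) = cL • 1 := LinearMap.ext (central_smul h.span (by simp) h.cL)
    rw [← map_mul, ← map_mul, ← map_sub, L_mul_L, map_add, map_smul, map_smul, e, smul_smul]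
    split_ifs <;> simp
  LW n m := by
    have e : opOf Q (gen .CW) = cW • 1 := LinearMap.ext (central_smul h.span (by simp) h.cW)
    rw [← map_mul, ← map_mul, ← map_sub, L_mul_W, map_add, map_smul, map_smul, e, smul_smul]
    split_ifs <;> simp
  WW n m := by
    rw [← sub_eq_zero, ← map_mul, ← map_mul, ← map_sub, W_mul_W, map_zero]

lemma W22.IsCyclic.cyclicVector (h : W22.IsCyclic cL cW v) :
    CyclicVector (fun n => opOf Q (W22.L n)) (fun n => opOf Q (W22.W n)) v := by
  intro P hv hL hI
  refine eq_top_iff.mpr fun x _ => ?_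
  obtain ⟨u, rfl⟩ := h.span x
  refine W22.stable (opOf Q) P (fun i y hy => ?_) u v hv
  change gen i • y ∈ P
  cases i with
  | L n => exact hL n y hy
  | W n => exact hI n y hy
  | C => rw [central_smul h.span (by simp) h.cL]; exact P.smul_mem _ hy
  | CW => rw [central_smul h.span (by simp) h.cW]; exact P.smul_mem _ hy

end W22Modules

lemma mk_eq_smul_mk_one {U : Type} [Ring U] (J : Submodule U U) (u : U) :
    (Submodule.Quotient.mk u : U ⧸ J) = u • Submodule.Quotient.mk 1 := by
  rw [← Submodule.Quotient.mk_smul, smul_eq_mul, mul_one]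

lemma smul_mk_one_eq_zero {U : Type} [Ring U] (J : Submodule U U) {u : U} (h : u ∈ J) :
    u • (Submodule.Quotient.mk 1 : U ⧸ J) = 0 := by
  rw [← mk_eq_smul_mk_one, (Submodule.Quotient.mk_eq_zero J).mpr h]

lemma smul_mk_one_eq_smul {U : Type} [Ring U] [Algebra ℂ U] (J : Submodule U U) {u : U} {c : ℂ}
    (h : u - algebraMap ℂ U c ∈ J) :
    u • (Submodule.Quotient.mk 1 : U ⧸ J) = c • Submodule.Quotient.mk 1 := by
  rw [← algebraMap_smul U c, ← sub_eq_zero, ← sub_smul, smul_mk_one_eq_zero J h]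

lemma HVir.Verma.isCyclic (cL cLI h hI : ℂ) :
    HVir.IsCyclic cL cLI (Verma.hwv cL 0 cLI h hI) where
  cL := smul_mk_one_eq_smul _ (Submodule.subset_span (by simp))
  cLI := smul_mk_one_eq_smul _ (Submodule.subset_span (by simp))
  cI := (smul_mk_one_eq_smul (c := 0) _ (Submodule.subset_span (by simp))).trans (zero_smul ℂ _)
  span x := by
    obtain ⟨u, rfl⟩ := Submodule.Quotient.mk_surjective _ x
    exact ⟨u, mk_eq_smul_mk_one _ u⟩

lemma HVir.Verma.L_hwv (cL cLI h hI : ℂ) {n : ℤ} (hn : 0 < n) :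
    L n • Verma.hwv cL 0 cLI h hI = 0 :=
  smul_mk_one_eq_zero _ (Submodule.subset_span (Or.inl ⟨n, hn, Or.inl rfl⟩))

lemma HVir.Verma.I_hwv (cL cLI h hI : ℂ) {n : ℤ} (hn : 0 < n) :
    I n • Verma.hwv cL 0 cLI h hI = 0 :=
  smul_mk_one_eq_zero _ (Submodule.subset_span (Or.inl ⟨n, hn, Or.inr rfl⟩))

lemma HVir.Verma.L_zero_hwv (cL cLI h hI : ℂ) :
    L 0 • Verma.hwv cL 0 cLI h hI = h • Verma.hwv cL 0 cLI h hI :=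
  smul_mk_one_eq_smul _ (Submodule.subset_span (by simp))

lemma HVir.Verma.I_zero_hwv (cL cLI h hI : ℂ) :
    I 0 • Verma.hwv cL 0 cLI h hI = hI • Verma.hwv cL 0 cLI h hI :=
  smul_mk_one_eq_smul _ (Submodule.subset_span (by simp))

lemma HVir.IsCyclic.mkQ [Module HVir.U Q] [IsScalarTower ℂ HVir.U Q] {cL cLI : ℂ} {v : Q}
    (h : HVir.IsCyclic cL cLI v) (N : Submodule HVir.U Q) :
    HVir.IsCyclic cL cLI (Submodule.Quotient.mk v : Q ⧸ N) where
  cL := by rw [← Submodule.Quotient.mk_smul, h.cL, Submodule.Quotient.mk_smul]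
  cLI := by rw [← Submodule.Quotient.mk_smul, h.cLI, Submodule.Quotient.mk_smul]
  cI := by rw [← Submodule.Quotient.mk_smul, h.cI, Submodule.Quotient.mk_zero]
  span x := by
    obtain ⟨x, rfl⟩ := Submodule.Quotient.mk_surjective _ x
    obtain ⟨u, rfl⟩ := h.span x
    exact ⟨u, Submodule.Quotient.mk_smul _ _ _⟩

lemma HVir.Vac.isCyclic (cL cLI : ℂ) : HVir.IsCyclic cL cLI (Vac.one cL cLI) :=
  (Verma.isCyclic cL cLI 0 0).mkQ _

lemma W22.Verma.isCyclic (cL cW h hW : ℂ) : W22.IsCyclic cL cW (Verma.hwv cL cW h hW) where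
  cL := smul_mk_one_eq_smul _ (Submodule.subset_span (by simp))
  cW := smul_mk_one_eq_smul _ (Submodule.subset_span (by simp))
  span x := by
    obtain ⟨u, rfl⟩ := Submodule.Quotient.mk_surjective _ x
    exact ⟨u, mk_eq_smul_mk_one _ u⟩

lemma W22.Vac.isCyclic (cL cW : ℂ) : W22.IsCyclic cL cW (Vac.one cL cW) where
  cL := smul_mk_one_eq_smul _ (Submodule.subset_span (by simp))
  cW := smul_mk_one_eq_smul _ (Submodule.subset_span (by simp))
  span x := by
    obtain ⟨u, rfl⟩ := Submodule.Quotient.mk_surjective _ x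
    exact ⟨u, mk_eq_smul_mk_one _ u⟩

lemma W22.Vac.L_one (cL cW : ℂ) {n : ℤ} (hn : -1 ≤ n) : L n • Vac.one cL cW = 0 :=
  smul_mk_one_eq_zero _ (Submodule.subset_span (Or.inl ⟨n, hn, Or.inl rfl⟩))

lemma W22.Vac.W_one (cL cW : ℂ) {n : ℤ} (hn : -1 ≤ n) : W n • Vac.one cL cW = 0 :=
  smul_mk_one_eq_zero _ (Submodule.subset_span (Or.inl ⟨n, hn, Or.inr rfl⟩))

end Modules

section Filtration

/-! ### The weight filtration of a polynomial ring -/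

open MvPolynomial

variable {σ τ : Type} {w : σ → ℕ} {w' : τ → ℕ}

/-- The polynomials all of whose monomials have weight less than `k`. -/
def lowWeight (w : σ → ℕ) (k : ℕ) : Submodule ℂ (MvPolynomial σ ℂ) where
  carrier := {p | ∀ m, coeff m p ≠ 0 → Finsupp.weight w m < k}
  zero_mem' m h := absurd (coeff_zero m) h
  add_mem' {p q} hp hq m h := by
    by_cases h' : coeff m p = 0
    · exact hq m fun h'' => h (by rw [coeff_add, h', h'', add_zero])
    · exact hp m h'
  smul_mem' c p hp m h := hp m fun h' => h (by rw [coeff_smul, h', smul_zero])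

/-- With the strict inequality in `lowWeight`, level `0` is the zero space; descent through the
levels ends here. -/
lemma lowWeight_zero {p : MvPolynomial σ ℂ} (h : p ∈ lowWeight w 0) : p = 0 := by
  ext m
  by_contra h'
  exact absurd (h m h') (by omega)

lemma lowWeight_mono {a b : ℕ} (h : a ≤ b) : lowWeight w a ≤ lowWeight w b :=
  fun _ hp m hm => (hp m hm).trans_le h

lemma exists_mem_lowWeight (w : σ → ℕ) (p : MvPolynomial σ ℂ) : ∃ k, p ∈ lowWeight w k := by
  refine ⟨p.support.sup (Finsupp.weight w) + 1, fun m hm => ?_⟩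
  exact Nat.lt_succ_of_le (Finset.le_sup (f := Finsupp.weight w) (mem_support_iff.mpr hm))

/-- Level `a + 1` means weight at most `a`, which explains the asymmetric indices. -/
lemma mul_mem_lowWeight {a b : ℕ} {p q : MvPolynomial σ ℂ} (hp : p ∈ lowWeight w (a + 1))
    (hq : q ∈ lowWeight w b) : p * q ∈ lowWeight w (b + a) := by
  classical
  intro m hm
  rw [coeff_mul] at hm
  obtain ⟨x, hx, hx'⟩ := Finset.exists_ne_zero_of_sum_ne_zero hm
  have h1 := hp x.1 (left_ne_zero_of_mul hx')
  have h2 := hq x.2 (right_ne_zero_of_mul hx')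
  rw [← Finset.HasAntidiagonal.mem_antidiagonal.mp hx, map_add]
  omega

lemma X_mem_lowWeight (w : σ → ℕ) (i : σ) : (X i : MvPolynomial σ ℂ) ∈ lowWeight w (w i + 1) := by
  classical
  intro m hm
  rw [coeff_X] at hm
  have : Finsupp.single i 1 = m := by
    by_contra h
    exact hm (if_neg h)
  rw [← this, Finsupp.weight_single, one_smul]
  omega

lemma C_mem_lowWeight (w : σ → ℕ) (c : ℂ) : (C c : MvPolynomial σ ℂ) ∈ lowWeight w 1 := by
  classical
  intro m hm
  rw [coeff_C] at hm
  have : 0 = m := by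
    by_contra h
    exact hm (if_neg h)
  rw [← this, map_zero]
  omega

lemma one_mem_lowWeight (w : σ → ℕ) : (1 : MvPolynomial σ ℂ) ∈ lowWeight w 1 :=
  C_mem_lowWeight w 1

lemma pderiv_mem_lowWeight {k : ℕ} {p : MvPolynomial σ ℂ} (i : σ) (hp : p ∈ lowWeight w (k + w i)) :
    pderiv i p ∈ lowWeight w k := by
  intro m hm
  rw [coeff_pderiv] at hm
  have := hp _ (left_ne_zero_of_mul hm)
  rw [map_add, Finsupp.weight_single, one_smul] at this
  omega

lemma multiset_prod_mem_lowWeight {ι : Type} {wι : ι → ℕ} {g : ι → MvPolynomial τ ℂ}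
    (hg : ∀ i, g i ∈ lowWeight w' (wι i + 1)) (s : Multiset ι) :
    (s.map g).prod ∈ lowWeight w' ((s.map wι).sum + 1) := by
  induction s using Multiset.induction_on with
  | empty => simpa using one_mem_lowWeight w'
  | cons i s ih =>
    rw [Multiset.map_cons, Multiset.map_cons, Multiset.prod_cons, Multiset.sum_cons]
    exact lowWeight_mono (by omega) (mul_mem_lowWeight (hg i) ih)

lemma weight_eq_sum_toMultiset (w : σ → ℕ) (m : σ →₀ ℕ) :
    Finsupp.weight w m = (m.toMultiset.map w).sum := by
  induction m using Finsupp.induction_linear with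
  | zero => simp
  | add f g hf hg => rw [map_add, hf, hg, map_add, Multiset.map_add, Multiset.sum_add]
  | single i n => simp [Finsupp.weight_single, Finsupp.toMultiset_single, Multiset.map_nsmul, Multiset.sum_nsmul]

lemma aeval_monomial_one {A : Type} [CommRing A] [Algebra ℂ A] (g : σ → A) (m : σ →₀ ℕ) :
    aeval g (monomial m (1 : ℂ)) = (m.toMultiset.map g).prod := by
  rw [aeval_monomial, map_one, one_mul, Finsupp.toMultiset_map, Finsupp.prod_toMultiset,
    Finsupp.prod_mapDomain_index (fun _ => pow_zero _) fun _ _ _ => pow_add _ _ _]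

lemma linear_mem_of_lowWeight {E : Type} [AddCommGroup E] [Module ℂ E]
    (f : MvPolynomial σ ℂ →ₗ[ℂ] E) (P : Submodule ℂ E) {k : ℕ}
    (hf : ∀ m, Finsupp.weight w m < k → f (monomial m 1) ∈ P) {p : MvPolynomial σ ℂ}
    (hp : p ∈ lowWeight w k) : f p ∈ P := by
  rw [p.as_sum, map_sum]
  refine P.sum_mem fun m hm => ?_
  rw [← mul_one (coeff m p), ← smul_eq_mul, ← smul_monomial, map_smul]
  exact P.smul_mem _ (hf m (hp m (mem_support_iff.mp hm)))

lemma aeval_mem_lowWeight {g : σ → MvPolynomial τ ℂ} (hg : ∀ i, g i ∈ lowWeight w' (w i + 1))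
    {k : ℕ} {p : MvPolynomial σ ℂ} (hp : p ∈ lowWeight w k) : aeval g p ∈ lowWeight w' k := by
  refine linear_mem_of_lowWeight (aeval g).toLinearMap _ (fun m hm => ?_) hp
  rw [AlgHom.toLinearMap_apply, aeval_monomial_one]
  rw [weight_eq_sum_toMultiset] at hm
  exact lowWeight_mono hm (multiset_prod_mem_lowWeight hg _)

end Filtration

section Words

/-! ### Words in lowering operators -/

variable {Q : Type} [AddCommGroup Q] [Module ℂ Q] {J : Type} {T : J → Module.End ℂ Q} {v : Q}

/-- The word with letters `l`, applied to `v`. -/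
def word (T : J → Module.End ℂ Q) (v : Q) (l : List J) : Q := l.foldr (fun j x => T j x) v

@[simp] lemma word_nil : word T v [] = v := rfl

@[simp] lemma word_cons (j : J) (l : List J) : word T v (j :: l) = T j (word T v l) := rfl

lemma map_word {E : Type} [AddCommGroup E] [Module ℂ E] {T' : J → Module.End ℂ E} (f : Q →ₗ[ℂ] E)
    (hf : ∀ j x, f (T j x) = T' j (f x)) (l : List J) : f (word T v l) = word T' (f v) l := by
  induction l with
  | nil => rfl
  | cons j l ih => rw [word_cons, hf, ih, word_cons]

/-- The span of the words of length less than `r`. -/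
def shortWords (T : J → Module.End ℂ Q) (v : Q) (r : ℕ) : Submodule ℂ Q :=
  Submodule.span ℂ {x | ∃ l : List J, l.length < r ∧ x = word T v l}

/-- Operators whose commutators are linear combinations of these operators. -/
def ClosedUnderComm (T : J → Module.End ℂ Q) : Prop :=
  ∀ i j, T i * T j - T j * T i ∈ Submodule.span ℂ (Set.range T)

lemma apply_mem_shortWords (j : J) {r : ℕ} {x : Q} (hx : x ∈ shortWords T v r) :
    T j x ∈ shortWords T v (r + 1) := by
  have : shortWords T v r ≤ (shortWords T v (r + 1)).comap (T j) := by
    refine Submodule.span_le.mpr ?_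
    rintro _ ⟨l, hl, rfl⟩
    exact Submodule.subset_span ⟨j :: l, by simpa using hl, rfl⟩
  exact this hx

/-- Exchanging adjacent letters costs a commutator, which is a combination of single letters and so
gives shorter words. -/
lemma word_perm (h : ClosedUnderComm T) {l l' : List J} (hl : l.Perm l') :
    word T v l - word T v l' ∈ shortWords T v l.length := by
  induction hl with
  | nil => simp
  | cons j _ ih =>
    rw [word_cons, word_cons, ← map_sub]
    exact apply_mem_shortWords j ih
  | swap i j l =>
    have : T j * T i - T i * T j ∈
        (shortWords T v (l.length + 2)).comap ((LinearMap.id : Module.End ℂ Q →ₗ[ℂ] _).flip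
          (word T v l)) := by
      refine (Submodule.span_le.mpr ?_ : Submodule.span ℂ (Set.range T) ≤ _) (h j i)
      rintro _ ⟨k, rfl⟩
      exact Submodule.subset_span ⟨k :: l, by simp, rfl⟩
    exact this
  | trans h1 _ ih1 ih2 =>
    rw [← h1.length_eq] at ih2
    rw [← sub_add_sub_cancel]
    exact add_mem ih1 ih2

/-- Induction on the length by `word_perm`. One ordering for each multiset of letters is enough, and
any choice will do; no order on the letters is needed. -/
lemma word_mem_span (h : ClosedUnderComm T) (l : List J) :
    word T v l ∈ Submodule.span ℂ (Set.range fun s : Multiset J => word T v s.toList) := by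
  suffices ∀ r, shortWords T v r ≤
      Submodule.span ℂ (Set.range fun s : Multiset J => word T v s.toList) from
    this (l.length + 1) (Submodule.subset_span ⟨l, by simp, rfl⟩)
  intro r
  induction r with
  | zero =>
    refine Submodule.span_le.mpr ?_
    rintro _ ⟨l, hl, rfl⟩
    exact absurd hl (by omega)
  | succ r ih =>
    refine Submodule.span_le.mpr ?_
    rintro _ ⟨l, hl, rfl⟩
    have hp : l.Perm (l : Multiset J).toList := Multiset.coe_eq_coe.mp (Multiset.coe_toList _).symm
    have h1 : shortWords T v l.length ≤ shortWords T v r := by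
      refine Submodule.span_mono ?_
      rintro _ ⟨l', hl', rfl⟩
      exact ⟨l', by omega, rfl⟩
    rw [← sub_add_cancel (word T v l) (word T v (l : Multiset J).toList)]
    exact add_mem (ih (h1 (word_perm h hp))) (Submodule.subset_span ⟨_, rfl⟩)

open MvPolynomial

/-- The linear map that sends a monomial to a word with the same letters. -/
def wordMap (T : J → Module.End ℂ Q) (v : Q) : MvPolynomial J ℂ →ₗ[ℂ] Q :=
  (basisMonomials J ℂ).constr ℂ fun m => word T v m.toMultiset.toList

lemma wordMap_monomial (m : J →₀ ℕ) :
    wordMap T v (monomial m 1) = word T v m.toMultiset.toList := by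
  have := (basisMonomials J ℂ).constr_basis ℂ (fun m => word T v m.toMultiset.toList) m
  rwa [coe_basisMonomials] at this

lemma wordMap_surjective (h : ClosedUnderComm T)
    (hv : ∀ P : Submodule ℂ Q, (∀ l, word T v l ∈ P) → P = ⊤) :
    Function.Surjective (wordMap T v) := by
  rw [← LinearMap.range_eq_top]
  refine hv _ fun l => ?_
  refine (Submodule.span_le.mpr ?_ : Submodule.span ℂ _ ≤ _) (word_mem_span h l)
  rintro _ ⟨s, rfl⟩
  classical
  exact ⟨monomial (Multiset.toFinsupp s) 1, by rw [wordMap_monomial, Multiset.toFinsupp_toMultiset]⟩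

variable {σ : Type} {w : σ → ℕ} {wJ : J → ℕ} {s : J → MvPolynomial σ ℂ}
  {TF : J → Module.End ℂ (MvPolynomial σ ℂ)}

/-- Every letter multiplies by its symbol up to lower weight, and these errors stay of lower weight
under the remaining letters. -/
lemma word_sub_prod_mem (hs : ∀ j, s j ∈ lowWeight w (wJ j + 1))
    (hT : ∀ j k f, f ∈ lowWeight w (k + 1) → TF j f - s j * f ∈ lowWeight w (k + wJ j))
    (l : List J) : word TF 1 l - (l.map s).prod ∈ lowWeight w (l.map wJ).sum := by
  induction l with
  | nil => simp
  | cons j l ih =>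
    have h1 : (l.map s).prod ∈ lowWeight w ((l.map wJ).sum + 1) := by
      have := multiset_prod_mem_lowWeight hs (l : Multiset J)
      simpa using this
    have h2 : word TF 1 l ∈ lowWeight w ((l.map wJ).sum + 1) := by
      rw [← sub_add_cancel (word TF 1 l) (l.map s).prod]
      exact add_mem (lowWeight_mono (by omega) ih) h1
    have e : word TF 1 (j :: l) - ((j :: l).map s).prod =
        (TF j (word TF 1 l) - s j * word TF 1 l) + s j * (word TF 1 l - (l.map s).prod) := by
      rw [word_cons, List.map_cons, List.prod_cons]
      ring
    rw [e, List.map_cons, List.sum_cons, add_comm (wJ j)]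
    exact add_mem (hT j _ _ h2) (mul_mem_lowWeight (hs j) ih)

lemma wordMap_sub_aeval_mem (hs : ∀ j, s j ∈ lowWeight w (wJ j + 1))
    (hT : ∀ j k f, f ∈ lowWeight w (k + 1) → TF j f - s j * f ∈ lowWeight w (k + wJ j))
    {k : ℕ} {p : MvPolynomial J ℂ} (hp : p ∈ lowWeight wJ (k + 1)) :
    wordMap TF 1 p - aeval s p ∈ lowWeight w k := by
  refine linear_mem_of_lowWeight (wordMap TF 1 - (aeval s).toLinearMap) _ (fun m hm => ?_) hp
  rw [LinearMap.sub_apply, AlgHom.toLinearMap_apply, aeval_monomial_one, wordMap_monomial]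
  rw [weight_eq_sum_toMultiset] at hm
  have := word_sub_prod_mem hs hT m.toMultiset.toList
  rw [← Multiset.sum_coe, ← Multiset.prod_coe, ← Multiset.map_coe, ← Multiset.map_coe,
    Multiset.coe_toList] at this
  exact lowWeight_mono (by omega) this

/-- Operators on a polynomial ring whose leading symbols are algebraically independent have linearly
independent ordered words. -/
theorem wordMap_injective (hs : ∀ j, s j ∈ lowWeight w (wJ j + 1))
    (hT : ∀ j k f, f ∈ lowWeight w (k + 1) → TF j f - s j * f ∈ lowWeight w (k + wJ j))
    (θ : σ → MvPolynomial J ℂ) (hθ : ∀ i, θ i ∈ lowWeight wJ (w i + 1))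
    (hθs : ∀ j, aeval θ (s j) = X j) : Function.Injective (wordMap TF 1) := by
  rw [injective_iff_map_eq_zero]
  intro p hp
  have inv : ∀ q, aeval θ (aeval s q) = q := fun q => by
    have : (aeval θ).comp (aeval s) = AlgHom.id ℂ (MvPolynomial J ℂ) := by
      refine algHom_ext fun j => ?_
      rw [AlgHom.comp_apply, aeval_X, hθs, AlgHom.id_apply]
    exact DFunLike.congr_fun this q
  -- If `p` has level `k + 1` and its combination of words is zero, then `aeval s p` equals minus an
  -- error term of level `k`; the filtered left inverse `θ` brings `p` itself down to level `k`.
  have step : ∀ k, p ∈ lowWeight wJ k → p = 0 := by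
    intro k
    induction k with
    | zero => exact lowWeight_zero
    | succ k ih =>
      intro h
      have := wordMap_sub_aeval_mem hs hT h
      rw [hp, zero_sub, neg_mem_iff] at this
      apply ih
      rw [← inv p]
      exact aeval_mem_lowWeight hθ this
  obtain ⟨k, hk⟩ := exists_mem_lowWeight wJ p
  exact step k hk

/-- Words with one ordering per multiset span `Q` by the commutation relations alone, and their
images are independent. No basis of `Q` has to be known beforehand. -/
theorem injective_of_wordMap_injective (h : ClosedUnderComm T)
    (hv : ∀ P : Submodule ℂ Q, (∀ l, word T v l ∈ P) → P = ⊤)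
    (hi : Function.Injective (wordMap TF 1)) (π : Q →ₗ[ℂ] MvPolynomial σ ℂ) (h1 : π v = 1)
    (hπ : ∀ j x, π (T j x) = TF j (π x)) : Function.Injective π := by
  have e : π ∘ₗ wordMap T v = wordMap TF 1 := by
    refine (basisMonomials J ℂ).ext fun m => ?_
    rw [coe_basisMonomials, LinearMap.comp_apply, wordMap_monomial, wordMap_monomial,
      map_word π hπ, h1]
  rw [injective_iff_map_eq_zero]
  intro x hx
  obtain ⟨p, rfl⟩ := wordMap_surjective h hv x
  have : wordMap TF 1 p = 0 := by rw [← e]; exact hx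
  rw [(injective_iff_map_eq_zero _).mp hi p this, map_zero]

end Words

section FreeFields

/-! ### Free field realization of the twisted Heisenberg-Virasoro algebra -/

variable {M : Type} [AddCommGroup M] [Module ℂ M] {a b b' c d e L : VertexOperator ℂ M}

/-- Fields with `a(z) b(w) ~ ε / (z - w)^2`. -/
structure HeisPair (a b : VertexOperator ℂ M) (ε : ℂ) : Prop where
  loc : IsLocal a b
  prod : ∀ l : ℕ, nprod a b l = if l = 1 then ε • idF M else 0

lemma HeisPair.of_commFun {ε : ℂ} (h : ∀ x p q, commFun a b x p q =
    (if p + q = 0 then p * ε else 0) • x) : HeisPair a b ε := by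
  obtain ⟨h1, h2⟩ := nprod_of_commFun (a := a) (b := b) (N := 2)
    (d := fun l => if l = 1 then ε • idF M else 0) fun x p q => by
      rw [h]
      simp only [Finset.sum_range_succ, Finset.sum_range_zero, Nat.cast_zero, Nat.cast_one,
        Ring.choose_zero_right, Ring.choose_one_right, zero_add, if_true, zero_ne_one, if_false,
        map_smul, Pi.smul_apply, LinearMap.smul_apply, idF_ncoeff, map_zero, Pi.zero_apply,
        LinearMap.zero_apply, smul_zero]
      rw [← Int.cast_smul_eq_zsmul ℂ]
      by_cases hpq : p + q = 0
      · rw [if_pos hpq, if_pos (by omega), smul_smul]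
      · rw [if_neg hpq, if_neg (by omega), smul_zero, smul_zero, zero_smul]
  refine ⟨h1, fun l => ?_⟩
  rw [h2]
  split_ifs <;> first | rfl | omega

/-- The field `a` contracts with one factor of the normally ordered product at a time. -/
lemma HeisPair.nprod_normal {ε ε' : ℂ} (h : HeisPair a b ε) (h' : HeisPair a b' ε') (l : ℕ) :
    nprod a (nprod b b' (-1)) l = if l = 1 then ε • b' + ε' • b else 0 := by
  have := h.loc.nprod_comm b' l (-1)
  rw [finsum_eq_sum_range (N := 2) fun i hi => by
    rw [h.prod, if_neg (by omega), nprod_zero_left, smul_zero], sub_eq_iff_eq_add] at this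
  rw [this, h'.prod]
  simp only [Finset.sum_range_succ, Finset.sum_range_zero, Nat.cast_one, h.prod, if_true,
    zero_ne_one, if_false, nprod_zero_left, smul_zero, Ring.choose_one_right, zero_add,
    nprod_smul_left, nprod_idF_left]
  by_cases hl : l = 1
  · subst hl
    simp [nprod_smul_right, nprod_idF_neg_one]
  · rw [if_neg hl, if_neg hl]
    rcases Nat.eq_zero_or_pos l with rfl | hl'
    · simp
    · rw [if_neg (by omega)]
      simp

lemma HeisPair.nprod_derF {ε : ℂ} (h : HeisPair a b ε) (l : ℕ) :
    nprod a (derF b) l = if l = 2 then (2 * ε) • idF M else 0 := by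
  have := derF_nprod a b l
  rw [nprod_derF_left, h.prod, ← sub_eq_iff_eq_add'] at this
  rw [← this]
  cases l with
  | zero => simp
  | succ l =>
    rw [show ((l + 1 : ℕ) : ℤ) - 1 = l by push_cast; ring, h.prod]
    by_cases hl : l = 1
    · subst hl
      simp only [if_true, Nat.reduceAdd, OfNat.ofNat_ne_one, if_false, map_zero, zero_sub]
      push_cast
      module
    · rw [if_neg hl, if_neg (show ¬ l + 1 = 2 by omega)]
      split_ifs <;> simp

/-- Products of a free field with a quadratic one are the easy direction; reversing the commutator
gives the expansion in the other order. -/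
lemma OPE2.of_nprod_right {κ γ : ℂ} (h : IsLocal a L) (h' : ∀ l : ℕ, nprod a L l =
    if l = 1 then κ • a else if l = 2 then (-γ) • idF M else 0) : OPE2 L a κ γ := by
  refine OPE2.of_commFun fun x p q => ?_
  have e : commFun L a x p q = -commFun a L x q p := by rw [commFun, commFun, neg_sub]
  rw [e, h.commFun_eq, finsum_eq_sum_range (N := 3) fun i hi => by
    rw [h', if_neg (by omega), if_neg (by omega)]; simp]
  simp only [Finset.sum_range_succ, Finset.sum_range_zero, Nat.cast_zero, Nat.cast_one,
    Nat.cast_ofNat, Ring.choose_zero_right, Ring.choose_one_right, zero_add, h', zero_ne_one,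
    if_false, if_true, OfNat.zero_ne_ofNat, OfNat.ofNat_ne_one,
    map_smul, Pi.smul_apply, LinearMap.smul_apply, idF_ncoeff, map_zero,
    Pi.zero_apply, LinearMap.zero_apply, smul_zero, add_comm q p]
  rw [← Int.cast_smul_eq_zsmul ℂ (Ring.choose q 2), choose_two]
  by_cases hpq : p + q = 1
  · obtain rfl : q = 1 - p := by omega
    rw [if_pos (by omega), if_pos hpq]
    push_cast
    module
  · rw [if_neg (by omega), if_neg hpq]
    module

/-- The Virasoro field `:c d: + α ∂c + β ∂d + (κ / 2) :e e:`. -/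
def freeL (α β κ : ℂ) (c d e : VertexOperator ℂ M) : VertexOperator ℂ M :=
  nprod c d (-1) + α • derF c + β • derF d + (κ / 2) • nprod e e (-1)

lemma freeL_nprod_right (α β κ : ℂ) {γ δ η : ℂ} (hc : HeisPair a c γ) (hd : HeisPair a d δ)
    (he : HeisPair a e η) (l : ℕ) : nprod a (freeL α β κ c d e) l =
      if l = 1 then γ • d + δ • c + (κ * η) • e else
        if l = 2 then (2 * α * γ + 2 * β * δ) • idF M else 0 := by
  simp only [freeL, nprod_add_right, nprod_smul_right, hc.nprod_normal hd, hc.nprod_derF,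
    hd.nprod_derF, he.nprod_normal he]
  by_cases h1 : l = 1
  · subst h1
    simp only [if_true, OfNat.one_ne_ofNat, if_false, smul_zero]
    module
  · rw [if_neg h1, if_neg h1]
    split_ifs with h2
    · module
    · simp

lemma isLocal_freeL (α β κ : ℂ) (hcd : IsLocal c d) (he : IsLocal e e)
    (hca : IsLocal c a) (hda : IsLocal d a) (hea : IsLocal e a) :
    IsLocal (freeL α β κ c d e) a :=
  (((isLocal_nprod hcd hca hda _).add ((isLocal_derF hca).smul α)).add
    ((isLocal_derF hda).smul β)).add ((isLocal_nprod he hea hea _).smul (κ / 2))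

/-- A Heisenberg system of fields. -/
structure HeisSystem (c d e : VertexOperator ℂ M) : Prop where
  cc : HeisPair c c 0
  cd : HeisPair c d 1
  ce : HeisPair c e 0
  dc : HeisPair d c 1
  dd : HeisPair d d 0
  de : HeisPair d e 0
  ec : HeisPair e c 0
  ed : HeisPair e d 0
  ee : HeisPair e e 1

namespace HeisSystem

variable (h : HeisSystem c d e) (α β κ : ℂ)
include h

lemma opeC : OPE2 (freeL α β κ c d e) c 1 (-2 * β) :=
  OPE2.of_nprod_right (isLocal_freeL α β κ h.cd.loc h.ee.loc h.cc.loc h.dc.loc h.ec.loc).symm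
    fun l => by
      rw [freeL_nprod_right α β κ h.cc h.cd h.ce]
      congr 2 <;> module

lemma opeD : OPE2 (freeL α β κ c d e) d 1 (-2 * α) :=
  OPE2.of_nprod_right (isLocal_freeL α β κ h.cd.loc h.ee.loc h.cd.loc h.dd.loc h.ed.loc).symm
    fun l => by
      rw [freeL_nprod_right α β κ h.dc h.dd h.de]
      congr 2 <;> module

lemma opeE : OPE2 (freeL α β κ c d e) e κ 0 :=
  OPE2.of_nprod_right (isLocal_freeL α β κ h.cd.loc h.ee.loc h.ce.loc h.de.loc h.ee.loc).symm
    fun l => by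
      rw [freeL_nprod_right α β κ h.ec h.ed h.ee]
      congr 2 <;> module

/-- The terms `α ∂c` and `β ∂d` cancel the third-order pole `-2β d - 2α c` of `:cd:`. The
fourth-order pole `1 - 12 α β + κ / 2` is half the central charge, and `β ∂d` gives `c` the anomaly
`-2β`. The summand `(κ / 2) :ee:` is of Virasoro type only for `κ² = κ`. -/
lemma hVirFields (hκ : κ = 0 ∨ κ = 1) :
    HVirFields (2 + κ - 24 * α * β) β (freeL α β κ c d e) c where
  LL := by
    have hcd := (h.opeC α β κ).normal (g := 1) (h.opeD α β κ) h.cd.loc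
      (by simpa using h.cd.prod 0) (by simpa using h.cd.prod 1) fun l hl => by
        lift l to ℕ using by omega
        rw [h.cd.prod, if_neg (by omega)]
    have h1 := (hcd.add ((h.opeC α β κ).derF.smul α)).add ((h.opeD α β κ).derF.smul β)
    rcases hκ with rfl | rfl
    · convert h1 using 1
      · rw [freeL]
        simp
      · module
      · ring
    · have hee := ((h.opeE α β 1).normal (g := 1) (h.opeE α β 1) h.ee.loc
        (by simpa using h.ee.prod 0) (by simpa using h.ee.prod 1) fun l hl => by
          lift l to ℕ using by omega
          rw [h.ee.prod, if_neg (by omega)]).smul (1 / 2)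
      convert h1.add hee using 1
      · rw [freeL]
      · module
      · ring
  LI := h.opeC α β κ
  II x := by
    ext p q
    rw [h.cc.loc.commFun_eq, finsum_eq_sum_range (N := 0) fun i _ => by
      rw [h.cc.prod]; split_ifs <;> simp]
    simp

end HeisSystem

end FreeFields

/-! ### Polynomial Fock spaces -/

section Fock

open MvPolynomial

variable {σ : Type}

/-- The modes of a free field on a polynomial ring: multiplication by the variables `x n`, the
scalar `z`, and derivatives with respect to the variables `y n`. -/
def modeOp (x y : ℕ → σ) (z : ℂ) : ℤ → Module.End ℂ (MvPolynomial σ ℂ)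
  | .negSucc n => LinearMap.mulLeft ℂ (X (x n))
  | .ofNat 0 => z • 1
  | .ofNat (n + 1) => ((n : ℂ) + 1) • (pderiv (y n)).toLinearMap

variable {x y x' y' : ℕ → σ} {z z' : ℂ}

@[simp] lemma modeOp_negSucc (n : ℕ) (f : MvPolynomial σ ℂ) :
    modeOp x y z (.negSucc n) f = X (x n) * f := rfl

@[simp] lemma modeOp_zero (f : MvPolynomial σ ℂ) : modeOp x y z 0 f = z • f := rfl

@[simp] lemma modeOp_succ (n : ℕ) (f : MvPolynomial σ ℂ) :
    modeOp x y z (n + 1) f = ((n : ℂ) + 1) • pderiv (y n) f := rfl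

lemma pderiv_comm (i j : σ) (f : MvPolynomial σ ℂ) :
    pderiv i (pderiv j f) = pderiv j (pderiv i f) := by
  classical
  ext m
  simp only [coeff_pderiv, add_right_comm m]
  rcases eq_or_ne i j with rfl | h
  · rfl
  · simp [h, h.symm]
    ring

lemma modeOp_restricted (hy : Function.Injective y) : Restricted (modeOp x y z) := by
  intro f
  have hfin : {n | y n ∈ f.vars}.Finite := f.vars.finite_toSet.preimage hy.injOn
  obtain ⟨N, hN⟩ := hfin.bddAbove
  refine ⟨N + 2, fun n hn => ?_⟩
  obtain ⟨k, rfl⟩ : ∃ k : ℕ, n = k + 1 := ⟨(n - 1).toNat, by omega⟩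
  rw [modeOp_succ, pderiv_eq_zero_of_notMem_vars fun h => ?_, smul_zero]
  have : k ≤ N := hN h
  omega

lemma modeOp_comm {ε : ℂ} (h : ∀ k l, pderiv (y k) (X (x' l)) = if k = l then C ε else 0)
    (h' : ∀ k l, pderiv (y' k) (X (x l)) = if k = l then C ε else 0) (f : MvPolynomial σ ℂ)
    (p q : ℤ) : modeOp x y z p (modeOp x' y' z' q f) - modeOp x' y' z' q (modeOp x y z p f) =
      (if p + q = 0 then p * ε else 0) • f := by
  obtain ⟨k, rfl | rfl | rfl⟩ : ∃ k : ℕ, p = .negSucc k ∨ p = 0 ∨ p = (k : ℤ) + 1 := by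
    rcases lt_trichotomy p 0 with hp | rfl | hp
    · exact ⟨(-p - 1).toNat, Or.inl (by omega)⟩
    · exact ⟨0, by simp⟩
    · exact ⟨(p - 1).toNat, by omega⟩
  all_goals
    obtain ⟨l, rfl | rfl | rfl⟩ : ∃ k : ℕ, q = .negSucc k ∨ q = 0 ∨ q = (k : ℤ) + 1 := by
      rcases lt_trichotomy q 0 with hp | rfl | hp
      · exact ⟨(-q - 1).toNat, Or.inl (by omega)⟩
      · exact ⟨0, by simp⟩
      · exact ⟨(q - 1).toNat, by omega⟩
  · rw [if_neg (by omega)]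
    simp only [modeOp_negSucc, zero_smul]
    ring
  · simp
  · simp only [modeOp_negSucc, modeOp_succ, pderiv_mul, h']
    by_cases hkl : k = l
    · subst hkl
      rw [if_pos rfl, if_pos (by omega), smul_add, C_mul', mul_smul_comm, Int.cast_negSucc]
      push_cast
      module
    · rw [if_neg (Ne.symm hkl), if_neg (by omega), smul_add, mul_smul_comm]
      simp
  · simp
  · simp [smul_comm z z']
  · simp [smul_comm z]
  · simp only [modeOp_negSucc, modeOp_succ, pderiv_mul, h]
    by_cases hkl : k = l
    · subst hkl
      rw [if_pos rfl, if_pos (by omega), smul_add, C_mul', mul_smul_comm]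
      push_cast
      module
    · rw [if_neg hkl, if_neg (by omega), smul_add, mul_smul_comm]
      simp
  · rw [if_neg (by omega)]
    simp [smul_comm z']
  · rw [if_neg (by omega)]
    simp only [modeOp_succ, map_smul, pderiv_comm (y k), zero_smul]
    rw [smul_comm, sub_self]

lemma heisPair_modeOp {ε : ℂ} (hy : Function.Injective y) (hy' : Function.Injective y')
    (h : ∀ k l, pderiv (y k) (X (x' l)) = if k = l then C ε else 0)
    (h' : ∀ k l, pderiv (y' k) (X (x l)) = if k = l then C ε else 0) :
    HeisPair (modeOp_restricted (x := x) (z := z) hy).weightOne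
      (modeOp_restricted (x := x') (z := z') hy').weightOne ε :=
  HeisPair.of_commFun fun f p q => by
    rw [commFun]
    simp only [Restricted.weightOne_ncoeff]
    exact modeOp_comm h h' f p q

/-- The variables of the Fock space. -/
inductive FockVar : Type
  | c (n : ℕ)
  | d (n : ℕ)
  | e (n : ℕ)

/-- The Fock space. -/
abbrev Fock : Type := MvPolynomial FockVar ℂ

namespace Fock

lemma c_injective : Function.Injective FockVar.c := fun _ _ h => FockVar.c.inj h

lemma d_injective : Function.Injective FockVar.d := fun _ _ h => FockVar.d.inj h

lemma e_injective : Function.Injective FockVar.e := fun _ _ h => FockVar.e.inj h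

/-- The field `c` with zero mode `z`. -/
def c (z : ℂ) : VertexOperator ℂ Fock :=
  -- The positive modes of `c` differentiate with respect to the variables of `d`, and those of `d`
  -- with respect to the variables of `c`: the two fields are dual to each other and each commutes
  -- with itself. The field `e` is dual to itself.
  (modeOp_restricted (x := FockVar.c) (z := z) d_injective).weightOne

/-- The field `d` with zero mode `0`. -/
def d : VertexOperator ℂ Fock :=
  (modeOp_restricted (x := FockVar.d) (z := 0) c_injective).weightOne

/-- The field `e` with zero mode `z`. -/
def e (z : ℂ) : VertexOperator ℂ Fock :=
  (modeOp_restricted (x := FockVar.e) (z := z) e_injective).weightOne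

lemma pderiv_X_family {a : ℕ → FockVar} (ha : Function.Injective a) (k l : ℕ) :
    pderiv (a k) (X (a l) : Fock) = if k = l then C 1 else 0 := by
  split_ifs with h
  · rw [h, pderiv_X_self, map_one]
  · exact pderiv_X_of_ne fun h' => h (ha h').symm

lemma pderiv_X_disjoint {a b : ℕ → FockVar} (h : ∀ k l, b l ≠ a k) (k l : ℕ) :
    pderiv (a k) (X (b l) : Fock) = if k = l then C 0 else 0 := by
  rw [pderiv_X_of_ne (h k l), map_zero, ite_self]

lemma heisSystem (z z' : ℂ) : HeisSystem (c z) d (e z') where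
  cc := heisPair_modeOp d_injective d_injective
    (pderiv_X_disjoint (by simp)) (pderiv_X_disjoint (by simp))
  cd := heisPair_modeOp d_injective c_injective
    (pderiv_X_family d_injective) (pderiv_X_family c_injective)
  ce := heisPair_modeOp d_injective e_injective
    (pderiv_X_disjoint (by simp)) (pderiv_X_disjoint (by simp))
  dc := heisPair_modeOp c_injective d_injective
    (pderiv_X_family c_injective) (pderiv_X_family d_injective)
  dd := heisPair_modeOp c_injective c_injective
    (pderiv_X_disjoint (by simp)) (pderiv_X_disjoint (by simp))
  de := heisPair_modeOp c_injective e_injective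
    (pderiv_X_disjoint (by simp)) (pderiv_X_disjoint (by simp))
  ec := heisPair_modeOp e_injective d_injective
    (pderiv_X_disjoint (by simp)) (pderiv_X_disjoint (by simp))
  ed := heisPair_modeOp e_injective c_injective
    (pderiv_X_disjoint (by simp)) (pderiv_X_disjoint (by simp))
  ee := heisPair_modeOp e_injective e_injective
    (pderiv_X_family e_injective) (pderiv_X_family e_injective)

end Fock

end Fock

section HighestWeight

/-! ### Normally ordered products on vectors of highest weight -/

variable {M : Type} [AddCommGroup M] [Module ℂ M] {a b I : VertexOperator ℂ M} {x : M} {y z : ℂ}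

/-- The positive modes of `a` annihilate `x`, and the zero mode acts by the scalar `z`. -/
structure IsHighest (a : VertexOperator ℂ M) (z : ℂ) (x : M) : Prop where
  pos : ∀ n : ℤ, 0 < n → a〚n〛 x = 0
  zero : a〚0〛 x = z • x

lemma IsHighest.normal_pos (ha : IsHighest a y x) (hb : IsHighest b z x) {n : ℤ} (hn : 1 ≤ n) :
    (nprod a b (-1))〚n〛 x = if n = 1 then (y * z) • x else 0 := by
  rw [nprod_neg_one_apply, finsum_eq_sum_range (N := 1) fun i hi => by
    rw [hb.pos _ (by omega), ha.pos _ (by omega), map_zero, map_zero, add_zero] ]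
  rw [Finset.sum_range_one, hb.pos _ (by omega), map_zero, zero_add, Nat.cast_zero, ha.zero,
    map_smul]
  split_ifs with h
  · subst h
    rw [show (1 : ℤ) - 1 - 0 = 0 by ring, hb.zero, smul_smul]
  · rw [hb.pos _ (by omega), smul_zero]

lemma IsHighest.normal_neg (ha : IsHighest a y x) (hb : IsHighest b z x) (n : ℕ) :
    (nprod a b (-1))〚-(n : ℤ)〛 x = ∑ i ∈ Finset.range n, a〚-1 - (i : ℤ)〛 (b〚-(n : ℤ) + i〛 x) +
      z • a〚-1 - (n : ℤ)〛 x + y • b〚-1 - (n : ℤ)〛 x := by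
  have h1 : EvZero fun i : ℕ => a〚-1 - (i : ℤ)〛 (b〚-(n : ℤ) + i〛 x) := leftTerm_evZero ..
  have h2 : EvZero fun i : ℕ => b〚-(n : ℤ) - 1 - i〛 (a〚(i : ℤ)〛 x) :=
    ⟨1, fun i hi => (congrArg _ (ha.pos _ (by omega))).trans (map_zero _)⟩
  rw [nprod_neg_one_apply, EvZero.finsum_add h1 h2,
    finsum_eq_sum_range (N := n + 1) (f := fun i : ℕ => a〚-1 - (i : ℤ)〛 (b〚-(n : ℤ) + i〛 x))
      fun i hi => by rw [hb.pos _ (by omega), map_zero],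
    finsum_eq_sum_range (N := 1) fun i hi => by rw [ha.pos _ (by omega), map_zero] ]
  rw [Finset.sum_range_one, Finset.sum_range_succ, neg_add_cancel, hb.zero, Nat.cast_zero, ha.zero,
    map_smul, map_smul, show -(n : ℤ) - 1 - 0 = -1 - n by ring]

/-- Mode `1` is `W(0)`: `:II:` contributes `z²` and the derivative `-2 cLI z`. This is the origin of
`h_W`. -/
lemma IsHighest.wField_pos (h : IsHighest I z x) (cLI : ℂ) {n : ℤ} (hn : 1 ≤ n) :
    (wField cLI I)〚n〛 x = if n = 1 then (z * (z - 2 * cLI)) • x else 0 := by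
  simp only [wField, map_add, Pi.add_apply, LinearMap.add_apply, map_smul, Pi.smul_apply,
    LinearMap.smul_apply, derF_ncoeff]
  rw [h.normal_pos h hn]
  split_ifs with h1
  · subst h1
    rw [sub_self, h.zero]
    push_cast
    module
  · rw [h.pos _ (by omega)]
    simp

/-- Mode `-n` is `W(-1-n)`. It is triangular in the modes of `I`, with pivot `2 (z + n cLI)`; the
condition on `h_I` in the theorem says that no pivot vanishes. -/
lemma IsHighest.wField_neg (h : IsHighest I z x) (cLI : ℂ) (n : ℕ) :
    (wField cLI I)〚-(n : ℤ)〛 x =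
      ∑ i ∈ Finset.range n, I〚-1 - (i : ℤ)〛 (I〚-(n : ℤ) + i〛 x) +
        (2 * (z + n * cLI)) • I〚-1 - (n : ℤ)〛 x := by
  simp only [wField, map_add, Pi.add_apply, LinearMap.add_apply, map_smul, Pi.smul_apply,
    LinearMap.smul_apply, derF_ncoeff]
  rw [h.normal_neg h, show -(n : ℤ) - 1 = -1 - n by ring]
  push_cast
  module

lemma nprod_mem {P : Submodule ℂ M} (ha : ∀ n, ∀ x ∈ P, a〚n〛 x ∈ P) (hb : ∀ n, ∀ x ∈ P, b〚n〛 x ∈ P)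
    {x : M} (hx : x ∈ P) (n : ℤ) : (nprod a b (-1))〚n〛 x ∈ P := by
  rw [nprod_neg_one_apply]
  exact finsum_induction (p := (· ∈ P)) P.zero_mem (fun _ _ => P.add_mem) fun i =>
    P.add_mem (ha _ _ (hb _ _ hx)) (hb _ _ (ha _ _ hx))

end HighestWeight

section Symbols

/-! ### Leading symbols of modes -/

open MvPolynomial

variable {σ : Type} {w : σ → ℕ} {a b : VertexOperator ℂ (MvPolynomial σ ℂ)}
  {sa sb : ℕ → MvPolynomial σ ℂ} {za zb : ℂ} {wa wb : ℕ}

/-- The negative modes of the field are multiplications by polynomials of degree `wa`, the positive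
modes have lower degree. -/
structure HasSymbol (w : σ → ℕ) (a : VertexOperator ℂ (MvPolynomial σ ℂ))
    (sa : ℕ → MvPolynomial σ ℂ) (za : ℂ) (wa : ℕ) : Prop where
  neg : ∀ (n : ℕ) f, a〚-1 - (n : ℤ)〛 f = sa n * f
  zero : ∀ f, a〚0〛 f = za • f
  pos : ∀ (n : ℤ) (j : ℕ) f, 0 < n → f ∈ lowWeight w (j + 1) → a〚n〛 f ∈ lowWeight w (j + wa)
  mem : ∀ n, sa n ∈ lowWeight w (wa + 1)

/-- For `i < n` both modes are negative and act as multiplications; the zero modes of `b` and `a`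
give the two scalar terms. Every other term contains a positive mode, which lowers the degree. -/
lemma HasSymbol.normal (ha : HasSymbol w a sa za wa) (hb : HasSymbol w b sb zb wb) {j : ℕ}
    {f : MvPolynomial σ ℂ} (hf : f ∈ lowWeight w (j + 1)) (n : ℕ) :
    (nprod a b (-1))〚-(n : ℤ)〛 f -
      (∑ i ∈ Finset.range n, sa i * sb (n - 1 - i) + zb • sa n + za • sb n) * f ∈
        lowWeight w (j + (wa + wb)) := by
  have h1 : EvZero fun i : ℕ => a〚-1 - (i : ℤ)〛 (b〚-(n : ℤ) + i〛 f) := leftTerm_evZero ..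
  have h2 : EvZero fun i : ℕ => b〚-(n : ℤ) - 1 - i〛 (a〚(i : ℤ)〛 f) := by
    have := leftTerm_evZero b a 0 (fun i : ℕ => -(n : ℤ) - 1 - i) f
    simpa only [zero_add] using this
  rw [nprod_neg_one_apply, EvZero.finsum_add h1 h2]
  obtain ⟨N, hN⟩ := h1
  obtain ⟨K, hK⟩ := h2
  rw [finsum_eq_sum_range (N := n + 1 + N) fun i hi => hN i (by omega),
    finsum_eq_sum_range (N := 1 + K) fun i hi => hK i (by omega), Finset.sum_range_add,
    Finset.sum_range_succ, Finset.sum_range_add _ 1 K, Finset.sum_range_one]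
  have e1 : ∑ i ∈ Finset.range n, a〚-1 - (i : ℤ)〛 (b〚-(n : ℤ) + i〛 f) =
      (∑ i ∈ Finset.range n, sa i * sb (n - 1 - i)) * f := by
    rw [Finset.sum_mul]
    refine Finset.sum_congr rfl fun i hi => ?_
    rw [Finset.mem_range] at hi
    rw [ha.neg, show -(n : ℤ) + i = -1 - ((n - 1 - i : ℕ) : ℤ) by omega, hb.neg, mul_assoc]
  rw [e1, neg_add_cancel, hb.zero, Nat.cast_zero, ha.zero, map_smul, map_smul, ha.neg,
    show -(n : ℤ) - 1 - 0 = -1 - n by ring, hb.neg, add_mul, add_mul, smul_mul_assoc,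
    smul_mul_assoc]
  have e2 : ∀ s1 s2 s3 r1 r2 : MvPolynomial σ ℂ, s1 + s2 + r1 + (s3 + r2) - (s1 + s2 + s3) =
      r1 + r2 := fun _ _ _ _ _ => by ring
  rw [e2]
  refine add_mem (Submodule.sum_mem _ fun i _ => ?_) (Submodule.sum_mem _ fun i _ => ?_)
  · rw [ha.neg]
    exact lowWeight_mono (by omega) (mul_mem_lowWeight (ha.mem _) (hb.pos _ j f (by omega) hf))
  · rw [show -(n : ℤ) - 1 - ((1 + i : ℕ) : ℤ) = -1 - ((n + 1 + i : ℕ) : ℤ) by push_cast; ring,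
      hb.neg]
    exact lowWeight_mono (by omega) (mul_mem_lowWeight (hb.mem _) (ha.pos _ j f (by omega) hf))

lemma HasSymbol.wField (ha : HasSymbol w a sa za 0) (cLI : ℂ) {j : ℕ} {f : MvPolynomial σ ℂ}
    (hf : f ∈ lowWeight w (j + 1)) (n : ℕ) : (wField cLI a)〚-(n : ℤ)〛 f -
      (∑ i ∈ Finset.range n, sa i * sa (n - 1 - i) + (2 * (za + n * cLI)) • sa n) * f ∈
        lowWeight w j := by
  have := ha.normal ha hf n
  have e : (_root_.wField cLI a)〚-(n : ℤ)〛 f = (nprod a a (-1))〚-(n : ℤ)〛 f +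
      (2 * cLI * n) • (sa n * f) := by
    simp only [_root_.wField, map_add, Pi.add_apply, LinearMap.add_apply, map_smul, Pi.smul_apply,
      LinearMap.smul_apply, derF_ncoeff]
    rw [show -(n : ℤ) - 1 = -1 - n by ring, ha.neg]
    push_cast
    module
  rw [add_zero, add_zero] at this
  rw [e]
  convert this using 1
  simp only [add_mul, smul_mul_assoc]
  module

namespace Fock

/-- The degree in the variables `d`. -/
def degD : FockVar → ℕ
  | .d _ => 1
  | _ => 0

lemma modeOp_neg_one_sub {x y : ℕ → σ} {z : ℂ} (n : ℕ) (f : MvPolynomial σ ℂ) :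
    modeOp x y z (-1 - (n : ℤ)) f = X (x n) * f := by
  rw [show (-1 - n : ℤ) = .negSucc n by omega, modeOp_negSucc]

lemma modeOp_of_pos {x y : ℕ → σ} {z : ℂ} {n : ℤ} (hn : 0 < n) (f : MvPolynomial σ ℂ) :
    modeOp x y z n f = (n : ℂ) • pderiv (y (n - 1).toNat) f := by
  obtain ⟨k, rfl⟩ : ∃ k : ℕ, n = k + 1 := ⟨(n - 1).toNat, by omega⟩
  rw [modeOp_succ]
  simp

lemma X_c_mem (n : ℕ) : (X (.c n) : Fock) ∈ lowWeight degD (0 + 1) := X_mem_lowWeight degD (.c n)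

lemma X_d_mem (n : ℕ) : (X (.d n) : Fock) ∈ lowWeight degD (1 + 1) := X_mem_lowWeight degD (.d n)

lemma X_e_mem (n : ℕ) : (X (.e n) : Fock) ∈ lowWeight degD (0 + 1) := X_mem_lowWeight degD (.e n)

lemma pderiv_mem {i : FockVar} (hi : degD i = 0) {j : ℕ} {f : Fock} (hf : f ∈ lowWeight degD j) :
    pderiv i f ∈ lowWeight degD j :=
  pderiv_mem_lowWeight i (by rwa [hi, add_zero])

lemma pderiv_d_mem (n : ℕ) {j : ℕ} {f : Fock} (hf : f ∈ lowWeight degD (j + 1)) :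
    pderiv (.d n) f ∈ lowWeight degD j := by
  refine pderiv_mem_lowWeight _ ?_
  rw [show degD (.d n) = 1 from rfl]
  exact hf

lemma hasSymbol_c (z : ℂ) : HasSymbol degD (c z) (fun n => X (.c n)) z 0 where
  neg n f := by rw [c, Restricted.weightOne_ncoeff, modeOp_neg_one_sub]
  zero f := by rw [c, Restricted.weightOne_ncoeff, modeOp_zero]
  pos n j f hn hf := by
    rw [c, Restricted.weightOne_ncoeff, modeOp_of_pos hn]
    exact Submodule.smul_mem _ _ (pderiv_d_mem _ hf)
  mem := X_c_mem

lemma hasSymbol_d : HasSymbol degD d (fun n => X (.d n)) 0 1 where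
  neg n f := by rw [d, Restricted.weightOne_ncoeff, modeOp_neg_one_sub]
  zero f := by rw [d, Restricted.weightOne_ncoeff, modeOp_zero]
  pos n j f hn hf := by
    rw [d, Restricted.weightOne_ncoeff, modeOp_of_pos hn]
    exact Submodule.smul_mem _ _ (pderiv_mem rfl hf)
  mem := X_d_mem

lemma e_mem (z : ℂ) {j : ℕ} (n : ℤ) (f : Fock) (hf : f ∈ lowWeight degD j) :
    (e z)〚n〛 f ∈ lowWeight degD j := by
  rw [e, Restricted.weightOne_ncoeff]
  rcases lt_trichotomy n 0 with hn | rfl | hn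
  · obtain ⟨k, rfl⟩ : ∃ k : ℕ, n = -1 - k := ⟨(-n - 1).toNat, by omega⟩
    rw [modeOp_neg_one_sub]
    exact mul_mem_lowWeight (a := 0) (X_e_mem k) hf
  · rw [modeOp_zero]
    exact Submodule.smul_mem _ _ hf
  · rw [modeOp_of_pos hn]
    exact Submodule.smul_mem _ _ (pderiv_mem rfl hf)

/-- The Virasoro field on the Fock space. -/
def L (α β κ z z' : ℂ) : VertexOperator ℂ Fock := freeL α β κ (c z) d (e z')

lemma fields {α β κ : ℂ} (z z' : ℂ) (hκ : κ = 0 ∨ κ = 1) :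
    HVirFields (2 + κ - 24 * α * β) β (L α β κ z z') (c z) :=
  (heisSystem z z').hVirFields α β κ hκ

lemma L_ncoeff (α β κ z z' : ℂ) (n : ℤ) (f : Fock) : (L α β κ z z')〚n〛 f =
    (nprod (c z) d (-1))〚n〛 f + α • (-(n : ℂ)) • (c z)〚n - 1〛 f + β • (-(n : ℂ)) • d〚n - 1〛 f +
      (κ / 2) • (nprod (e z') (e z') (-1))〚n〛 f := by
  simp only [L, freeL, map_add, Pi.add_apply, LinearMap.add_apply, map_smul, Pi.smul_apply,
    LinearMap.smul_apply, derF_ncoeff]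

/-- The leading symbol of the modes of the Virasoro field. -/
def symL (β z : ℂ) (n : ℕ) : Fock :=
  ∑ i ∈ Finset.range n, X (.c i) * X (.d (n - 1 - i)) + (z + n * β) • X (.d n)

/-- The leading symbol of the modes of the weight two field of `W(2,2)`. -/
def symW (β z : ℂ) (n : ℕ) : Fock :=
  ∑ i ∈ Finset.range n, X (.c i) * X (.c (n - 1 - i)) + (2 * (z + n * β)) • X (.c n)

/-- In the degree that counts the variables `d`, both `α ∂c` and `(κ / 2) :ee:` have degree zero and
drop out. The symbol that remains is linear in the variables `d`, with coefficients in the variables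
`c`. -/
lemma L_sub_symL_mem (α β κ z z' : ℂ) {j : ℕ} {f : Fock} (hf : f ∈ lowWeight degD (j + 1)) (n : ℕ) :
    (L α β κ z z')〚-(n : ℤ)〛 f - symL β z n * f ∈ lowWeight degD (j + 1) := by
  have h1 := (hasSymbol_c z).normal hasSymbol_d hf n
  have h2 : (nprod (e z') (e z') (-1))〚-(n : ℤ)〛 f ∈ lowWeight degD (j + 1) :=
    nprod_mem (fun k f hf => e_mem z' k f hf) (fun k f hf => e_mem z' k f hf) hf _
  have h3 : X (.c n) * f ∈ lowWeight degD (j + 1) :=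
    mul_mem_lowWeight (a := 0) (X_c_mem n) hf
  rw [L_ncoeff, show -(n : ℤ) - 1 = -1 - n by ring, (hasSymbol_c z).neg, hasSymbol_d.neg]
  have := add_mem (add_mem h1 (Submodule.smul_mem _ (κ / 2) h2))
    (Submodule.smul_mem _ (α * n) h3)
  convert this using 1
  simp only [symL, add_mul, smul_mul_assoc]
  push_cast
  module

lemma symL_mem (β z : ℂ) (n : ℕ) : symL β z n ∈ lowWeight degD (1 + 1) := by
  refine add_mem (Submodule.sum_mem _ fun i _ => ?_) (Submodule.smul_mem _ _ ?_)
  · exact mul_mem_lowWeight (a := 0) (X_c_mem i) (X_d_mem _)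
  · exact X_d_mem n

lemma symW_mem (β z : ℂ) (n : ℕ) : symW β z n ∈ lowWeight degD (0 + 1) := by
  refine add_mem (Submodule.sum_mem _ fun i _ => ?_) (Submodule.smul_mem _ _ ?_)
  · exact mul_mem_lowWeight (a := 0) (X_c_mem i) (X_c_mem _)
  · exact X_c_mem n

lemma isHighest_modeOp {x y : ℕ → σ} {z : ℂ} (hy : Function.Injective y) :
    IsHighest (modeOp_restricted (x := x) (z := z) hy).weightOne z 1 where
  pos n hn := by rw [Restricted.weightOne_ncoeff, modeOp_of_pos hn, pderiv_one, smul_zero]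
  zero := by rw [Restricted.weightOne_ncoeff, modeOp_zero]

lemma isHighest_c (z : ℂ) : IsHighest (c z) z 1 := isHighest_modeOp d_injective

lemma isHighest_d : IsHighest d 0 1 := isHighest_modeOp c_injective

lemma isHighest_e (z : ℂ) : IsHighest (e z) z 1 := isHighest_modeOp e_injective

lemma L_pos_one (α β κ z z' : ℂ) {n : ℤ} (hn : 1 ≤ n) : (L α β κ z z')〚n〛 1 =
    if n = 1 then (-(α * z) + κ / 2 * z' ^ 2) • (1 : Fock) else 0 := by
  rw [L_ncoeff, (isHighest_c z).normal_pos isHighest_d hn,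
    (isHighest_e z').normal_pos (isHighest_e z') hn]
  split_ifs with h
  · subst h
    rw [sub_self, (isHighest_c z).zero, isHighest_d.zero]
    push_cast
    module
  · rw [(isHighest_c z).pos _ (by omega), isHighest_d.pos _ (by omega)]
    simp

/-- This is `L(-1) 1 = 0`, due to the vanishing zero modes of `c` and `d` and to `κ = 0`. -/
lemma L_zero_one (α β z' : ℂ) : (L α β 0 0 z')〚0〛 1 = 0 := by
  have := (isHighest_c 0).normal_neg isHighest_d 0
  rw [Nat.cast_zero, neg_zero, Finset.sum_range_zero, zero_smul, zero_smul] at this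
  rw [L_ncoeff, this]
  simp

end Fock

/-! ### Inverting the leading symbols -/

section Invert

variable {R : Type} [CommRing R] [Algebra ℂ R]

/-- The solution of a triangular system of linear equations. -/
def triSolve (u : ℕ → ℂ) (t g : ℕ → R) (n : ℕ) : R :=
  (u n)⁻¹ • (t n - ∑ i : Fin n, g i * triSolve u t g (n - 1 - i))
termination_by n
decreasing_by omega

lemma triSolve_spec {u : ℕ → ℂ} {n : ℕ} (hu : u n ≠ 0) (t g : ℕ → R) :
    ∑ i ∈ Finset.range n, g i * triSolve u t g (n - 1 - i) + u n • triSolve u t g n = t n := by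
  rw [triSolve.eq_1 u t g n, smul_smul, mul_inv_cancel₀ hu, one_smul,
    Finset.sum_range fun i => g i * triSolve u t g (n - 1 - i)]
  abel

/-- The solution of a triangular system of quadratic equations. -/
def quadSolve (u : ℕ → ℂ) (t : ℕ → R) (n : ℕ) : R :=
  (u n)⁻¹ • (t n - ∑ i : Fin n, quadSolve u t i * quadSolve u t (n - 1 - i))
termination_by n
decreasing_by all_goals omega

lemma quadSolve_spec {u : ℕ → ℂ} {n : ℕ} (hu : u n ≠ 0) (t : ℕ → R) :
    ∑ i ∈ Finset.range n, quadSolve u t i * quadSolve u t (n - 1 - i) + u n • quadSolve u t n =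
      t n := by
  rw [quadSolve.eq_1 u t n, smul_smul, mul_inv_cancel₀ hu, one_smul,
    Finset.sum_range fun i => quadSolve u t i * quadSolve u t (n - 1 - i)]
  abel

lemma triSolve_mem {J : Type} {w : J → ℕ} (u : ℕ → ℂ) {t g : ℕ → MvPolynomial J ℂ} {k : ℕ}
    (ht : ∀ n, t n ∈ lowWeight w k) (hg : ∀ n, g n ∈ lowWeight w (0 + 1)) (n : ℕ) :
    triSolve u t g n ∈ lowWeight w k := by
  induction n using Nat.strong_induction_on with
  | _ n ih =>
    rw [triSolve]
    refine Submodule.smul_mem _ _ (sub_mem (ht n) (Submodule.sum_mem _ fun i _ => ?_))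
    exact mul_mem_lowWeight (a := 0) (hg _) (ih (n - 1 - i) (by omega))

lemma quadSolve_mem {J : Type} {w : J → ℕ} (u : ℕ → ℂ) {t : ℕ → MvPolynomial J ℂ}
    (ht : ∀ n, t n ∈ lowWeight w (0 + 1)) (n : ℕ) : quadSolve u t n ∈ lowWeight w (0 + 1) := by
  induction n using Nat.strong_induction_on with
  | _ n ih =>
    rw [quadSolve]
    refine Submodule.smul_mem _ _ (sub_mem (ht n) (Submodule.sum_mem _ fun i _ => ?_))
    exact mul_mem_lowWeight (a := 0) (ih i i.2) (ih (n - 1 - i) (by omega))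

end Invert

/-- The lowering operators among two families of operators. -/
def lowering {E : Type} [AddCommGroup E] [Module ℂ E] (ρ ρ' : ℤ → Module.End ℂ E) (p : ℕ)
    (j : Bool × ℕ) : Module.End ℂ E :=
  if j.1 then ρ (-(j.2 : ℤ) - p) else ρ' (-(j.2 : ℤ) - 1)

/-- The degree of the lowering operators in the variables `d`. -/
def lowDeg (j : Bool × ℕ) : ℕ := if j.1 then 1 else 0

/-- The symbol of `I(-1-n)` is the variable `c n`, and that of `L(-2-n)` is triangular in `d (n+1)`
with pivot `(n+1) β`. -/
lemma Fock.wordMap_injective_hVir (α : ℂ) {β : ℂ} (κ z' : ℂ) (hβ : β ≠ 0) : Function.Injective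
    (wordMap (lowering (fun n => (Fock.L α β κ 0 z')〚n + 1〛) (fun n => (Fock.c 0)〚n〛) 2) 1) := by
  let θ : FockVar → MvPolynomial (Bool × ℕ) ℂ
    | .c n => X (false, n)
    -- At `n = 0` the pivot is `0` and `0⁻¹ = 0`, so `d 0` goes to `0`. This value is harmless:
    -- `L(-1)` is not among the operators, so no equation is solved for `d 0`.
    | .d n => triSolve (fun n => n * β) (fun n => X (true, n - 1)) (fun n => X (false, n)) n
    | .e _ => 0
  have hθ : ∀ i, θ i ∈ lowWeight lowDeg (Fock.degD i + 1) := by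
    rintro (n | n | n)
    · exact X_mem_lowWeight lowDeg (false, n)
    · exact triSolve_mem _ (fun n => X_mem_lowWeight lowDeg (true, n - 1))
        (fun n => X_mem_lowWeight lowDeg (false, n)) n
    · exact zero_mem _
  refine wordMap_injective (w := Fock.degD) (wJ := lowDeg)
    (s := fun j => if j.1 then Fock.symL β 0 (j.2 + 1) else X (.c j.2)) ?_ ?_ θ hθ ?_
  · rintro ⟨_ | _, n⟩
    · exact Fock.X_c_mem n
    · exact Fock.symL_mem β 0 (n + 1)
  · rintro ⟨_ | _, n⟩ k f hf
    · simp only [lowering, Bool.false_eq_true, if_false]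
      rw [show -(n : ℤ) - 1 = -1 - n by ring, (Fock.hasSymbol_c 0).neg, sub_self]
      exact zero_mem _
    · simp only [lowering, if_true]
      have := Fock.L_sub_symL_mem α β κ 0 z' hf (n + 1)
      rwa [show -((n + 1 : ℕ) : ℤ) = -(n : ℤ) - (2 : ℕ) + 1 by push_cast; ring] at this
  · rintro ⟨_ | _, n⟩
    · simp only [Bool.false_eq_true, if_false, aeval_X, θ]
    · simp only [if_true, Fock.symL, map_add, map_sum, map_mul, aeval_X, map_smul, θ, zero_add]
      exact triSolve_spec (u := fun n => n * β) (n := n + 1)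
        (mul_ne_zero (by exact_mod_cast n.succ_ne_zero) hβ) _ _

/-- The symbols of the `W(-1-n)` form a quadratic triangular system for the `c n`; once it is
solved, those of the `L(-1-n)` are a linear one for the `d n`. All pivots are `z + n β` up to a
factor `2`. -/
lemma Fock.wordMap_injective_w22 (α : ℂ) {β : ℂ} (κ : ℂ) {z : ℂ} (z' : ℂ)
    (hz : ∀ n : ℕ, z + n * β ≠ 0) : Function.Injective
    (wordMap (lowering (fun n => (Fock.L α β κ z z')〚n + 1〛)
      (fun n => (wField β (Fock.c z))〚n + 1〛) 1) 1) := by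
  let γ : ℕ → MvPolynomial (Bool × ℕ) ℂ :=
    quadSolve (fun n => 2 * (z + n * β)) fun n => X (false, n)
  let θ : FockVar → MvPolynomial (Bool × ℕ) ℂ
    | .c n => γ n
    | .d n => triSolve (fun n => z + n * β) (fun n => X (true, n)) γ n
    | .e _ => 0
  have hγ : ∀ n, γ n ∈ lowWeight lowDeg (0 + 1) :=
    quadSolve_mem _ fun n => X_mem_lowWeight lowDeg (false, n)
  have hθ : ∀ i, θ i ∈ lowWeight lowDeg (Fock.degD i + 1) := by
    rintro (n | n | n)
    · exact hγ n
    · exact triSolve_mem _ (fun n => X_mem_lowWeight lowDeg (true, n)) hγ n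
    · exact zero_mem _
  refine wordMap_injective (w := Fock.degD) (wJ := lowDeg)
    (s := fun j => if j.1 then Fock.symL β z j.2 else Fock.symW β z j.2) ?_ ?_ θ hθ ?_
  · rintro ⟨_ | _, n⟩
    · exact Fock.symW_mem β z n
    · exact Fock.symL_mem β z n
  · rintro ⟨_ | _, n⟩ k f hf
    · simp only [lowering, Bool.false_eq_true, if_false]
      have := (Fock.hasSymbol_c z).wField β hf n
      rwa [show -(n : ℤ) = -(n : ℤ) - 1 + 1 by ring] at this
    · simp only [lowering, if_true]
      have := Fock.L_sub_symL_mem α β κ z z' hf n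
      rwa [show -(n : ℤ) = -(n : ℤ) - (1 : ℕ) + 1 by push_cast; ring] at this
  · rintro ⟨_ | _, n⟩
    · simp only [Bool.false_eq_true, if_false, Fock.symW, map_add, map_sum, map_mul, aeval_X,
        map_smul, θ]
      exact quadSolve_spec (u := fun n => 2 * (z + n * β)) (n := n)
        (mul_ne_zero two_ne_zero (hz n)) _
    · simp only [if_true, Fock.symL, map_add, map_sum, map_mul, aeval_X, map_smul, θ]
      exact triSolve_spec (u := fun n => z + n * β) (n := n) (hz n) _ _

end Symbols

section Simplicity

/-! ### Simplicity of the vacuum Fock space -/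

open MvPolynomial

lemma eq_C_of_pderiv_eq_zero {σ : Type} {f : MvPolynomial σ ℂ} (h : ∀ i, pderiv i f = 0) :
    ∃ a : ℂ, f = C a := by
  classical
  refine ⟨coeff 0 f, ?_⟩
  ext m
  rw [coeff_C]
  split_ifs with hm
  · rw [hm]
  · obtain ⟨i, hi⟩ : ∃ i, m i ≠ 0 := by
      by_contra h'
      push Not at h'
      exact hm (Finsupp.ext fun i => (h' i).symm)
    have := coeff_pderiv f (m - Finsupp.single i 1) (i := i)
    rw [h, coeff_zero, Finsupp.sub_add_single_one_cancel hi, eq_comm, mul_eq_zero] at this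
    exact this.resolve_right (Nat.cast_add_one_ne_zero _)

namespace Fock

lemma c_pos (z : ℂ) (n : ℕ) (f : Fock) :
    (c z)〚(n : ℤ) + 1〛 f = ((n : ℂ) + 1) • pderiv (.d n) f := by
  rw [c, Restricted.weightOne_ncoeff, modeOp_succ]

lemma d_pos (n : ℕ) (f : Fock) : d〚(n : ℤ) + 1〛 f = ((n : ℂ) + 1) • pderiv (.c n) f := by
  rw [d, Restricted.weightOne_ncoeff, modeOp_succ]

/-- If `f` is free of the variables `d` and `c n` is the last variable `c` it may contain, the
normally ordered part kills `f`, and of the derivative terms only `β ∂d` survives. -/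
lemma L_maxMode (α β z' : ℂ) {f : Fock} {n : ℕ} (hd : ∀ k, pderiv (.d k) f = 0)
    (hc : ∀ k, n < k → pderiv (.c k) f = 0) : (L α β 0 0 z')〚(n : ℤ) + 1 + 1〛 f =
      (-(β * (n + 1) * (n + 2))) • pderiv (.c n) f := by
  have h1 : ∀ k : ℤ, 0 ≤ k → (c 0)〚k〛 f = 0 := by
    intro k hk
    rcases hk.eq_or_lt with rfl | hk
    · rw [(hasSymbol_c 0).zero, zero_smul]
    · obtain ⟨m, rfl⟩ : ∃ m : ℕ, k = m + 1 := ⟨(k - 1).toNat, by omega⟩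
      rw [c_pos, hd, smul_zero]
  have h2 : ∀ k : ℤ, (n : ℤ) + 1 < k → d〚k〛 f = 0 := by
    intro k hk
    obtain ⟨m, rfl⟩ : ∃ m : ℕ, k = m + 1 := ⟨(k - 1).toNat, by omega⟩
    rw [d_pos, hc _ (by omega), smul_zero]
  rw [L_ncoeff, nprod_neg_one_apply, finsum_eq_sum_range (N := 0) fun i _ => by
    rw [h1 i (by omega), h2 _ (by omega), map_zero, map_zero, add_zero] ]
  rw [Finset.sum_range_zero, add_sub_cancel_right, h1 _ (by omega), d_pos]
  push_cast
  module

/-- The derivative with respect to a variable `e n` commutes with the modes of `c` and `d`. -/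
lemma pderiv_e_comm {x y : ℕ → FockVar} {z : ℂ} (n : ℕ) (hx : ∀ k, x k ≠ .e n) (k : ℤ) (f : Fock) :
    pderiv (.e n) (modeOp x y z k f) = modeOp x y z k (pderiv (.e n) f) := by
  rcases lt_trichotomy k 0 with hk | rfl | hk
  · obtain ⟨m, rfl⟩ : ∃ m : ℕ, k = -1 - m := ⟨(-k - 1).toNat, by omega⟩
    rw [modeOp_neg_one_sub, modeOp_neg_one_sub, pderiv_mul, pderiv_X_of_ne (hx m), zero_mul,
      zero_add]
  · rw [modeOp_zero, modeOp_zero, Derivation.map_smul]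
  · rw [modeOp_of_pos hk, modeOp_of_pos hk, Derivation.map_smul, pderiv_comm]

lemma pderiv_e_c (z : ℂ) (n : ℕ) (k : ℤ) (f : Fock) :
    pderiv (.e n) ((c z)〚k〛 f) = (c z)〚k〛 (pderiv (.e n) f) := by
  rw [c, Restricted.weightOne_ncoeff, pderiv_e_comm n (by simp)]

lemma pderiv_e_d (n : ℕ) (k : ℤ) (f : Fock) :
    pderiv (.e n) (d〚k〛 f) = d〚k〛 (pderiv (.e n) f) := by
  rw [d, Restricted.weightOne_ncoeff, pderiv_e_comm n (by simp)]

lemma pderiv_e_L (α β z z' : ℂ) (n : ℕ) (k : ℤ) (f : Fock) :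
    pderiv (.e n) ((L α β 0 z z')〚k〛 f) = (L α β 0 z z')〚k〛 (pderiv (.e n) f) := by
  have := map_borSum (pderiv (.e n) : Derivation ℂ Fock Fock).toLinearMap
    (pderiv_e_c z n) (pderiv_e_d n) 0 k (-1) f
  rw [← nprod_ncoeff, ← nprod_ncoeff] at this
  rw [L_ncoeff, L_ncoeff, zero_div, zero_smul, zero_smul, add_zero, add_zero, map_add, map_add,
    Derivation.map_smul, Derivation.map_smul, Derivation.map_smul, Derivation.map_smul, pderiv_e_c,
    pderiv_e_d]
  congr 2

/-- Take a nonzero `f` of least total degree in `K`. The positive modes of `c` give its derivatives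
in the variables `d`, of smaller degree and hence zero; then `L_maxMode` excludes a last variable `c
n` in the same way, using `β ≠ 0`. So `f` is constant. -/
theorem one_mem_of_stable (α z' : ℂ) {β : ℂ} (hβ : β ≠ 0) (K : Submodule ℂ Fock)
    (hL : ∀ n, ∀ f ∈ K, (L α β 0 0 z')〚n〛 f ∈ K) (hc : ∀ n, ∀ f ∈ K, (c 0)〚n〛 f ∈ K)
    (he : ∀ n, ∀ f ∈ K, pderiv (.e n) f = 0) (hK : ∃ f ∈ K, f ≠ 0) : (1 : Fock) ∈ K := by
  classical
  have ex : ∃ k, ∃ f ∈ K, f ≠ 0 ∧ f ∈ lowWeight (fun _ : FockVar => 1) k := by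
    obtain ⟨f, hf, h0⟩ := hK
    obtain ⟨k, hk⟩ := exists_mem_lowWeight (fun _ : FockVar => 1) f
    exact ⟨k, f, hf, h0, hk⟩
  obtain ⟨f, hf, h0, hk⟩ := Nat.find_spec ex
  obtain ⟨k, hk'⟩ : ∃ k, Nat.find ex = k + 1 :=
    Nat.exists_eq_succ_of_ne_zero fun h => h0 (lowWeight_zero (h ▸ hk))
  have min : ∀ g ∈ K, g ∈ lowWeight (fun _ : FockVar => 1) k → g = 0 := by
    intro g hg hgk
    by_contra hne
    exact Nat.find_min ex (m := k) (by omega) ⟨g, hg, hne, hgk⟩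
  rw [hk'] at hk
  have low : ∀ i, pderiv i f ∈ lowWeight (fun _ : FockVar => 1) k := fun i =>
    pderiv_mem_lowWeight i hk
  have kill : ∀ i (a : ℂ), a ≠ 0 → a • pderiv i f ∈ K → pderiv i f = 0 := by
    intro i a ha h
    have := min _ h (Submodule.smul_mem _ _ (low i))
    exact (smul_eq_zero.mp this).resolve_left ha
  have zd : ∀ n, pderiv (.d n) f = 0 := fun n =>
    kill _ ((n : ℂ) + 1) (by exact_mod_cast n.succ_ne_zero) (by rw [← c_pos 0]; exact hc _ f hf)
  have zc : ∀ n, pderiv (.c n) f = 0 := by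
    by_contra hne
    push Not at hne
    have hfin : {n | pderiv (.c n) f ≠ 0}.Finite := by
      refine (f.vars.finite_toSet.preimage c_injective.injOn).subset fun n hn => ?_
      by_contra h
      exact hn (pderiv_eq_zero_of_notMem_vars h)
    obtain ⟨n, hn, hmax⟩ := hfin.exists_maximal hne
    have hc' : ∀ k, n < k → pderiv (.c k) f = 0 := by
      intro k hk
      by_contra h
      exact absurd (hmax (y := k) h hk.le) (by omega)
    refine hn (kill _ (-(β * (n + 1) * (n + 2))) ?_ ?_)
    · refine neg_ne_zero.mpr (mul_ne_zero (mul_ne_zero hβ ?_) ?_)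
      · exact_mod_cast n.succ_ne_zero
      · exact_mod_cast (n + 1).succ_ne_zero
    · rw [← L_maxMode α β z' zd hc']
      exact hL _ f hf
  obtain ⟨a, rfl⟩ := eq_C_of_pderiv_eq_zero (f := f) fun i => by
    cases i with
    | c n => exact zc n
    | d n => exact zd n
    | e n => exact he n f hf
  have ha : a ≠ 0 := fun h => h0 (by rw [h, map_zero])
  have := K.smul_mem a⁻¹ hf
  rwa [smul_eq_C_mul, ← C_mul, inv_mul_cancel₀ ha, C_1] at this

end Fock

end Simplicity

section Spanning

/-! ### Spanning by words in lowering operators -/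

variable {E : Type} [AddCommGroup E] [Module ℂ E] {cL cLI cW : ℂ} {ρL ρI ρW : ℤ → Module.End ℂ E}
  {v : E} {p : ℕ}

lemma closedUnderComm_of_lt {T : Bool × ℕ → Module.End ℂ E}
    (h : ∀ i j, ∃ (k : _) (c : ℂ), T i * T j - T j * T i = c • T k) : ClosedUnderComm T := by
  intro i j
  obtain ⟨k, c, h⟩ := h i j
  rw [h]
  exact Submodule.smul_mem _ _ (Submodule.subset_span ⟨k, rfl⟩)

lemma HVirRep.closedUnderComm (h : HVirRep cL cLI ρL ρI) (hp : 1 ≤ p) :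
    ClosedUnderComm (lowering ρL ρI p) := by
  have hLI : ∀ m n : ℕ, lowering ρL ρI p (true, m) * lowering ρL ρI p (false, n) -
      lowering ρL ρI p (false, n) * lowering ρL ρI p (true, m) =
        ((n : ℂ) + 1) • lowering ρL ρI p (false, m + n + p) := by
    intro m n
    simp only [lowering, if_true, Bool.false_eq_true, if_false]
    rw [h.LI, if_neg (by omega), zero_smul, sub_zero,
      show -(m : ℤ) - p + (-n - 1) = -((m + n + p : ℕ) : ℤ) - 1 by push_cast; ring]
    push_cast
    module
  refine closedUnderComm_of_lt ?_
  rintro ⟨_ | _, m⟩ ⟨_ | _, n⟩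
  · exact ⟨(false, 0), 0, by simp [lowering, h.II (-(m : ℤ) - 1)]⟩
  · refine ⟨(false, n + m + p), -((m : ℂ) + 1), ?_⟩
    rw [neg_smul, ← hLI, neg_sub]
  · exact ⟨_, _, hLI m n⟩
  · refine ⟨(true, m + n + p), (n : ℂ) - m, ?_⟩
    simp only [lowering, if_true]
    rw [h.LL, if_neg (by omega), zero_smul, add_zero,
      show -(m : ℤ) - p + (-n - p) = -((m + n + p : ℕ) : ℤ) - p by push_cast; ring]
    push_cast
    module

lemma W22Rep.closedUnderComm (h : W22Rep cL cW ρL ρW) :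
    ClosedUnderComm (lowering ρL ρW 1) := by
  have hLW : ∀ m n : ℕ, lowering ρL ρW 1 (true, m) * lowering ρL ρW 1 (false, n) -
      lowering ρL ρW 1 (false, n) * lowering ρL ρW 1 (true, m) =
        ((n : ℂ) - m) • lowering ρL ρW 1 (false, m + n + 1) := by
    intro m n
    simp only [lowering, if_true, Bool.false_eq_true, if_false]
    rw [h.LW, if_neg (by omega), zero_smul, add_zero,
      show -(m : ℤ) - (1 : ℕ) + (-n - 1) = -((m + n + 1 : ℕ) : ℤ) - 1 by push_cast; ring]
    push_cast
    module
  refine closedUnderComm_of_lt ?_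
  rintro ⟨_ | _, m⟩ ⟨_ | _, n⟩
  · exact ⟨(false, 0), 0, by simp [lowering, h.WW (-(m : ℤ) - 1)]⟩
  · refine ⟨(false, n + m + 1), -((m : ℂ) - n), ?_⟩
    rw [neg_smul, ← hLW, neg_sub]
  · exact ⟨_, _, hLW m n⟩
  · refine ⟨(true, m + n + 1), (n : ℂ) - m, ?_⟩
    simp only [lowering, if_true]
    rw [h.LL, if_neg (by omega), zero_smul, add_zero,
      show -(m : ℤ) - (1 : ℕ) + (-n - (1 : ℕ)) = -((m + n + 1 : ℕ) : ℤ) - (1 : ℕ) by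
        push_cast; ring]
    push_cast
    module

lemma apply_mem_span_words {J : Type} (T : J → Module.End ℂ E) (j : J) {x : E}
    (hx : x ∈ Submodule.span ℂ (Set.range (word T v))) :
    T j x ∈ Submodule.span ℂ (Set.range (word T v)) := by
  refine (Submodule.span_le.mpr ?_ : _ ≤ (Submodule.span ℂ (Set.range (word T v))).comap (T j)) hx
  rintro _ ⟨l, rfl⟩
  exact Submodule.subset_span ⟨j :: l, rfl⟩

lemma mem_of_mul_sub_eq {S T R : Module.End ℂ E} {P : Submodule ℂ E} {a b : ℂ} {x : E}
    (h : S * T - T * S = a • R + b • 1) (hST : T (S x) ∈ P) (hR : R x ∈ P) (hx : x ∈ P) :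
    S (T x) ∈ P := by
  have := LinearMap.congr_fun h x
  simp only [LinearMap.sub_apply, Module.End.mul_apply, LinearMap.add_apply, LinearMap.smul_apply,
    Module.End.one_apply] at this
  rw [sub_eq_iff_eq_add.mp this]
  exact P.add_mem (P.add_mem (P.smul_mem _ hR) (P.smul_mem _ hx)) hST

lemma HVirRep.commLI (h : HVirRep cL cLI ρL ρI) (n m : ℤ) : ρL n * ρI m - ρI m * ρL n =
    (-(m : ℂ)) • ρI (n + m) + (-(if n + m = 0 then ((n : ℂ) ^ 2 + n) * cLI else 0)) • 1 := by
  rw [h.LI, sub_eq_add_neg, ← neg_smul]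

lemma HVirRep.commIL (h : HVirRep cL cLI ρL ρI) (n m : ℤ) : ρI m * ρL n - ρL n * ρI m =
    (m : ℂ) • ρI (n + m) + (if n + m = 0 then ((n : ℂ) ^ 2 + n) * cLI else 0) • 1 := by
  rw [← neg_sub, h.commLI]
  module

lemma W22Rep.commWL (h : W22Rep cL cW ρL ρW) (n m : ℤ) : ρW m * ρL n - ρL n * ρW m =
    ((m : ℂ) - n) • ρW (n + m) +
      (-(if n + m = 0 then ((n : ℂ) ^ 3 - n) / 12 * cW else 0)) • 1 := by
  rw [← neg_sub, h.LW]
  module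

/-- Commuting a mode past the first letter of a word leaves modes acting on a shorter word, so the
span of the words is stable under everything. The parameter `p` says that `L(-p)` is the first
lowering operator: `1` for Verma modules, `2` for the vacuum module. -/
lemma HVirRep.span_words (h : HVirRep cL cLI ρL ρI) (hv : CyclicVector ρL ρI v)
    (hL : ∀ n : ℤ, -(p : ℤ) < n → ρL n v ∈ Submodule.span ℂ {v})
    (hI : ∀ n : ℤ, -1 < n → ρI n v ∈ Submodule.span ℂ {v})
    (P : Submodule ℂ E) (hP : ∀ l, word (lowering ρL ρI p) v l ∈ P) : P = ⊤ := by
  set T := lowering ρL ρI p with hT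
  set Z := Submodule.span ℂ (Set.range (word T v)) with hZ
  have hZP : Z ≤ P := Submodule.span_le.mpr (by rintro _ ⟨l, rfl⟩; exact hP l)
  have hvZ : Submodule.span ℂ {v} ≤ Z := Submodule.span_le.mpr (by
    rintro _ rfl
    exact Submodule.subset_span ⟨[], rfl⟩)
  have base : ∀ n, ρL n v ∈ Z ∧ ρI n v ∈ Z := by
    refine fun n => ⟨?_, ?_⟩
    · rcases lt_or_ge (-(p : ℤ)) n with hn | hn
      · exact hvZ (hL n hn)
      · refine Submodule.subset_span ⟨[(true, (-n - p).toNat)], ?_⟩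
        simp only [word_cons, word_nil, hT, lowering, if_true]
        congr 2
        omega
    · rcases lt_or_ge (-1) n with hn | hn
      · exact hvZ (hI n hn)
      · refine Submodule.subset_span ⟨[(false, (-n - 1).toNat)], ?_⟩
        simp only [word_cons, word_nil, hT, lowering, Bool.false_eq_true, if_false]
        congr 2
        omega
  have key : ∀ l n, ρL n (word T v l) ∈ Z ∧ ρI n (word T v l) ∈ Z := by
    intro l
    induction l with
    | nil => exact base
    | cons j l ih =>
      have hl : word T v l ∈ Z := Submodule.subset_span ⟨l, rfl⟩
      intro n
      obtain ⟨_ | _, m⟩ := j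
      · have e : T (false, m) = ρI (-(m : ℤ) - 1) := rfl
        refine ⟨?_, ?_⟩
        · exact mem_of_mul_sub_eq (h.commLI n (-(m : ℤ) - 1))
            (apply_mem_span_words T (false, m) (ih n).1) (ih _).2 hl
        · rw [word_cons, e, ← Module.End.mul_apply, h.II]
          exact apply_mem_span_words T (false, m) (ih n).2
      · refine ⟨?_, ?_⟩
        · exact mem_of_mul_sub_eq (h.LL n (-(m : ℤ) - p))
            (apply_mem_span_words T (true, m) (ih n).1) (ih _).1 hl
        · exact mem_of_mul_sub_eq (h.commIL (-(m : ℤ) - p) n)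
            (apply_mem_span_words T (true, m) (ih n).2) (ih _).2 hl
  have hZtop : Z = ⊤ := by
    refine hv Z (hvZ (Submodule.mem_span_singleton_self v)) (fun n => ?_) fun n => ?_
    · refine Submodule.span_le.mpr (?_ : _ ⊆ (Z.comap (ρL n) : Set E))
      rintro _ ⟨l, rfl⟩
      exact (key l n).1
    · refine Submodule.span_le.mpr (?_ : _ ⊆ (Z.comap (ρI n) : Set E))
      rintro _ ⟨l, rfl⟩
      exact (key l n).2
  exact eq_top_iff.mpr (hZtop ▸ hZP)

lemma W22Rep.span_words (h : W22Rep cL cW ρL ρW) (hv : CyclicVector ρL ρW v)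
    (hL : ∀ n : ℤ, -1 < n → ρL n v ∈ Submodule.span ℂ {v})
    (hW : ∀ n : ℤ, -1 < n → ρW n v ∈ Submodule.span ℂ {v})
    (P : Submodule ℂ E) (hP : ∀ l, word (lowering ρL ρW 1) v l ∈ P) : P = ⊤ := by
  set T := lowering ρL ρW 1 with hT
  set Z := Submodule.span ℂ (Set.range (word T v)) with hZ
  have hZP : Z ≤ P := Submodule.span_le.mpr (by rintro _ ⟨l, rfl⟩; exact hP l)
  have hvZ : Submodule.span ℂ {v} ≤ Z := Submodule.span_le.mpr (by
    rintro _ rfl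
    exact Submodule.subset_span ⟨[], rfl⟩)
  have base : ∀ n, ρL n v ∈ Z ∧ ρW n v ∈ Z := by
    refine fun n => ⟨?_, ?_⟩
    · rcases lt_or_ge (-1) n with hn | hn
      · exact hvZ (hL n hn)
      · refine Submodule.subset_span ⟨[(true, (-n - 1).toNat)], ?_⟩
        simp only [word_cons, word_nil, hT, lowering, if_true]
        congr 2
        omega
    · rcases lt_or_ge (-1) n with hn | hn
      · exact hvZ (hW n hn)
      · refine Submodule.subset_span ⟨[(false, (-n - 1).toNat)], ?_⟩
        simp only [word_cons, word_nil, hT, lowering, Bool.false_eq_true, if_false]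
        congr 2
        omega
  have key : ∀ l n, ρL n (word T v l) ∈ Z ∧ ρW n (word T v l) ∈ Z := by
    intro l
    induction l with
    | nil => exact base
    | cons j l ih =>
      have hl : word T v l ∈ Z := Submodule.subset_span ⟨l, rfl⟩
      intro n
      obtain ⟨_ | _, m⟩ := j
      · have e : T (false, m) = ρW (-(m : ℤ) - 1) := rfl
        refine ⟨?_, ?_⟩
        · exact mem_of_mul_sub_eq (h.LW n (-(m : ℤ) - 1))
            (apply_mem_span_words T (false, m) (ih n).1) (ih _).2 hl
        · rw [word_cons, e, ← Module.End.mul_apply, h.WW]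
          exact apply_mem_span_words T (false, m) (ih n).2
      · refine ⟨?_, ?_⟩
        · exact mem_of_mul_sub_eq (h.LL n (-(m : ℤ) - (1 : ℕ)))
            (apply_mem_span_words T (true, m) (ih n).1) (ih _).1 hl
        · exact mem_of_mul_sub_eq (h.commWL (-(m : ℤ) - (1 : ℕ)) n)
            (apply_mem_span_words T (true, m) (ih n).2) (ih _).2 hl
  have hZtop : Z = ⊤ := by
    refine hv Z (hvZ (Submodule.mem_span_singleton_self v)) (fun n => ?_) fun n => ?_
    · refine Submodule.span_le.mpr (?_ : _ ⊆ (Z.comap (ρL n) : Set E))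
      rintro _ ⟨l, rfl⟩
      exact (key l n).1
    · refine Submodule.span_le.mpr (?_ : _ ⊆ (Z.comap (ρW n) : Set E))
      rintro _ ⟨l, rfl⟩
      exact (key l n).2
  exact eq_top_iff.mpr (hZtop ▸ hZP)

lemma HVirRep.zero_word (h : HVirRep cL cLI ρL ρI) (hv : ρL 0 v = 0) (l : List (Bool × ℕ)) :
    ρL 0 (word (lowering ρL ρI 1) v l) =
      (((l.map fun j => j.2 + 1).sum : ℕ) : ℂ) • word (lowering ρL ρI 1) v l := by
  induction l with
  | nil => simp [hv]
  | cons j l ih =>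
    have : ρL 0 * lowering ρL ρI 1 j - lowering ρL ρI 1 j * ρL 0 =
        ((j.2 : ℂ) + 1) • lowering ρL ρI 1 j := by
      obtain ⟨_ | _, m⟩ := j
      · simp only [lowering, Bool.false_eq_true, if_false]
        rw [h.LI, if_neg (by omega), zero_smul, sub_zero, zero_add]
        push_cast
        module
      · simp only [lowering, if_true]
        rw [h.LL, if_neg (by omega), zero_smul, add_zero, zero_add]
        push_cast
        module
    have e := LinearMap.congr_fun this (word (lowering ρL ρI 1) v l)
    simp only [LinearMap.sub_apply, Module.End.mul_apply, LinearMap.smul_apply] at e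
    rw [word_cons, sub_eq_iff_eq_add.mp e, ih, map_smul, ← add_smul, List.map_cons, List.sum_cons]
    push_cast
    rfl

end Spanning

namespace HVir

/-! ### The maximal submodule of the vacuum Verma module -/

/-- The left ideal generated by `L(n)` (`n ≥ -1`), `I(n)` (`n ≥ 0`), `C_L - c_L`, `C_I` and
`C_LI - c_LI`. -/
def vacIdeal (cL cLI : ℂ) : Submodule U U :=
  Submodule.span U
    (({x | ∃ n : ℤ, -1 ≤ n ∧ x = L n} ∪ {x | ∃ n : ℤ, 0 ≤ n ∧ x = I n}) ∪
      {gen .CL - algebraMap ℂ U cL, gen .CI - algebraMap ℂ U 0, gen .CLI - algebraMap ℂ U cLI})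

lemma L_mem_vacIdeal (cL cLI : ℂ) {n : ℤ} (hn : -1 ≤ n) : L n ∈ vacIdeal cL cLI :=
  Submodule.subset_span (Or.inl (Or.inl ⟨n, hn, rfl⟩))

lemma I_mem_vacIdeal (cL cLI : ℂ) {n : ℤ} (hn : 0 ≤ n) : I n ∈ vacIdeal cL cLI :=
  Submodule.subset_span (Or.inl (Or.inr ⟨n, hn, rfl⟩))

lemma vermaIdeal_le_vacIdeal (cL cLI : ℂ) : vermaIdeal cL 0 cLI 0 0 ≤ vacIdeal cL cLI := by
  refine Submodule.span_le.mpr ?_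
  rintro x (⟨n, hn, rfl | rfl⟩ | rfl | rfl | rfl | rfl | rfl)
  · exact L_mem_vacIdeal cL cLI (by omega)
  · exact I_mem_vacIdeal cL cLI (by omega)
  · rw [map_zero, sub_zero]
    exact L_mem_vacIdeal cL cLI (by omega)
  · rw [map_zero, sub_zero]
    exact I_mem_vacIdeal cL cLI le_rfl
  · exact Submodule.subset_span (Or.inr (Or.inl rfl))
  · exact Submodule.subset_span (Or.inr (Or.inr (Or.inl rfl)))
  · exact Submodule.subset_span (Or.inr (Or.inr (Or.inr rfl)))

section Rep

variable {E : Type} [AddCommGroup E] [Module ℂ E] {cL cLI : ℂ} {ρL ρI : ℤ → Module.End ℂ E} {v : E}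

lemma _root_.HVirRep.vacIdeal_apply (h : HVirRep cL cLI ρL ρI) (hL : ∀ n : ℤ, -1 ≤ n → ρL n v = 0)
    (hI : ∀ n : ℤ, 0 ≤ n → ρI n v = 0) {u : U} (hu : u ∈ vacIdeal cL cLI) : h.hom u v = 0 := by
  refine annihilates_span h.hom v ?_ hu
  rintro x ((⟨n, hn, rfl⟩ | ⟨n, hn, rfl⟩) | rfl | rfl | rfl)
  · rw [h.hom_L, hL n hn]
  · rw [h.hom_I, hI n hn]
  · rw [map_sub, h.hom_gen, AlgHom.commutes, LinearMap.sub_apply, Module.algebraMap_end_apply]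
    exact sub_self _
  · rw [map_sub, h.hom_gen, map_zero, map_zero, sub_zero]
    rfl
  · rw [map_sub, h.hom_gen, AlgHom.commutes, LinearMap.sub_apply, Module.algebraMap_end_apply]
    exact sub_self _

lemma _root_.HVirRep.vermaIdeal_apply {h' hI' : ℂ} (h : HVirRep cL cLI ρL ρI)
    (hL : ∀ n : ℤ, 0 < n → ρL n v = 0) (hI : ∀ n : ℤ, 0 < n → ρI n v = 0) (hL0 : ρL 0 v = h' • v)
    (hI0 : ρI 0 v = hI' • v) {u : U} (hu : u ∈ vermaIdeal cL 0 cLI h' hI') : h.hom u v = 0 := by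
  refine annihilates_span h.hom v ?_ hu
  rintro x (⟨n, hn, rfl | rfl⟩ | rfl | rfl | rfl | rfl | rfl)
  · rw [h.hom_L, hL n hn]
  · rw [h.hom_I, hI n hn]
  · rw [map_sub, h.hom_L, AlgHom.commutes, LinearMap.sub_apply, Module.algebraMap_end_apply, hL0,
      sub_self]
  · rw [map_sub, h.hom_I, AlgHom.commutes, LinearMap.sub_apply, Module.algebraMap_end_apply, hI0,
      sub_self]
  · rw [map_sub, h.hom_gen, AlgHom.commutes, LinearMap.sub_apply, Module.algebraMap_end_apply]
    exact sub_self _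
  · rw [map_sub, h.hom_gen, map_zero, map_zero, sub_zero]
    rfl
  · rw [map_sub, h.hom_gen, AlgHom.commutes, LinearMap.sub_apply, Module.algebraMap_end_apply]
    exact sub_self _

end Rep

variable {cL cLI : ℂ}

/-- The representation on the vacuum Fock space. -/
lemma fockRep (cL : ℂ) (hc : cLI ≠ 0) : HVirRep cL cLI
    (fun n => (Fock.L ((2 - cL) / (24 * cLI)) cLI 0 0 0)〚n + 1〛) (fun n => (Fock.c 0)〚n〛) := by
  -- For `κ = 0` the central charge is `2 - 24 α β`; with `β = cLI ≠ 0` the value of `α` can be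
  -- adjusted to give `cL`.
  have := (Fock.fields (α := (2 - cL) / (24 * cLI)) (β := cLI) 0 0 (Or.inl rfl)).rep
  rwa [show 2 + 0 - 24 * ((2 - cL) / (24 * cLI)) * cLI = cL by field_simp; ring] at this

lemma fockRep_L (cL : ℂ) (cLI : ℂ) (n : ℤ) (hn : -1 ≤ n) :
    (Fock.L ((2 - cL) / (24 * cLI)) cLI 0 0 0)〚n + 1〛 1 = 0 := by
  rcases hn.eq_or_lt with rfl | hn
  · exact Fock.L_zero_one _ _ _
  · rw [Fock.L_pos_one _ _ _ _ _ (by omega)]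
    simp

lemma fockRep_I (n : ℤ) (hn : 0 ≤ n) : (Fock.c 0)〚n〛 1 = 0 := by
  rcases hn.eq_or_lt with rfl | hn
  · rw [(Fock.isHighest_c 0).zero, zero_smul]
  · exact (Fock.isHighest_c 0).pos n hn

lemma quotient_vacIdeal_isCyclic (cL cLI : ℂ) :
    IsCyclic cL cLI (Submodule.Quotient.mk 1 : U ⧸ vacIdeal cL cLI) where
  cL := smul_mk_one_eq_smul _ (Submodule.subset_span (by simp))
  cLI := smul_mk_one_eq_smul _ (Submodule.subset_span (by simp))
  cI := (smul_mk_one_eq_smul (c := 0) _ (Submodule.subset_span (by simp))).trans (zero_smul ℂ _)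
  span x := by
    obtain ⟨u, rfl⟩ := Submodule.Quotient.mk_surjective _ x
    exact ⟨u, mk_eq_smul_mk_one _ u⟩

/-- The universal vacuum module `U ⧸ vacIdeal` embeds in the Fock space. -/
theorem mem_vacIdeal_of_fockRep (hc : cLI ≠ 0) {u : U} (hu : (fockRep cL hc).hom u 1 = 0) :
    u ∈ vacIdeal cL cLI := by
  have hq := quotient_vacIdeal_isCyclic cL cLI
  have ann : ∀ u ∈ vacIdeal cL cLI, (fockRep cL hc).hom u 1 = 0 := fun u hu =>
    (fockRep cL hc).vacIdeal_apply (fockRep_L cL cLI) fockRep_I hu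
  have inj := injective_of_wordMap_injective
    (T := lowering (fun n => opOf (U ⧸ vacIdeal cL cLI) (L n)) (fun n => opOf _ (I n)) 2)
    (hq.rep.closedUnderComm (p := 2) (by omega))
    (hq.rep.span_words hq.cyclicVector
      (fun n hn => Submodule.mem_span_singleton.mpr ⟨0, (zero_smul ℂ _).trans
        (smul_mk_one_eq_zero _ (L_mem_vacIdeal cL cLI (by omega))).symm⟩)
      fun n hn => Submodule.mem_span_singleton.mpr ⟨0, (zero_smul ℂ _).trans
        (smul_mk_one_eq_zero _ (I_mem_vacIdeal cL cLI (by omega))).symm⟩)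
    (Fock.wordMap_injective_hVir ((2 - cL) / (24 * cLI)) 0 0 hc)
    (cyclicLift (fockRep cL hc).hom 1 _ ann) (by rw [cyclicLift_mk, map_one (fockRep cL hc).hom]; rfl) (by
      rintro ⟨_ | _, n⟩ x
      · exact (cyclicLift_smul _ _ _ _ _ _).trans (by rw [(fockRep cL hc).hom_I]; rfl)
      · exact (cyclicLift_smul _ _ _ _ _ _).trans (by rw [(fockRep cL hc).hom_L]; rfl))
  rw [← Submodule.Quotient.mk_eq_zero]
  refine inj ?_
  rw [map_zero, cyclicLift_mk, hu]

/-- Simplicity of `U ⧸ vacIdeal`: the orbit of the nonzero vector `u · 1` is stable and free of the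
variables `e`, so it contains `1`, and the embedding brings this back to `U`. -/
theorem exists_mul_sub_one_mem_vacIdeal (hc : cLI ≠ 0) {u : U} (hu : u ∉ vacIdeal cL cLI) :
    ∃ u', u' * u - 1 ∈ vacIdeal cL cLI := by
  set ρ := (fockRep cL hc).hom with hρ
  set f : Fock := ρ u 1 with hf
  let ev : U →ₗ[ℂ] Fock := (LinearMap.applyₗ f).comp ρ.toLinearMap
  have hev : ∀ u', ev u' = ρ u' f := fun _ => rfl
  have hL : ∀ n u', (Fock.L ((2 - cL) / (24 * cLI)) cLI 0 0 0)〚n + 1〛 (ρ u' f) =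
      ρ (L n * u') f := by
    intro n u'
    rw [map_mul, hρ, (fockRep cL hc).hom_L]
    rfl
  have hI : ∀ n u', (Fock.c 0)〚n〛 (ρ u' f) = ρ (I n * u') f := by
    intro n u'
    rw [map_mul, hρ, (fockRep cL hc).hom_I]
    rfl
  have efree : ∀ n u', MvPolynomial.pderiv (.e n) (ρ u' 1) = 0 := by
    intro n u'
    refine HVir.stable ρ (LinearMap.ker (MvPolynomial.pderiv (.e n) :
      Derivation ℂ Fock Fock).toLinearMap) (fun i x hx => ?_) u' 1 (by simp)
    change MvPolynomial.pderiv (.e n) x = 0 at hx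
    change MvPolynomial.pderiv (.e n) (ρ (gen i) x) = 0
    rw [hρ, (fockRep cL hc).hom_gen]
    cases i with
    | L m => exact (Fock.pderiv_e_L _ _ _ _ n _ x).trans (by rw [hx, map_zero])
    | I m => exact (Fock.pderiv_e_c _ n _ x).trans (by rw [hx, map_zero])
    | CL =>
      change MvPolynomial.pderiv _ (cL • x) = 0
      rw [Derivation.map_smul, hx, smul_zero]
    | CLI =>
      change MvPolynomial.pderiv _ (cLI • x) = 0
      rw [Derivation.map_smul, hx, smul_zero]
    | CI => exact map_zero _
  have one : (1 : Fock) ∈ LinearMap.range ev := by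
    refine Fock.one_mem_of_stable ((2 - cL) / (24 * cLI)) 0 hc _ ?_ ?_ ?_ ?_
    · rintro n _ ⟨u', rfl⟩
      refine ⟨L (n - 1) * u', ?_⟩
      rw [hev, hev, ← hL, sub_add_cancel]
    · rintro n _ ⟨u', rfl⟩
      exact ⟨I n * u', by rw [hev, hev, ← hI]⟩
    · rintro n _ ⟨u', rfl⟩
      rw [hev, hf, ← Module.End.mul_apply, ← map_mul, efree]
    · refine ⟨f, ⟨1, by rw [hev, map_one ρ]; rfl⟩, fun h => hu ?_⟩
      exact mem_vacIdeal_of_fockRep hc h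
  obtain ⟨u', hu'⟩ := one
  refine ⟨u', mem_vacIdeal_of_fockRep hc ?_⟩
  rw [← hρ, map_sub, map_mul, map_one ρ, LinearMap.sub_apply, Module.End.mul_apply, ← hf, ← hev, hu']
  exact sub_self _

lemma one_notMem_vacIdeal (hc : cLI ≠ 0) : (1 : U) ∉ vacIdeal cL cLI := fun h => by
  have := (fockRep cL hc).vacIdeal_apply (fockRep_L cL cLI) fockRep_I h
  rw [map_one (fockRep cL hc).hom] at this
  exact one_ne_zero (α := Fock) this

/-- The product of the `L(0) - j` for `1 ≤ j ≤ r`. -/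
def weightKiller : ℕ → U
  | 0 => 1
  | r + 1 => (L 0 - algebraMap ℂ U (r + 1)) * weightKiller r

lemma weightKiller_smul {Q : Type} [AddCommGroup Q] [Module ℂ Q] [Module U Q] [IsScalarTower ℂ U Q]
    {x : Q} {k : ℂ} (hx : L 0 • x = k • x) (r : ℕ) : weightKiller r • x =
      (∏ i ∈ Finset.range r, (k - (i + 1))) • x := by
  have := IsScalarTower.to_smulCommClass (R := ℂ) (A := U) (M := Q)
  induction r with
  | zero => simp [weightKiller]
  | succ r ih =>
    rw [weightKiller, mul_smul, ih, smul_comm, sub_smul, hx, algebraMap_smul, ← sub_smul, smul_smul,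
      Finset.prod_range_succ]

namespace Verma

/-- The module is spanned by words, whose weights are nonnegative integers, and only the empty word
has weight zero. The factors `L(0) - j` remove all positive weights up to `r`. -/
lemma exists_weightKiller (x : Verma cL 0 cLI 0 0) :
    ∃ (r : ℕ) (c : ℂ), weightKiller r • x = c • hwv cL 0 cLI 0 0 := by
  have comm := IsScalarTower.to_smulCommClass (R := ℂ) (A := U) (M := Verma cL 0 cLI 0 0)
  have hq := isCyclic cL cLI 0 0
  have h0 : L 0 • hwv cL 0 cLI 0 0 = (0 : ℂ) • hwv cL 0 cLI 0 0 := L_zero_hwv ..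
  have mono : ∀ (x : Verma cL 0 cLI 0 0) (r s : ℕ), r ≤ s →
      (∃ c : ℂ, weightKiller r • x = c • hwv cL 0 cLI 0 0) →
      ∃ c : ℂ, weightKiller s • x = c • hwv cL 0 cLI 0 0 := by
    intro x r s hrs h
    induction s, hrs using Nat.le_induction with
    | base => exact h
    | succ s _ ih =>
      obtain ⟨c, hc⟩ := ih
      refine ⟨c * (0 - (s + 1)), ?_⟩
      rw [weightKiller, mul_smul, hc, smul_comm, sub_smul, h0, algebraMap_smul, ← sub_smul,
        smul_smul]
  let P : Submodule ℂ (Verma cL 0 cLI 0 0) :=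
    { carrier := {x | ∃ (r : ℕ) (c : ℂ), weightKiller r • x = c • hwv cL 0 cLI 0 0}
      zero_mem' := ⟨0, 0, by simp⟩
      add_mem' := by
        rintro x y ⟨r, hx⟩ ⟨s, hy⟩
        obtain ⟨c, hc⟩ := mono x r _ (le_max_left r s) hx
        obtain ⟨d, hd⟩ := mono y s _ (le_max_right r s) hy
        exact ⟨max r s, c + d, by rw [smul_add, hc, hd, add_smul]⟩
      smul_mem' := by
        rintro a x ⟨r, c, hc⟩
        exact ⟨r, a * c, by rw [smul_comm, hc, smul_smul]⟩ }
  have : P = ⊤ := by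
    refine hq.rep.span_words (p := 1) hq.cyclicVector (fun n hn => ?_) (fun n hn => ?_) P fun l => ?_
    · refine Submodule.mem_span_singleton.mpr ⟨0, ?_⟩
      rcases (show (0 : ℤ) ≤ n by push_cast at hn; omega).eq_or_lt with rfl | hn
      · exact h0.symm
      · exact (zero_smul ℂ _).trans (L_hwv _ _ _ _ hn).symm
    · refine Submodule.mem_span_singleton.mpr ⟨0, ?_⟩
      rcases (show (0 : ℤ) ≤ n by omega).eq_or_lt with rfl | hn
      · exact (I_zero_hwv ..).symm
      · exact (zero_smul ℂ _).trans (I_hwv _ _ _ _ hn).symm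
    · cases l with
      | nil => exact ⟨0, 1, by rw [weightKiller, one_smul, one_smul]; rfl⟩
      | cons j l =>
        have hl := hq.rep.zero_word (h0.trans (zero_smul ℂ _)) (j :: l)
        refine ⟨((j :: l).map fun j => j.2 + 1).sum, 0, ?_⟩
        rw [weightKiller_smul hl, zero_smul, List.map_cons, List.sum_cons, Finset.prod_eq_zero
          (i := j.2 + (l.map fun j => j.2 + 1).sum) (Finset.mem_range.mpr (by omega)), zero_smul]
        push_cast
        ring
  have hx : x ∈ P := by
    rw [this]
    trivial
  exact hx

/-- The submodule of the Verma module generated by `L(-1)v`. -/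
def vacSubmodule (cL cLI : ℂ) : Submodule U (Verma cL 0 cLI 0 0) :=
  (vacIdeal cL cLI).map (Submodule.mkQ _)

lemma mk_mem_vacSubmodule {u : U} :
    (Submodule.Quotient.mk u : Verma cL 0 cLI 0 0) ∈ vacSubmodule cL cLI ↔ u ∈ vacIdeal cL cLI := by
  constructor
  · rintro ⟨u', hu', h⟩
    have := (Submodule.Quotient.eq _).mp h
    have := vermaIdeal_le_vacIdeal cL cLI this
    rw [← sub_sub_cancel u' u]
    exact sub_mem hu' this
  · exact fun h => ⟨u, h, rfl⟩

lemma hwv_notMem_vacSubmodule (hc : cLI ≠ 0) : hwv cL 0 cLI 0 0 ∉ vacSubmodule cL cLI :=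
  fun h => one_notMem_vacIdeal hc (mk_mem_vacSubmodule.mp h)

lemma eq_top_of_hwv_mem {h hI : ℂ} {N : Submodule U (Verma cL 0 cLI h hI)}
    (hN : hwv cL 0 cLI h hI ∈ N) : N = ⊤ := by
  refine eq_top_iff.mpr fun x _ => ?_
  obtain ⟨u, rfl⟩ := (isCyclic cL cLI h hI).span x
  exact N.smul_mem u hN

/-- The quotient by `vacSubmodule` is simple, so a submodule `N` not contained in it has an element
`z + hwv` with `z` in `vacSubmodule`. Projecting to weight zero gives `hwv ∈ N`, since the weight
zero part of `vacSubmodule` is trivial. -/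
theorem maxSubmodule_eq (hc : cLI ≠ 0) : maxSubmodule cL 0 cLI 0 0 = vacSubmodule cL cLI := by
  refine le_antisymm (sSup_le fun N hN => ?_) (le_sSup fun h => ?_)
  · by_contra hlt
    obtain ⟨x, hxN, hx⟩ := SetLike.not_le_iff_exists.mp hlt
    obtain ⟨u, rfl⟩ := Submodule.Quotient.mk_surjective _ x
    rw [mk_mem_vacSubmodule] at hx
    obtain ⟨u', hu'⟩ := exists_mul_sub_one_mem_vacIdeal hc hx
    set z : Verma cL 0 cLI 0 0 := Submodule.Quotient.mk (u' * u - 1) with hz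
    have hzM : z ∈ vacSubmodule cL cLI := mk_mem_vacSubmodule.mpr hu'
    have hy : z + hwv cL 0 cLI 0 0 ∈ N := by
      have : z + hwv cL 0 cLI 0 0 = u' • Submodule.Quotient.mk u := by
        rw [hz, hwv, ← Submodule.Quotient.mk_add, sub_add_cancel]
        rfl
      rw [this]
      exact N.smul_mem _ hxN
    obtain ⟨r, c, hr⟩ := exists_weightKiller z
    have hc0 : c = 0 := by
      by_contra hne
      refine hwv_notMem_vacSubmodule (cL := cL) hc ?_
      have h1 : c • hwv cL 0 cLI 0 0 ∈ vacSubmodule cL cLI := by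
        rw [← hr]
        exact Submodule.smul_mem _ _ hzM
      have h2 := Submodule.smul_mem _ (algebraMap ℂ U c⁻¹) h1
      rwa [algebraMap_smul, smul_smul, inv_mul_cancel₀ hne, one_smul] at h2
    rw [hc0, zero_smul] at hr
    have h3 := N.smul_mem (weightKiller r) hy
    rw [smul_add, hr, zero_add, weightKiller_smul (L_zero_hwv cL cLI 0 0)] at h3
    have hne : (∏ i ∈ Finset.range r, ((0 : ℂ) - (i + 1))) ≠ 0 :=
      Finset.prod_ne_zero_iff.mpr fun i _ => by
        rw [zero_sub]
        exact neg_ne_zero.mpr (Nat.cast_add_one_ne_zero i)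
    have h4 := N.smul_mem (algebraMap ℂ U (∏ i ∈ Finset.range r, ((0 : ℂ) - (i + 1)))⁻¹) h3
    rw [algebraMap_smul, smul_smul, inv_mul_cancel₀ hne, one_smul] at h4
    exact hN (eq_top_of_hwv_mem h4)
  · exact hwv_notMem_vacSubmodule hc (h ▸ Submodule.mem_top)

end Verma

namespace Vac

lemma smul_one_eq_zero_iff (hc : cLI ≠ 0) {u : U} : u • one cL cLI = 0 ↔ u ∈ vacIdeal cL cLI := by
  have : u • one cL cLI = Submodule.Quotient.mk (Submodule.Quotient.mk u) := by
    rw [one, ← Submodule.Quotient.mk_smul, Verma.hwv, ← mk_eq_smul_mk_one]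
  rw [this, Submodule.Quotient.mk_eq_zero, Verma.maxSubmodule_eq hc, Verma.mk_mem_vacSubmodule]

lemma one_ne_zero (hc : cLI ≠ 0) : one cL cLI ≠ 0 := fun h =>
  one_notMem_vacIdeal hc ((smul_one_eq_zero_iff hc).mp (by rw [h, smul_zero]))

lemma L_one (hc : cLI ≠ 0) {n : ℤ} (hn : -1 ≤ n) : L n • one cL cLI = 0 :=
  (smul_one_eq_zero_iff hc).mpr (L_mem_vacIdeal cL cLI hn)

lemma I_one (hc : cLI ≠ 0) {n : ℤ} (hn : 0 ≤ n) : I n • one cL cLI = 0 :=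
  (smul_one_eq_zero_iff hc).mpr (I_mem_vacIdeal cL cLI hn)

/-- By `smul_one_eq_zero_iff` the irreducible quotient has the universal property of the module `U ⧸
vacIdeal`. -/
theorem exists_lift (hc : cLI ≠ 0) {E : Type} [AddCommGroup E] [Module ℂ E]
    {ρL ρI : ℤ → Module.End ℂ E} {v : E} (h : HVirRep cL cLI ρL ρI)
    (hL : ∀ n : ℤ, -1 ≤ n → ρL n v = 0) (hI : ∀ n : ℤ, 0 ≤ n → ρI n v = 0) :
    ∃ φ : Vac cL cLI →ₗ[ℂ] E, φ (one cL cLI) = v ∧ (∀ n x, φ (L n • x) = ρL n (φ x)) ∧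
      ∀ n x, φ (I n • x) = ρI n (φ x) := by
  have key : ∀ u : U, u • one cL cLI = 0 → h.hom u v = 0 := fun u hu =>
    h.vacIdeal_apply hL hI ((smul_one_eq_zero_iff hc).mp hu)
  choose s hs using (isCyclic cL cLI).span
  have hφ : ∀ u x, x = u • one cL cLI → h.hom (s x) v = h.hom u v := by
    intro u x hx
    rw [← sub_eq_zero, ← LinearMap.sub_apply, ← map_sub]
    refine key _ ?_
    rw [sub_smul, ← hs, ← hx, sub_self]
  have comm := IsScalarTower.to_smulCommClass (R := ℂ) (A := U) (M := Vac cL cLI)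
  let φ : Vac cL cLI →ₗ[ℂ] E :=
    { toFun := fun x => h.hom (s x) v
      map_add' := fun x y => by
        rw [hφ (s x + s y) (x + y) (by rw [add_smul, ← hs, ← hs]), map_add, LinearMap.add_apply]
      map_smul' := fun c x => by
        rw [hφ (c • s x) (c • x) (by rw [smul_assoc, ← hs]), map_smul, LinearMap.smul_apply]
        rfl }
  have hu : ∀ u x, φ (u • x) = h.hom u (φ x) := fun u x =>
    (hφ (u * s x) (u • x) (by rw [mul_smul, ← hs])).trans (by rw [map_mul]; rfl)
  refine ⟨φ, ?_, fun n x => ?_, fun n x => ?_⟩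
  · exact (hφ 1 _ (one_smul _ _).symm).trans (by rw [map_one h.hom]; rfl)
  · rw [hu, h.hom_L]
  · rw [hu, h.hom_I]

end Vac

end HVir

section Standard

/-! ### Vertex algebra structures and modules given by generating fields -/

variable {Q : Type} [AddCommGroup Q] [Module ℂ Q] {M : Type} [AddCommGroup M] [Module ℂ M]

/-- A pair of fields, as a family. -/
abbrev fieldPair (a b : VertexOperator ℂ M) (x : Bool) : VertexOperator ℂ M := if x then a else b

lemma IsFieldMap.map_gen {X : Type} {sV : X → VertexOperator ℂ Q} {one : Q}
    {s : X → VertexOperator ℂ M} {φ : Q →ₗ[ℂ] VertexOperator ℂ M} (h : IsFieldMap sV one s φ)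
    (x : X) : φ ((sV x)〚-1〛 one) = s x := by
  rw [h.map_mode, h.map_one, nprod_idF_neg_one]

/-- The fields `L(z) = ∑ L(n) z^{-n-2}` and `I(z) = ∑ I(n) z^{-n-1}` on a module. -/
structure HVir.ActsBy [Module HVir.U Q] (fL fI : VertexOperator ℂ Q) : Prop where
  mode_L : ∀ (n : ℤ) (x : Q), fL〚n + 1〛 x = HVir.L n • x
  mode_I : ∀ (n : ℤ) (x : Q), fI〚n〛 x = HVir.I n • x

/-- The fields `L(z) = ∑ L(n) z^{-n-2}` and `W(z) = ∑ W(n) z^{-n-2}` on a module. -/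
structure W22.ActsBy [Module W22.U Q] (fL fW : VertexOperator ℂ Q) : Prop where
  mode_L : ∀ (n : ℤ) (x : Q), fL〚n + 1〛 x = W22.L n • x
  mode_W : ∀ (n : ℤ) (x : Q), fW〚n + 1〛 x = W22.W n • x

lemma HVir.IsCyclic.exists_fields [Module HVir.U Q] [IsScalarTower ℂ HVir.U Q] {cL cLI : ℂ} {v : Q}
    (h : HVir.IsCyclic cL cLI v) (h0 : ∀ n : ℤ, 0 < n → HVir.L n • v = 0 ∧ HVir.I n • v = 0) :
    ∃ fL fI : VertexOperator ℂ Q, HVirFields cL cLI fL fI ∧ HVir.ActsBy fL fI := by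
  obtain ⟨hL, hI⟩ := h.rep.restricted h.cyclicVector ⟨1, fun n hn => h0 n (by omega)⟩
  refine ⟨_, _, h.rep.fields hL hI, fun n x => ?_, fun n x => ?_⟩
  · rw [Restricted.weightTwo_ncoeff, add_sub_cancel_right]
    rfl
  · rw [Restricted.weightOne_ncoeff]
    rfl

lemma W22.IsCyclic.exists_fields [Module W22.U Q] [IsScalarTower ℂ W22.U Q] {cL cW : ℂ} {v : Q}
    (h : W22.IsCyclic cL cW v) (h0 : ∀ n : ℤ, 0 < n → W22.L n • v = 0 ∧ W22.W n • v = 0) :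
    ∃ fL fW : VertexOperator ℂ Q, W22Fields cL cW fL fW ∧ W22.ActsBy fL fW := by
  obtain ⟨hL, hW⟩ := h.rep.restricted h.cyclicVector ⟨1, fun n hn => h0 n (by omega)⟩
  refine ⟨_, _, h.rep.fields hL hW, fun n x => ?_, fun n x => ?_⟩
  · rw [Restricted.weightTwo_ncoeff, add_sub_cancel_right]
    rfl
  · rw [Restricted.weightTwo_ncoeff, add_sub_cancel_right]
    rfl

section W22Rep

variable {cL cW : ℂ} {ρL ρW : ℤ → Module.End ℂ M} {v : M}

lemma W22Rep.vacIdeal_apply (h : W22Rep cL cW ρL ρW) (hL : ∀ n : ℤ, -1 ≤ n → ρL n v = 0)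
    (hW : ∀ n : ℤ, -1 ≤ n → ρW n v = 0) (u : W22.U) (hu : u ∈ W22.vacIdeal cL cW) :
    h.hom u v = 0 := by
  refine annihilates_span h.hom v ?_ hu
  rintro x (⟨n, hn, rfl | rfl⟩ | rfl | rfl)
  · rw [h.hom_L, hL n hn]
  · rw [h.hom_W, hW n hn]
  · rw [map_sub, h.hom_gen, AlgHom.commutes, LinearMap.sub_apply, Module.algebraMap_end_apply]
    exact sub_self _
  · rw [map_sub, h.hom_gen, AlgHom.commutes, LinearMap.sub_apply, Module.algebraMap_end_apply]
    exact sub_self _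

lemma W22Rep.vermaIdeal_apply {h' hW' : ℂ} (h : W22Rep cL cW ρL ρW)
    (hL : ∀ n : ℤ, 0 < n → ρL n v = 0) (hW : ∀ n : ℤ, 0 < n → ρW n v = 0) (hL0 : ρL 0 v = h' • v)
    (hW0 : ρW 0 v = hW' • v) (u : W22.U) (hu : u ∈ W22.vermaIdeal cL cW h' hW') :
    h.hom u v = 0 := by
  refine annihilates_span h.hom v ?_ hu
  rintro x (⟨n, hn, rfl | rfl⟩ | rfl | rfl | rfl | rfl)
  · rw [h.hom_L, hL n hn]
  · rw [h.hom_W, hW n hn]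
  · rw [map_sub, h.hom_L, AlgHom.commutes, LinearMap.sub_apply, Module.algebraMap_end_apply, hL0,
      sub_self]
  · rw [map_sub, h.hom_W, AlgHom.commutes, LinearMap.sub_apply, Module.algebraMap_end_apply, hW0,
      sub_self]
  · rw [map_sub, h.hom_gen, AlgHom.commutes, LinearMap.sub_apply, Module.algebraMap_end_apply]
    exact sub_self _
  · rw [map_sub, h.hom_gen, AlgHom.commutes, LinearMap.sub_apply, Module.algebraMap_end_apply]
    exact sub_self _

lemma W22.Vac.exists_lift (h : W22Rep cL cW ρL ρW) (hL : ∀ n : ℤ, -1 ≤ n → ρL n v = 0)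
    (hW : ∀ n : ℤ, -1 ≤ n → ρW n v = 0) :
    ∃ φ : Vac cL cW →ₗ[ℂ] M, φ (one cL cW) = v ∧ (∀ n x, φ (L n • x) = ρL n (φ x)) ∧
      ∀ n x, φ (W n • x) = ρW n (φ x) := by
  refine ⟨cyclicLift h.hom v _ (h.vacIdeal_apply hL hW), ?_, fun n x => ?_, fun n x => ?_⟩
  · rw [one, cyclicLift_mk, map_one h.hom]
    rfl
  · rw [cyclicLift_smul, h.hom_L]
  · rw [cyclicLift_smul, h.hom_W]

lemma W22.Verma.exists_lift {h' hW' : ℂ} (h : W22Rep cL cW ρL ρW)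
    (hL : ∀ n : ℤ, 0 < n → ρL n v = 0) (hW : ∀ n : ℤ, 0 < n → ρW n v = 0) (hL0 : ρL 0 v = h' • v)
    (hW0 : ρW 0 v = hW' • v) :
    ∃ φ : Verma cL cW h' hW' →ₗ[ℂ] M, φ (hwv cL cW h' hW') = v ∧
      (∀ n x, φ (L n • x) = ρL n (φ x)) ∧ ∀ n x, φ (W n • x) = ρW n (φ x) := by
  refine ⟨cyclicLift h.hom v _ (h.vermaIdeal_apply hL hW hL0 hW0), ?_, fun n x => ?_,
    fun n x => ?_⟩
  · rw [hwv, cyclicLift_mk, map_one h.hom]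
    rfl
  · rw [cyclicLift_smul, h.hom_L]
  · rw [cyclicLift_smul, h.hom_W]

end W22Rep

/-! ### The vertex algebra of `W(2,2)` -/

namespace W22

variable {cL cW : ℂ} {fL fW : VertexOperator ℂ (Vac cL cW)}

lemma Vac.exists_fields (cL cW : ℂ) :
    ∃ fL fW : VertexOperator ℂ (Vac cL cW), W22Fields cL cW fL fW ∧ ActsBy fL fW :=
  (isCyclic cL cW).exists_fields fun n hn =>
    ⟨L_one cL cW (by omega), W_one cL cW (by omega)⟩

lemma ActsBy.generates (h : ActsBy fL fW) : Generates (fieldPair fL fW) (Vac.one cL cW) where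
  top P h1 hP := by
    refine (Vac.isCyclic cL cW).cyclicVector P h1 (fun n x hx => ?_) fun n x hx => ?_
    · have : fL〚n + 1〛 x ∈ P := hP true (n + 1) x hx
      rwa [h.mode_L] at this
    · have : fW〚n + 1〛 x ∈ P := hP false (n + 1) x hx
      rwa [h.mode_W] at this
  annihilates x k hk := by
    cases x
    · have := h.mode_W (k - 1) (Vac.one cL cW)
      rwa [sub_add_cancel, Vac.W_one cL cW (by omega)] at this
    · have := h.mode_L (k - 1) (Vac.one cL cW)
      rwa [sub_add_cancel, Vac.L_one cL cW (by omega)] at this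

/-- The universal property of the vacuum module, applied to the representation `nprodRep` on the
space of fields with `idF M` as image of the vacuum. -/
lemma ActsBy.exists_isFieldMap (h : ActsBy fL fW) {gL gW : VertexOperator ℂ M}
    (hM : W22Fields cL cW gL gW) :
    ∃ φ, IsFieldMap (fieldPair fL fW) (Vac.one cL cW) (fieldPair gL gW) φ := by
  obtain ⟨φ, h1, hL, hW⟩ := Vac.exists_lift (v := idF M) hM.nprodRep
    (fun n hn => nprod_idF_of_nonneg gL (show 0 ≤ n + 1 by omega))
    fun n hn => nprod_idF_of_nonneg gW (show 0 ≤ n + 1 by omega)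
  refine ⟨φ, h1, fun x k v => ?_⟩
  cases x
  · have := h.mode_W (k - 1) v
    rw [sub_add_cancel] at this
    have e := hW (k - 1) v
    rw [sub_add_cancel] at e
    exact (congrArg φ this).trans e
  · have := h.mode_L (k - 1) v
    rw [sub_add_cancel] at this
    have e := hL (k - 1) v
    rw [sub_add_cancel] at e
    exact (congrArg φ this).trans e

lemma ActsBy.mode_one (h : ActsBy fL fW) (x : Bool) : (fieldPair fL fW x)〚-1〛 (Vac.one cL cW) =
    if x then L (-2) • Vac.one cL cW else W (-2) • Vac.one cL cW := by
  cases x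
  · exact h.mode_W (-2) _
  · exact h.mode_L (-2) _

lemma IsStandard.Y_gen {A : VertexAlgebra (Vac cL cW)} (hA : IsStandard A) (h : ActsBy fL fW)
    (x : Bool) : A.Y ((fieldPair fL fW x)〚-1〛 (Vac.one cL cW)) = fieldPair fL fW x := by
  rw [h.mode_one]
  cases x
  · refine field_ext fun n x => ?_
    have := (hA.w (n - 1) x).trans (h.mode_W (n - 1) x).symm
    rwa [sub_add_cancel] at this
  · refine field_ext fun n x => ?_
    have := (hA.omega (n - 1) x).trans (h.mode_L (n - 1) x).symm
    rwa [sub_add_cancel] at this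

/-- For uniqueness, the Borcherds identity at `p = 0` makes the state-field map of any standard
structure a field map, and field maps agree on what the generators produce. -/
theorem existsUnique_vertexAlgebra (cL cW : ℂ) :
    ∃! A : VertexAlgebra (Vac cL cW), IsStandard A := by
  obtain ⟨fL, fW, hf, ha⟩ := Vac.exists_fields cL cW
  obtain ⟨φ, hφ⟩ := ha.exists_isFieldMap hf
  refine ⟨hφ.vertexAlgebra ha.generates hf.currents, ⟨rfl, fun n x => ?_, fun n x => ?_⟩,
    fun A hA => VertexAlgebra.ext_Y hA.vac_eq ?_⟩
  · have := hφ.map_gen true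
    rw [ha.mode_one] at this
    exact (congrArg (fun f : VertexOperator ℂ _ => f〚n + 1〛 x) this).trans (ha.mode_L n x)
  · have := hφ.map_gen false
    rw [ha.mode_one] at this
    exact (congrArg (fun f : VertexOperator ℂ _ => f〚n + 1〛 x) this).trans (ha.mode_W n x)
  · exact IsFieldMap.unique ha.generates (A.isFieldMap hA.vac_eq _ (hA.Y_gen ha)) hφ

end W22

/-! ### The vertex algebra of the twisted Heisenberg-Virasoro algebra and its modules -/

namespace HVir

variable {cL cLI : ℂ} {fL fI : VertexOperator ℂ (Vac cL cLI)}

lemma Vac.exists_fields (cL : ℂ) (hc : cLI ≠ 0) :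
    ∃ fL fI : VertexOperator ℂ (Vac cL cLI), HVirFields cL cLI fL fI ∧ ActsBy fL fI :=
  (isCyclic cL cLI).exists_fields fun n hn =>
    ⟨L_one hc (by omega), I_one hc (by omega)⟩

lemma Verma.exists_fields (cL cLI h hI : ℂ) :
    ∃ fL fI : VertexOperator ℂ (Verma cL 0 cLI h hI), HVirFields cL cLI fL fI ∧ ActsBy fL fI :=
  (isCyclic cL cLI h hI).exists_fields fun _ hn =>
    ⟨L_hwv cL cLI h hI hn, I_hwv cL cLI h hI hn⟩

lemma ActsBy.generates (h : ActsBy fL fI) (hc : cLI ≠ 0) :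
    Generates (fieldPair fL fI) (Vac.one cL cLI) where
  top P h1 hP := by
    refine (Vac.isCyclic cL cLI).cyclicVector P h1 (fun n x hx => ?_) fun n x hx => ?_
    · have : fL〚n + 1〛 x ∈ P := hP true (n + 1) x hx
      rwa [h.mode_L] at this
    · have : fI〚n〛 x ∈ P := hP false n x hx
      rwa [h.mode_I] at this
  annihilates x k hk := by
    cases x
    · exact (h.mode_I k _).trans (Vac.I_one hc hk)
    · have := h.mode_L (k - 1) (Vac.one cL cLI)
      rwa [sub_add_cancel, Vac.L_one hc (by omega)] at this

lemma ActsBy.exists_isFieldMap (h : ActsBy fL fI) (hc : cLI ≠ 0) {gL gI : VertexOperator ℂ M}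
    (hM : HVirFields cL cLI gL gI) :
    ∃ φ, IsFieldMap (fieldPair fL fI) (Vac.one cL cLI) (fieldPair gL gI) φ := by
  obtain ⟨φ, h1, hL, hI⟩ := Vac.exists_lift (v := idF M) hc hM.nprodRep
    (fun n hn => nprod_idF_of_nonneg gL (show 0 ≤ n + 1 by omega))
    fun n hn => nprod_idF_of_nonneg gI hn
  refine ⟨φ, h1, fun x k v => ?_⟩
  cases x
  · exact (congrArg φ (h.mode_I k v)).trans (hI k v)
  · have := h.mode_L (k - 1) v
    rw [sub_add_cancel] at this
    have e := hL (k - 1) v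
    rw [sub_add_cancel] at e
    exact (congrArg φ this).trans e

lemma ActsBy.mode_one (h : ActsBy fL fI) (x : Bool) : (fieldPair fL fI x)〚-1〛 (Vac.one cL cLI) =
    if x then L (-2) • Vac.one cL cLI else I (-1) • Vac.one cL cLI := by
  cases x
  · exact h.mode_I (-1) _
  · exact h.mode_L (-2) _

lemma IsStandard.Y_gen {B : VertexAlgebra (Vac cL cLI)} (hB : IsStandard B) (h : ActsBy fL fI)
    (x : Bool) : B.Y ((fieldPair fL fI x)〚-1〛 (Vac.one cL cLI)) = fieldPair fL fI x := by
  rw [h.mode_one]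
  cases x
  · exact field_ext fun n x => (hB.heis n x).trans (h.mode_I n x).symm
  · refine field_ext fun n x => ?_
    have := (hB.omega (n - 1) x).trans (h.mode_L (n - 1) x).symm
    rwa [sub_add_cancel] at this

theorem existsUnique_vertexAlgebra (cL : ℂ) (hc : cLI ≠ 0) :
    ∃! B : VertexAlgebra (Vac cL cLI), IsStandard B := by
  obtain ⟨fL, fI, hf, ha⟩ := Vac.exists_fields cL hc
  obtain ⟨φ, hφ⟩ := ha.exists_isFieldMap hc hf
  refine ⟨hφ.vertexAlgebra (ha.generates hc) hf.currents, ⟨rfl, fun n x => ?_, fun n x => ?_⟩,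
    fun B hB => VertexAlgebra.ext_Y hB.vac_eq ?_⟩
  · have := hφ.map_gen true
    rw [ha.mode_one] at this
    exact (congrArg (fun f : VertexOperator ℂ _ => f〚n + 1〛 x) this).trans (ha.mode_L n x)
  · have := hφ.map_gen false
    rw [ha.mode_one] at this
    exact (congrArg (fun f : VertexOperator ℂ _ => f〚n〛 x) this).trans (ha.mode_I n x)
  · exact IsFieldMap.unique (ha.generates hc) (B.isFieldMap hB.vac_eq _ (hB.Y_gen ha)) hφ

section Mod

variable {B : VertexAlgebra (Vac cL cLI)} [Module U M] {gL gI : VertexOperator ℂ M}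

lemma IsCompatible.isFieldMap {S : B.Mod M} (hS : IsCompatible S) (hB : IsStandard B)
    (h : ActsBy fL fI) (hM : ActsBy gL gI) :
    IsFieldMap (fieldPair fL fI) (Vac.one cL cLI) (fieldPair gL gI) S.Y := by
  refine S.isFieldMap hB.vac_eq _ (hB.Y_gen h) fun x => ?_
  rw [h.mode_one]
  cases x
  · exact field_ext fun n x => (hS.heis n x).trans (hM.mode_I n x).symm
  · refine field_ext fun n x => ?_
    have := (hS.omega (n - 1) x).trans (hM.mode_L (n - 1) x).symm
    rwa [sub_add_cancel] at this

theorem existsUnique_mod (hc : cLI ≠ 0) (hB : IsStandard B) (hM : HVirFields cL cLI gL gI)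
    (hg : ActsBy gL gI) : ∃! S : B.Mod M, IsCompatible S := by
  obtain ⟨fL, fI, hf, ha⟩ := Vac.exists_fields cL hc
  obtain ⟨φ, hφ⟩ := ha.exists_isFieldMap hc hM
  have hV := B.isFieldMap hB.vac_eq _ (hB.Y_gen ha)
  let S : B.Mod M :=
    { Y := φ
      vacuum := fun n x => by rw [hB.vac_eq, hφ.map_one, idF_ncoeff]
      borcherds := IsFieldMap.borcherds (ha.generates hc) hf.currents hM.currents hV hφ }
  refine ⟨S, ⟨fun n x => ?_, fun n x => ?_⟩, fun T hT => VertexAlgebra.Mod.ext_Y ?_⟩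
  · have := hφ.map_gen true
    rw [ha.mode_one] at this
    exact (congrArg (fun f : VertexOperator ℂ _ => f〚n + 1〛 x) this).trans (hg.mode_L n x)
  · have := hφ.map_gen false
    rw [ha.mode_one] at this
    exact (congrArg (fun f : VertexOperator ℂ _ => f〚n〛 x) this).trans (hg.mode_I n x)
  · exact IsFieldMap.unique (ha.generates hc) (hT.isFieldMap hB ha hg) hφ

end Mod

/-- The map `φ` turns `I(k)` into the `k`-th product with `gI`, so `I(-1)² 1` gives `:II:` and
`I(-2) 1` gives the derivative of `gI`. -/
lemma ActsBy.map_wVector (h : ActsBy fL fI) {gL gI : VertexOperator ℂ M}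
    {φ : Vac cL cLI →ₗ[ℂ] VertexOperator ℂ M}
    (hφ : IsFieldMap (fieldPair fL fI) (Vac.one cL cLI) (fieldPair gL gI) φ) :
    φ ((I (-1) ^ 2 + (2 * cLI) • I (-2)) • Vac.one cL cLI) = wField cLI gI := by
  have e : ∀ (k : ℤ) v, φ (I k • v) = nprod gI (φ v) k := fun k v =>
    (congrArg φ (h.mode_I k v).symm).trans (hφ.map_mode false k v)
  rw [add_smul, map_add, pow_two, mul_smul, e, e, hφ.map_one, nprod_idF_neg_one, smul_assoc,
    map_smul, e, hφ.map_one, ← derF_eq_nprod]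
  rfl

end HVir

end Standard

section Comparison

/-! ### Comparison of the Verma modules -/

variable {Q : Type} [AddCommGroup Q] [Module ℂ Q] {M : Type} [AddCommGroup M] [Module ℂ M]

lemma map_wField (Ψ : Q →ₗ[ℂ] M) {a : VertexOperator ℂ Q} {b : VertexOperator ℂ M}
    (h : ∀ n x, Ψ (a〚n〛 x) = b〚n〛 (Ψ x)) (c : ℂ) (n : ℤ) (x : Q) :
    Ψ ((wField c a)〚n〛 x) = (wField c b)〚n〛 (Ψ x) := by
  simp only [wField, map_add, Pi.add_apply, LinearMap.add_apply, map_smul, Pi.smul_apply,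
    LinearMap.smul_apply, derF_ncoeff, nprod_ncoeff, h, map_borSum Ψ h h]

/-- The vectors of highest weight for a field with commuting modes. -/
def highestSubmodule (a : VertexOperator ℂ M) (z : ℂ) : Submodule ℂ M where
  carrier := {x | IsHighest a z x}
  zero_mem' := ⟨fun n _ => map_zero _, by rw [map_zero, smul_zero]⟩
  add_mem' := fun {x y} hx hy => ⟨fun n hn => by rw [map_add, hx.pos n hn, hy.pos n hn, add_zero],
    by rw [map_add, hx.zero, hy.zero, smul_add]⟩
  smul_mem' := fun c x hx => ⟨fun n hn => by rw [map_smul, hx.pos n hn, smul_zero],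
    by rw [map_smul, hx.zero, smul_comm]⟩

lemma IsHighest.apply {a : VertexOperator ℂ M} {z : ℂ} {x : M} (h : IsHighest a z x)
    (hc : ∀ x, commFun a a x = 0) (k : ℤ) : IsHighest a z (a〚k〛 x) := by
  rw [commFun_eq_zero_iff] at hc
  exact ⟨fun n hn => by rw [hc, h.pos n hn, map_zero], by rw [hc, h.zero, map_smul]⟩

/-- A subspace that is stable under `L(z)` and under the weight two field contains everything that
is generated from its highest weight vectors. -/
theorem HVirFields.eq_top_of_stable {cL cLI z : ℂ} {fL fI : VertexOperator ℂ M}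
    (hf : HVirFields cL cLI fL fI) (hz : ∀ n : ℕ, z + n * cLI ≠ 0) {v : M} (hv : IsHighest fI z v)
    (hcyc : ∀ P : Submodule ℂ M, v ∈ P → (∀ n, ∀ x ∈ P, fL〚n + 1〛 x ∈ P) →
      (∀ n, ∀ x ∈ P, fI〚n〛 x ∈ P) → P = ⊤)
    (R : Submodule ℂ M) (hvR : v ∈ R) (hL : ∀ n, ∀ x ∈ R, fL〚n + 1〛 x ∈ R)
    (hW : ∀ n, ∀ x ∈ R, (wField cLI fI)〚n〛 x ∈ R) : R = ⊤ := by
  -- Solves the triangular system of `IsHighest.wField_neg` by strong induction. Modes of `I`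
  -- commute, hence preserve highest weight vectors, so the hypothesis applies twice to the
  -- quadratic terms.
  have neg : ∀ n : ℕ, ∀ x ∈ R ⊓ highestSubmodule fI z, fI〚-1 - (n : ℤ)〛 x ∈ R := by
    intro n
    induction n using Nat.strong_induction_on with
    | _ n ih =>
      rintro x ⟨hxR, hx⟩
      have hx' : IsHighest fI z x := hx
      have key := hW (-(n : ℤ)) x hxR
      rw [hx'.wField_neg, Submodule.add_mem_iff_right] at key
      · refine (Submodule.smul_mem_iff _ ?_).mp key
        exact mul_ne_zero two_ne_zero (hz n)
      · refine R.sum_mem fun i hi => ?_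
        have hi := Finset.mem_range.mp hi
        refine ih i hi _ ⟨?_, hx'.apply hf.II _⟩
        have := ih (n - 1 - i) (by omega) x ⟨hxR, hx⟩
        rwa [show -1 - ((n - 1 - i : ℕ) : ℤ) = -n + i by omega] at this
  have hI : ∀ n, ∀ x ∈ R ⊓ highestSubmodule fI z, fI〚n〛 x ∈ R ⊓ highestSubmodule fI z := by
    rintro n x ⟨hxR, hx⟩
    have hx' : IsHighest fI z x := hx
    refine ⟨?_, hx'.apply hf.II n⟩
    rcases lt_trichotomy n 0 with hn | rfl | hn
    · have := neg (-1 - n).toNat x ⟨hxR, hx⟩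
      rwa [show -1 - (((-1 - n).toNat : ℕ) : ℤ) = n by omega] at this
    · rw [hx'.zero]
      exact R.smul_mem _ hxR
    · rw [hx'.pos n hn]
      exact R.zero_mem
  set D := R ⊓ highestSubmodule fI z with hD
  let S : Set (Submodule ℂ M) := {N | D ≤ N ∧ ∀ n, ∀ x ∈ N, fL〚n + 1〛 x ∈ N}
  have hPD : D ≤ sInf S := le_sInf fun N hN => hN.1
  have hPL : ∀ n, ∀ x ∈ sInf S, fL〚n + 1〛 x ∈ sInf S := fun n x hx =>
    Submodule.mem_sInf.mpr fun N hN => hN.2 n x (Submodule.mem_sInf.mp hx N hN)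
  have hPI : ∀ n, ∀ x ∈ sInf S, fI〚n〛 x ∈ sInf S := by
    -- The vectors of `sInf S` that all modes of `I` keep inside it contain `D` and are stable under
    -- `L`, because `[I(m), L(n)]` is a mode of `I` plus a scalar; by minimality they are all of
    -- `sInf S`.
    have : sInf S ≤ sInf S ⊓ ⨅ n, (sInf S).comap (fI〚n〛) := by
      refine sInf_le ⟨le_inf hPD (le_iInf fun n x hx => hPD (hI n x hx)), ?_⟩
      rintro n x ⟨hx, hx'⟩
      rw [SetLike.mem_coe, Submodule.mem_iInf] at hx'
      refine ⟨hPL n x hx, ?_⟩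
      rw [SetLike.mem_coe, Submodule.mem_iInf]
      intro m
      exact mem_of_mul_sub_eq (hf.rep.commIL n m) (hPL n _ (hx' m)) (hx' (n + m)) hx
    intro n x hx
    have := (this hx).2
    rw [SetLike.mem_coe, Submodule.mem_iInf] at this
    exact this n
  have top := hcyc (sInf S) (hPD ⟨hvR, hv⟩) hPL hPI
  rw [eq_top_iff, ← top]
  exact sInf_le ⟨inf_le_left, hL⟩

variable {cL cLI h hI : ℂ}

lemma HVir.Verma.exists_lift {ρL ρI : ℤ → Module.End ℂ M} {v : M} (H : HVirRep cL cLI ρL ρI)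
    (hL : ∀ n : ℤ, 0 < n → ρL n v = 0) (hI' : ∀ n : ℤ, 0 < n → ρI n v = 0) (hL0 : ρL 0 v = h • v)
    (hI0 : ρI 0 v = hI • v) :
    ∃ φ : Verma cL 0 cLI h hI →ₗ[ℂ] M, φ (hwv cL 0 cLI h hI) = v ∧
      (∀ n x, φ (L n • x) = ρL n (φ x)) ∧ ∀ n x, φ (I n • x) = ρI n (φ x) := by
  refine ⟨cyclicLift H.hom v _ fun u hu => H.vermaIdeal_apply hL hI' hL0 hI0 hu, ?_,
    fun n x => ?_, fun n x => ?_⟩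
  · rw [hwv, cyclicLift_mk, map_one H.hom]
    rfl
  · rw [cyclicLift_smul, H.hom_L]
  · rw [cyclicLift_smul, H.hom_I]

/-- The Verma module maps to a Fock space on which `1` has the same weights. -/
lemma HVir.Verma.exists_toFock (hc : cLI ≠ 0) (cL h hI : ℂ) :
    ∃ (α z' : ℂ) (φ : Verma cL 0 cLI h hI →ₗ[ℂ] Fock), φ (hwv cL 0 cLI h hI) = 1 ∧
      (∀ n x, φ (L n • x) = (Fock.L α cLI 1 hI z')〚n + 1〛 (φ x)) ∧
      ∀ n x, φ (I n • x) = (Fock.c hI)〚n〛 (φ x) := by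
  set α := (3 - cL) / (24 * cLI) with hα
  -- Here `κ = 1`, so the central charge is `3 - 24 α β` and `L(0) 1 = -α hI + z'² / 2`. The zero
  -- mode `z'` of `e` is chosen to make this `h`.
  obtain ⟨z', hz'⟩ := IsAlgClosed.exists_pow_nat_eq (2 * (h + α * hI)) (n := 2) two_pos
  have H := (Fock.fields (α := α) (β := cLI) (κ := 1) hI z' (Or.inr rfl)).rep
  rw [show 2 + 1 - 24 * α * cLI = cL by rw [hα]; field_simp; ring] at H
  refine ⟨α, z', exists_lift H (fun n hn => ?_) (fun n hn => ?_) ?_ ?_⟩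
  · rw [Fock.L_pos_one _ _ _ _ _ (by omega), if_neg (by omega)]
  · exact (Fock.isHighest_c hI).pos n hn
  · rw [Fock.L_pos_one _ _ _ _ _ (by omega), if_pos (by omega), hz']
    congr 1
    ring
  · exact (Fock.isHighest_c hI).zero

variable {fL fI : VertexOperator ℂ (HVir.Verma cL 0 cLI h hI)}

lemma HVir.ActsBy.isHighest_hwv (ha : HVir.ActsBy fL fI) :
    IsHighest fI hI (HVir.Verma.hwv cL 0 cLI h hI) where
  pos n hn := by rw [ha.mode_I, Verma.I_hwv cL cLI h hI hn]
  zero := by rw [ha.mode_I, Verma.I_zero_hwv]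

theorem W22.Verma.exists_toHVir (hf : HVirFields cL cLI fL fI) (ha : HVir.ActsBy fL fI) :
    ∃ Φ : Verma cL (-24 * cLI ^ 2) h (hI * (hI - 2 * cLI)) →ₗ[ℂ] HVir.Verma cL 0 cLI h hI,
      Φ (hwv ..) = HVir.Verma.hwv cL 0 cLI h hI ∧ (∀ n x, Φ (L n • x) = fL〚n + 1〛 (Φ x)) ∧
        ∀ n x, Φ (W n • x) = (wField cLI fI)〚n + 1〛 (Φ x) := by
  refine exists_lift hf.w22Fields.rep (fun n hn => ?_) (fun n hn => ?_) ?_ ?_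
  · rw [ha.mode_L, HVir.Verma.L_hwv cL cLI h hI hn]
  · rw [ha.isHighest_hwv.wField_pos _ (by omega), if_neg (by omega)]
  · rw [ha.mode_L, HVir.Verma.L_zero_hwv]
  · rw [ha.isHighest_hwv.wField_pos _ (by omega), if_pos (by omega)]

/-- For injectivity only the composite with the map `π` to the Fock space is used; it sends ordered
words to independent polynomials. For surjectivity, the range is stable under `L` and the weight two
field, so `HVirFields.eq_top_of_stable` applies. -/
theorem W22.Verma.bijective_of_toHVir {cW hW : ℂ} (hc : cLI ≠ 0) (hz : ∀ n : ℕ, hI + n * cLI ≠ 0)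
    (hf : HVirFields cL cLI fL fI) (ha : HVir.ActsBy fL fI)
    {Φ : Verma cL cW h hW →ₗ[ℂ] HVir.Verma cL 0 cLI h hI}
    (h1 : Φ (hwv ..) = HVir.Verma.hwv cL 0 cLI h hI) (hL : ∀ n x, Φ (L n • x) = fL〚n + 1〛 (Φ x))
    (hΦW : ∀ n x, Φ (W n • x) = (wField cLI fI)〚n + 1〛 (Φ x)) : Function.Bijective Φ := by
  constructor
  · obtain ⟨α, z', π, hπ1, hπL, hπI⟩ := HVir.Verma.exists_toFock hc cL h hI
    have hq := isCyclic cL cW h hW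
    have hv : ∀ n : ℤ, -1 < n → L n • hwv cL cW h hW ∈ Submodule.span ℂ {hwv cL cW h hW} ∧
        W n • hwv cL cW h hW ∈ Submodule.span ℂ {hwv cL cW h hW} := by
      intro n hn
      rcases (show 0 ≤ n by omega).eq_or_lt with rfl | hn
      · refine ⟨Submodule.mem_span_singleton.mpr ⟨h, ?_⟩, Submodule.mem_span_singleton.mpr ⟨hW, ?_⟩⟩
        · exact (smul_mk_one_eq_smul _ (Submodule.subset_span (by simp))).symm
        · exact (smul_mk_one_eq_smul _ (Submodule.subset_span (by simp))).symm
      · have e1 : L n • hwv cL cW h hW = 0 :=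
          smul_mk_one_eq_zero _ (Submodule.subset_span (Or.inl ⟨n, hn, Or.inl rfl⟩))
        have e2 : W n • hwv cL cW h hW = 0 :=
          smul_mk_one_eq_zero _ (Submodule.subset_span (Or.inl ⟨n, hn, Or.inr rfl⟩))
        rw [e1, e2]
        exact ⟨Submodule.zero_mem _, Submodule.zero_mem _⟩
    have inj : Function.Injective (π ∘ₗ Φ) := injective_of_wordMap_injective
      (T := lowering (fun n => opOf (Verma cL cW h hW) (L n)) (fun n => opOf _ (W n)) 1)
      hq.rep.closedUnderComm
      (hq.rep.span_words hq.cyclicVector (fun n hn => (hv n hn).1) fun n hn => (hv n hn).2)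
      (Fock.wordMap_injective_w22 α 1 z' hz) (π ∘ₗ Φ)
      ((congrArg π h1).trans hπ1) (by
        rintro ⟨_ | _, n⟩ x
        · refine (congrArg π (hΦW _ x)).trans ?_
          exact map_wField π (fun n x => by rw [ha.mode_I, hπI]) _ _ _
        · refine (congrArg π (hL _ x)).trans ?_
          rw [ha.mode_L, hπL]
          rfl)
    exact Function.Injective.of_comp inj
  · rw [← LinearMap.range_eq_top]
    have hcyc := (HVir.Verma.isCyclic cL cLI h hI).cyclicVector
    refine hf.eq_top_of_stable hz ha.isHighest_hwv (fun P hv hPL hPI => hcyc P hv ?_ ?_)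
      (LinearMap.range Φ) ⟨_, h1⟩ ?_ ?_
    · intro n x hx
      have := hPL n x hx
      rwa [ha.mode_L] at this
    · intro n x hx
      have := hPI n x hx
      rwa [ha.mode_I] at this
    · rintro n _ ⟨x, rfl⟩
      exact ⟨_, hL n x⟩
    · rintro n _ ⟨x, rfl⟩
      refine ⟨W (n - 1) • x, ?_⟩
      rw [hΦW, sub_add_cancel]

end Comparison

/-! ### The homomorphism of vertex algebras and the main theorem -/

section MainTheorem

variable {cL cLI : ℂ}

namespace HVir

variable {fL fI : VertexOperator ℂ (Vac cL cLI)}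

lemma ActsBy.isHighest_one (ha : ActsBy fL fI) (hc : cLI ≠ 0) :
    IsHighest fI 0 (Vac.one cL cLI) where
  pos n hn := by rw [ha.mode_I, Vac.I_one hc hn.le]
  zero := by rw [ha.mode_I, Vac.I_one hc le_rfl, zero_smul]

lemma ActsBy.wField_one (ha : ActsBy fL fI) (hc : cLI ≠ 0) {n : ℤ} (hn : 0 ≤ n) :
    (wField cLI fI)〚n〛 (Vac.one cL cLI) = 0 := by
  rcases hn.eq_or_lt with rfl | hn
  · simpa using (ha.isHighest_one hc).wField_neg cLI 0
  · rw [(ha.isHighest_one hc).wField_pos cLI hn, zero_mul, zero_smul, ite_self]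

end HVir

/-- The homomorphism of vertex algebras with `w ↦ (I(-1)² + 2 c_LI I(-2)) 1`. -/
theorem W22.exists_hom_toHVir (hc : cLI ≠ 0) {A : VertexAlgebra (Vac cL (-24 * cLI ^ 2))}
    {B : VertexAlgebra (HVir.Vac cL cLI)} (hA : IsStandard A) (hB : HVir.IsStandard B) :
    ∃ Ψ : VertexAlgebra.Hom A B,
      Ψ.toLinearMap (Vac.one cL (-24 * cLI ^ 2)) = HVir.Vac.one cL cLI ∧
      Ψ.toLinearMap (L (-2) • Vac.one cL (-24 * cLI ^ 2)) = HVir.L (-2) • HVir.Vac.one cL cLI ∧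
      Ψ.toLinearMap (W (-2) • Vac.one cL (-24 * cLI ^ 2)) =
        (HVir.I (-1) ^ 2 + (2 * cLI) • HVir.I (-2)) • HVir.Vac.one cL cLI := by
  obtain ⟨fL, fW, hf, ha⟩ := Vac.exists_fields cL (-24 * cLI ^ 2)
  obtain ⟨gL, gI, hg, hb⟩ := HVir.Vac.exists_fields cL hc
  have hφ := B.isFieldMap hB.vac_eq _ (hB.Y_gen hb)
  have hw := hb.map_wVector hφ
  obtain ⟨Ψ, h1, hL, hW⟩ := Vac.exists_lift (v := HVir.Vac.one cL cLI) hg.w22Fields.rep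
    (fun n hn => by rw [hb.mode_L, HVir.Vac.L_one hc hn])
    fun n hn => hb.wField_one hc (by omega)
  have hω : Ψ (L (-2) • Vac.one cL (-24 * cLI ^ 2)) = HVir.L (-2) • HVir.Vac.one cL cLI := by
    rw [hL, h1, hb.mode_L]
  have hwΨ : Ψ (W (-2) • Vac.one cL (-24 * cLI ^ 2)) =
      (HVir.I (-1) ^ 2 + (2 * cLI) • HVir.I (-2)) • HVir.Vac.one cL cLI := by
    rw [hW, h1, ← hw]
    -- The creation axiom recovers the vector from its field, which `hw` identifies with `wField cLI
    -- gI`.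
    have := B.creation ((HVir.I (-1) ^ 2 + (2 * cLI) • HVir.I (-2)) • HVir.Vac.one cL cLI)
    rwa [hB.vac_eq] at this
  refine ⟨VertexAlgebra.homOfGenerates ha.generates hA.vac_eq _ (hA.Y_gen ha) Ψ
    (h1.trans hB.vac_eq.symm) fun x n v => ?_, h1, hω, hwΨ⟩
  rw [ha.mode_one]
  cases x
  · rw [if_neg Bool.false_ne_true, hwΨ, hw]
    have e1 := ha.mode_W (n - 1) v
    have e2 := hW (n - 1) v
    rw [sub_add_cancel] at e1 e2
    exact (congrArg Ψ e1).trans e2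
  · rw [if_pos rfl, hω]
    have e1 := ha.mode_L (n - 1) v
    have e2 := hL (n - 1) v
    rw [sub_add_cancel] at e1 e2
    have e3 := hB.Y_gen hb true
    rw [hb.mode_one] at e3
    exact (congrArg Ψ e1).trans
      (e2.trans (congrArg (fun f : VertexOperator ℂ _ => f〚n〛 (Ψ v)) e3).symm)

end MainTheorem

end

theorem mainTheorem7 (cL cLI cW : ℂ) (hcLI : cLI ≠ 0) (hcW : cW = -24 * cLI ^ 2) :
    (∃! A : VertexAlgebra (W22.Vac cL cW), W22.IsStandard A) ∧
    (∃! B : VertexAlgebra (HVir.Vac cL cLI), HVir.IsStandard B) ∧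
    ∀ (A : VertexAlgebra (W22.Vac cL cW)) (B : VertexAlgebra (HVir.Vac cL cLI)),
      W22.IsStandard A → HVir.IsStandard B →
      ∃ Ψ : VertexAlgebra.Hom A B,
        Ψ.toLinearMap ≠ 0 ∧
        Ψ.toLinearMap (W22.L (-2) • W22.Vac.one cL cW) = HVir.L (-2) • HVir.Vac.one cL cLI ∧
        Ψ.toLinearMap (W22.W (-2) • W22.Vac.one cL cW) =
          (HVir.I (-1) ^ 2 + (2 * cLI) • HVir.I (-2)) • HVir.Vac.one cL cLI ∧
        ∀ h hI hW : ℂ, hW = hI * (hI - 2 * cLI) →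
          (∃! S : B.Mod (HVir.Verma cL 0 cLI h hI), HVir.IsCompatible S) ∧
          ∀ S : B.Mod (HVir.Verma cL 0 cLI h hI), HVir.IsCompatible S →
            ∃ Φ : W22.Verma cL cW h hW →ₗ[ℂ] HVir.Verma cL 0 cLI h hI,
              Φ (W22.Verma.hwv cL cW h hW) = HVir.Verma.hwv cL 0 cLI h hI ∧
              (∀ (n : ℤ) (x : W22.Verma cL cW h hW),
                Φ (W22.L n • x) =
                  ((S.restrict Ψ).Y (W22.L (-2) • W22.Vac.one cL cW)).ncoeff (n + 1) (Φ x)) ∧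
              (∀ (n : ℤ) (x : W22.Verma cL cW h hW),
                Φ (W22.W n • x) =
                  ((S.restrict Ψ).Y (W22.W (-2) • W22.Vac.one cL cW)).ncoeff (n + 1) (Φ x)) ∧
              ((∀ m : ℕ, 0 < m → hI / cLI - 1 ≠ -(m : ℂ)) → Function.Bijective Φ) := by
  subst hcW
  refine ⟨W22.existsUnique_vertexAlgebra _ _, HVir.existsUnique_vertexAlgebra cL hcLI, ?_⟩
  intro A B hA hB
  obtain ⟨Ψ, h1, hω, hw⟩ := W22.exists_hom_toHVir hcLI hA hB
  refine ⟨Ψ, fun h0 => HVir.Vac.one_ne_zero (cL := cL) hcLI ?_, hω, hw, ?_⟩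
  · rw [← h1, h0, LinearMap.zero_apply]
  rintro h hI hW rfl
  obtain ⟨fL, fI, hf, ha⟩ := HVir.Verma.exists_fields cL cLI h hI
  refine ⟨HVir.existsUnique_mod hcLI hB hf ha, fun S hS => ?_⟩
  obtain ⟨gL, gI, hg, hb⟩ := HVir.Vac.exists_fields cL hcLI
  obtain ⟨Φ, hΦ1, hΦL, hΦW⟩ := W22.Verma.exists_toHVir hf ha
  refine ⟨Φ, hΦ1, fun n x => ?_, fun n x => ?_, fun hm => ?_⟩
  · have e : (S.restrict Ψ).Y (W22.L (-2) • W22.Vac.one cL (-24 * cLI ^ 2)) =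
        S.Y (HVir.L (-2) • HVir.Vac.one cL cLI) := congrArg S.Y hω
    rw [e, hS.omega, hΦL, ha.mode_L]
  · have e : (S.restrict Ψ).Y (W22.W (-2) • W22.Vac.one cL (-24 * cLI ^ 2)) =
        S.Y ((HVir.I (-1) ^ 2 + (2 * cLI) • HVir.I (-2)) • HVir.Vac.one cL cLI) := congrArg S.Y hw
    rw [e, hb.map_wVector (hS.isFieldMap hB hb ha), hΦW]
  -- With `m = n + 1` the excluded equality `hI / cLI - 1 = -m` reads `hI + n cLI = 0`.
  · refine W22.Verma.bijective_of_toHVir hcLI (fun n hn => hm (n + 1) n.succ_pos ?_) hf ha hΦ1 hΦL hΦW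
    field_simp
    push_cast
    linear_combination hn
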